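/- **Model.** $K\ge1$ sources produce random vectors $X_n=(X_n^1,\dots,X_n^K)$, $n\ge 1$, independent over time (the coordinates of each $X_n$ may be dependent). At an unknown deterministic time $\nu\in\{0,1,2,\dots\}$ the distribution changes: $X_n\sim\mathsf F$ for $n\le\nu$ and $X_n\sim\mathsf G$ for $n>\nu$, where $\mathsf F$ is known and $\mathsf G$ belongs to a family $\mathcal G$. Write $\mathsf F^k,\mathsf G^k$ for the $k$-th marginals, $\mathcal A(\mathsf G)=\{k:\mathsf G^k\ne\mathsf F^k\}$ for the set of affected sources and $\mathcal G^k=\{\mathsf G^k:\mathsf G\in\mathcal G,\ \mathsf G^k\neq\mathsf F^k\}$. Assume that $\mathcal A(\mathsf G)\ne\emptyset$ for every $\mathsf G\in\mathcal G$, that $\mathsf G^k$ and $\mathsf F^k$ are mutually absolutely continuous for every $\mathsf G\in\mathcal G$ and $k\in\mathcal A(\mathsf G)$, and that each $\mathcal G^k$ is finite and non-empty. Put $$\mathsf H^k=\frac1{|\mathcal G^k|}\sum_{\mathsf P\in\mathcal G^k}\mathsf P,\qquad \xi^k=\log\frac{d\mathsf H^k}{d\mathsf F^k},\qquad \mathcal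 I_0^k(\mathsf G)=\int\log\frac{d\mathsf G^k}{d\mathsf F^k}\,d\mathsf G^k,\qquad \mathcal J_0^k(\mathsf G)=\int\xi^k\,d\mathsf G^k,\qquad \mathcal J^k_\infty=\int\log\frac{d\mathsf F^k}{d\mathsf H^k}\,d\mathsf F^k .$$ **Policies.** At each time exactly one source is sampled ($m=1$). A policy $(S,T)$ consists of a sampling rule $S=(S_n)_{n\ge1}$ and a stopping time $T\ge1$ (possibly infinite) of the filtration $\mathcal F_n^S=\sigma(\mathcal F_{n-1}^S,X_n^{S_n})$, where $\mathcal F^S_0$ is independent of the data and $S_n$ is $\mathcal F_{n-1}^S$-measurable. For $\gamma>1$, $\Delta(\gamma)$ is the class of policies with $\mathbb E_\infty[T]\ge\gamma$ (expectation when no change occurs). The worst-case delay under $\mathsf G$ is $$D^{\mathsf G}(S,T)=\sup_{\nu\ge0}\ \operatorname{ess\,sup}\ \mathbb E_\nu^{\mathsf G}\big[T-\nu\,\big|\,\mathcal F_\nu^S(\mathsf G),\,T>\nu\big],\qquad \mathcal F_\nu^S(\mathsf G)=\sigma\big(S_t,X_t^{S_t}: t\le\nu,\ S_t\in\mathcal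 A(\mathsf G)\big).$$ **Round Robin CUSUM.** Fix any permutation of the sources and let $A=\log\gamma$. The policy $(\tilde S,\tilde T)$ starts with the first source in the permutation, sets $Y_0=0$, $Y_n=\max\{Y_{n-1},0\}+\xi^{\tilde S_n}(X_n^{\tilde S_n})$, keeps sampling the same source while $Y_n\in(0,A)$, moves cyclically to the next source when $Y_n\le0$, and stops at $\tilde T=\inf\{n\ge1:Y_n\ge A\}$. **Proposition.** Let $\mathsf G\in\mathcal G$ satisfy $\int\big(\log\frac{d\mathsf G^k}{d\mathsf F^k}\big)^2d\mathsf G^k<\infty$ for every $k\in\mathcal A(\mathsf G)$. Suppose that $\mathsf H^k\ne\mathsf F^k$ and $\mathcal J_\infty^k<\infty$ for every $k$, and that for every $k\in\mathcal A(\mathsf G)$ the expectation of $\xi^k$ is finite and has the same value under every $\mathsf P\in\mathcal G^k$. (i) $D^{\mathsf G}(\tilde S,\tilde T)<\infty$ for all large $\gamma$, and $$\mathsf{ARE}^{\mathsf G}(\tilde S,\tilde T):=\limsup_{\gamma\to\infty}\frac{D^{\mathsf G}(\tilde S,\tilde T)}{\inf\{D^{\mathsf G}(S,T):(S,T)\in\Delta(\gamma)\}}\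 \le\ \frac{\max\{\mathcal I_0^k(\mathsf G):k\in\mathcal A(\mathsf G)\}}{\min\{\mathcal J_0^k(\mathsf G):k\in\mathcal A(\mathsf G)\}} .$$ (ii) If, in addition, $\mathcal G^k$ is a singleton for every affected source $k\in\mathcal A(\mathsf G)$ and $\mathcal I_0^k(\mathsf G)$ has the same value for all $k\in\mathcal A(\mathsf G)$, then $(\tilde S,\tilde T)$ is asymptotically optimal under $\mathsf G$: $$\frac{D^{\mathsf G}(\tilde S,\tilde T)}{\inf\{D^{\mathsf G}(S,T):(S,T)\in\Delta(\gamma)\}}\longrightarrow1\qquad(\gamma\to\infty).$$ -/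

import Mathlib

open MeasureTheory ProbabilityTheory Filter Topology
open scoped ENNReal

noncomputable section

namespace RoundRobinCusum

universe u

variable {K : ℕ} {𝓧 : Fin K → Type u} [∀ k, MeasurableSpace (𝓧 k)]

/-! ### The multi-source change-point model -/

/-- The marginal ("local") distribution of source `k` when the global distribution is `F`. -/
def marginal (F : ProbabilityMeasure (∀ k, 𝓧 k)) (k : Fin K) : Measure (𝓧 k) :=
  (F : Measure (∀ k, 𝓧 k)).map (fun x => x k)

open scoped Classical in
/-- The set of sources whose marginal distribution changes when the global distribution changes
from `F` to `G`. -/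
def affected (F G : ProbabilityMeasure (∀ k, 𝓧 k)) : Finset (Fin K) :=
  Finset.univ.filter (fun k => marginal G k ≠ marginal F k)

/-- The family of all plausible post-change marginal distributions of source `k`. -/
def postFamily (F : ProbabilityMeasure (∀ k, 𝓧 k)) (𝒢 : Set (ProbabilityMeasure (∀ k, 𝓧 k)))
    (k : Fin K) : Set (Measure (𝓧 k)) :=
  {P | ∃ G ∈ 𝒢, P = marginal G k ∧ marginal G k ≠ marginal F k}

/-- The uniform mixture of the members of the (finite, non-empty) family of all plausible
post-change marginal distributions of source `k`. -/
def mixture (F : ProbabilityMeasure (∀ k, 𝓧 k)) (𝒢 : Set (ProbabilityMeasure (∀ k, 𝓧 k)))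
    (k : Fin K) : Measure (𝓧 k) :=
  ((postFamily F 𝒢 k).ncard : ℝ≥0∞)⁻¹ •
    Measure.sum (fun P : postFamily F 𝒢 k => (P : Measure (𝓧 k)))

/-- The log-likelihood ratio of the mixture versus the pre-change marginal of source `k`. -/
def xi (F : ProbabilityMeasure (∀ k, 𝓧 k)) (𝒢 : Set (ProbabilityMeasure (∀ k, 𝓧 k)))
    (k : Fin K) : 𝓧 k → ℝ :=
  llr (mixture F 𝒢 k) (marginal F k)

/-- The Kullback-Leibler information number of source `k` under `G`:
`∫ log (dG^k / dF^k) dG^k`. -/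
def infoI (F G : ProbabilityMeasure (∀ k, 𝓧 k)) (k : Fin K) : ℝ :=
  ∫ x, llr (marginal G k) (marginal F k) x ∂(marginal G k)

/-- The post-change drift `∫ log (dH^k / dF^k) dG^k`, where `H^k` is the mixture. -/
def driftJ (F : ProbabilityMeasure (∀ k, 𝓧 k)) (𝒢 : Set (ProbabilityMeasure (∀ k, 𝓧 k)))
    (G : ProbabilityMeasure (∀ k, 𝓧 k)) (k : Fin K) : ℝ :=
  ∫ x, xi F 𝒢 k x ∂(marginal G k)

/-! ### Sampling and detection policies, one source sampled at each time

A data sequence is `x : ℕ → ∀ k, 𝓧 k`, where `x n` is the vector of all sources at time `n + 1`. -/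

/-- What is observed at time `n + 1`: the label of the sampled source and its value. -/
def obs {R : Type} (S : ℕ → R × (ℕ → ∀ k, 𝓧 k) → Fin K) (n : ℕ)
    (ω : R × (ℕ → ∀ k, 𝓧 k)) : Σ k, 𝓧 k :=
  ⟨S n ω, ω.2 n (S n ω)⟩

/-- The filtration of the collected observations: at time `0` it contains only the auxiliary
randomization, and at time `n + 1` the observation at time `n + 1` is added. -/
def obsSigma {R : Type} [MeasurableSpace R] (S : ℕ → R × (ℕ → ∀ k, 𝓧 k) → Fin K) :
    ℕ → MeasurableSpace (R × (ℕ → ∀ k, 𝓧 k))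
  | 0 => MeasurableSpace.comap Prod.fst inferInstance
  | n + 1 => obsSigma S n ⊔ MeasurableSpace.comap (obs S n) inferInstance

variable (K 𝓧) in
/-- A joint sequential sampling rule and change-detection policy. The randomization space `(R, ρ)`
is independent of the data; `S n` is the source sampled at time `n + 1`, chosen on the basis of the
observations up to time `n`; `T` is the positive time at which the alarm is raised (`T = ⊤` if it is
never raised). -/
structure Policy where
  /-- the space of the auxiliary randomization -/
  R : Type
  /-- its σ-algebra -/
  [mR : MeasurableSpace R]
  /-- its law -/
  ρ : ProbabilityMeasure R
  /-- the sampling rule -/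
  S : ℕ → R × (ℕ → ∀ k, 𝓧 k) → Fin K
  /-- the stopping time -/
  T : R × (ℕ → ∀ k, 𝓧 k) → ℕ∞
  measurable_S : ∀ n, Measurable[obsSigma S n] (S n)
  one_le_T : ∀ ω, 1 ≤ T ω
  measurableSet_T : ∀ n : ℕ, MeasurableSet[obsSigma S n] {ω | T ω = n}

attribute [instance] Policy.mR

/-- The sample space of a policy: auxiliary randomization and data. -/
abbrev Policy.Ω (p : Policy K 𝓧) : Type u := p.R × (ℕ → ∀ k, 𝓧 k)

/-- The law when there is no change: all vectors are independent with distribution `F`. -/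
def Policy.lawInf (p : Policy K 𝓧) (F : ProbabilityMeasure (∀ k, 𝓧 k)) : Measure p.Ω :=
  (p.ρ : Measure p.R).prod
    (Measure.infinitePi (fun _ : ℕ => (F : Measure (∀ k, 𝓧 k))))

/-- The law when the change happens at time `ν`: the vectors at the times `1, …, ν` have
distribution `F`, those at later times have distribution `G`, and all are independent. -/
def Policy.law (p : Policy K 𝓧) (F G : ProbabilityMeasure (∀ k, 𝓧 k)) (ν : ℕ) : Measure p.Ω :=
  (p.ρ : Measure p.R).prod
    (Measure.infinitePi
      (fun n : ℕ => ((if n < ν then F else G : ProbabilityMeasure (∀ k, 𝓧 k)) :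
        Measure (∀ k, 𝓧 k))))

/-- The policies whose expected time to a false alarm is at least `γ`. -/
def Delta (F : ProbabilityMeasure (∀ k, 𝓧 k)) (γ : ℝ) : Set (Policy K 𝓧) :=
  {p | ENNReal.ofReal γ ≤ ∫⁻ ω, (p.T ω : ℝ≥0∞) ∂(p.lawInf F)}

/-- The σ-algebra of the observations from the affected sources up to time `ν`: it is generated by
the events "an affected source `k` is sampled at time `t` and its value is in `B`", `t ≤ ν`. -/
def Policy.affectedHistory (p : Policy K 𝓧) (F G : ProbabilityMeasure (∀ k, 𝓧 k)) (ν : ℕ) :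
    MeasurableSpace p.Ω :=
  MeasurableSpace.generateFrom
    {E | ∃ t < ν, ∃ k ∈ affected F G, ∃ B : Set (𝓧 k), MeasurableSet B ∧
      E = {ω : p.Ω | p.S t ω = k ∧ ω.2 t k ∈ B}}

theorem Policy.obsSigma_le (p : Policy K 𝓧) (n : ℕ) :
    obsSigma p.S n ≤ (inferInstance : MeasurableSpace p.Ω) := by
  induction n with
  | zero => exact measurable_fst.comap_le
  | succ n ih =>
    refine sup_le ih (Measurable.comap_le ?_)
    have hS : Measurable (p.S n) := (p.measurable_S n).mono ih le_rfl
    intro B hB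
    have : obs p.S n ⁻¹' B = ⋃ k, {ω : p.Ω | p.S n ω = k} ∩
        (fun ω : p.Ω => ω.2 n k) ⁻¹' (Sigma.mk k ⁻¹' B) := by
      ext ω
      simp only [obs, Set.mem_preimage, Set.mem_iUnion, Set.mem_inter_iff]
      constructor
      · intro h
        exact ⟨p.S n ω, rfl, h⟩
      · rintro ⟨k, rfl, h⟩
        exact h
    rw [this]
    refine MeasurableSet.iUnion fun k => (hS (measurableSet_singleton k)).inter ?_
    have hB' := MeasurableSpace.measurableSet_iInf.1 hB k
    have hk : Measurable (fun ω : p.Ω => ω.2 n k) := by fun_prop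
    exact hk hB'

/-- The history is a sub-σ-algebra, so that conditioning on it is meaningful. -/
theorem Policy.affectedHistory_le (p : Policy K 𝓧) (F G : ProbabilityMeasure (∀ k, 𝓧 k)) (ν : ℕ) :
    p.affectedHistory F G ν ≤ (inferInstance : MeasurableSpace p.Ω) := by
  refine MeasurableSpace.generateFrom_le ?_
  rintro _ ⟨t, _, k, _, B, hB, rfl⟩
  have hS : Measurable (p.S t) := (p.measurable_S t).mono (p.obsSigma_le t) le_rfl
  have hk : Measurable (fun ω : p.Ω => ω.2 t k) := by fun_prop
  exact (hS (measurableSet_singleton k)).inter (hk hB)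

/-- The worst-case conditional expected detection delay: the supremum over the change-point `ν` of
the essential supremum of the conditional expectation of `T - ν` given the event `T > ν` and the
observations from the affected sources up to time `ν`. -/
def Policy.delay (p : Policy K 𝓧) (F G : ProbabilityMeasure (∀ k, 𝓧 k)) : ℝ≥0∞ :=
  ⨆ ν : ℕ, essSup
    (condLExp (p.affectedHistory F G ν) (cond (p.law F G ν) {ω | (ν : ℕ∞) < p.T ω})
      (fun ω => ((p.T ω - (ν : ℕ∞) : ℕ∞) : ℝ≥0∞)))
    (cond (p.law F G ν) {ω | (ν : ℕ∞) < p.T ω})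

/-- The optimal worst-case delay among all policies with expected time to false alarm
at least `γ`. -/
def optimalDelay (F G : ProbabilityMeasure (∀ k, 𝓧 k)) (γ : ℝ) : ℝ≥0∞ :=
  ⨅ p ∈ Delta F γ, Policy.delay p F G

/-! ### The round robin CUSUM policy -/

variable [NeZero K]

/-- After `n` observations: the position (in the permutation `σ`) of the source to be sampled at
time `n + 1`, and the statistic `Y_n`. The addition `d + 1` in `Fin K` is cyclic. -/
def rrState (ξ : ∀ k, 𝓧 k → ℝ) (σ : Equiv.Perm (Fin K)) (x : ℕ → ∀ k, 𝓧 k) : ℕ → Fin K × ℝ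
  | 0 => (0, 0)
  | n + 1 =>
    let d := (rrState ξ σ x n).1
    let y := max (rrState ξ σ x n).2 0 + ξ (σ d) (x n (σ d))
    (if y ≤ 0 then d + 1 else d, y)

/-- The source sampled at time `n + 1` (the policy uses no randomization). -/
def rrS (ξ : ∀ k, 𝓧 k → ℝ) (σ : Equiv.Perm (Fin K)) (n : ℕ)
    (ω : Unit × (ℕ → ∀ k, 𝓧 k)) : Fin K :=
  σ (rrState ξ σ ω.2 n).1

/-- The first time `n ≥ 1` at which `Y_n ≥ A` (and `⊤` if there is none). -/
def rrT (ξ : ∀ k, 𝓧 k → ℝ) (σ : Equiv.Perm (Fin K)) (A : ℝ)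
    (ω : Unit × (ℕ → ∀ k, 𝓧 k)) : ℕ∞ :=
  ⨅ (n : ℕ) (_ : 1 ≤ n ∧ A ≤ (rrState ξ σ ω.2 n).2), (n : ℕ∞)

theorem measurable_sigma_uncurry {ξ : ∀ k, 𝓧 k → ℝ} (hξ : ∀ k, Measurable (ξ k)) :
    Measurable (fun s : Σ k, 𝓧 k => ξ s.1 s.2) := by
  intro B hB
  refine MeasurableSpace.measurableSet_iInf.2 fun k => ?_
  exact hξ k hB

theorem obsSigma_mono {R : Type} [MeasurableSpace R] (S : ℕ → R × (ℕ → ∀ k, 𝓧 k) → Fin K) :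
    Monotone (obsSigma S) :=
  monotone_nat_of_le_succ fun _ => le_sup_left

theorem measurable_rrState {ξ : ∀ k, 𝓧 k → ℝ} (hξ : ∀ k, Measurable (ξ k))
    (σ : Equiv.Perm (Fin K)) (n : ℕ) :
    Measurable[obsSigma (rrS ξ σ) n] (fun ω => rrState ξ σ ω.2 n) := by
  induction n with
  | zero => exact @measurable_const _ _ _ (obsSigma (rrS ξ σ) 0) _
  | succ n ih =>
    letI : MeasurableSpace (Unit × (ℕ → ∀ k, 𝓧 k)) := obsSigma (rrS ξ σ) (n + 1)
    have ih' : Measurable (fun ω : Unit × (ℕ → ∀ k, 𝓧 k) => rrState ξ σ ω.2 n) :=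
      ih.mono le_sup_left le_rfl
    have ho : Measurable (obs (rrS ξ σ) n) :=
      (comap_measurable (obs (rrS ξ σ) n)).mono le_sup_right le_rfl
    have hy : Measurable (fun ω : Unit × (ℕ → ∀ k, 𝓧 k) =>
        max (rrState ξ σ ω.2 n).2 0 +
          ξ (σ (rrState ξ σ ω.2 n).1) (ω.2 n (σ (rrState ξ σ ω.2 n).1))) :=
      (ih'.snd.max measurable_const).add ((measurable_sigma_uncurry hξ).comp ho)
    have hd : Measurable (fun ω : Unit × (ℕ → ∀ k, 𝓧 k) => (rrState ξ σ ω.2 n).1 + 1) :=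
      (measurable_of_countable (fun d : Fin K => d + 1)).comp ih'.fst
    exact (Measurable.ite (measurableSet_le hy measurable_const) hd ih'.fst).prodMk hy

theorem rrT_le_iff (ξ : ∀ k, 𝓧 k → ℝ) (σ : Equiv.Perm (Fin K)) (A : ℝ)
    (ω : Unit × (ℕ → ∀ k, 𝓧 k)) (n : ℕ) :
    rrT ξ σ A ω ≤ n ↔ ∃ j ≤ n, 1 ≤ j ∧ A ≤ (rrState ξ σ ω.2 j).2 := by
  constructor
  · intro h
    by_contra! hc
    have h1 : ((n + 1 : ℕ) : ℕ∞) ≤ rrT ξ σ A ω := by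
      refine le_iInf₂ fun j hj => ?_
      by_contra! hlt
      have hj' : j ≤ n := by
        have : j < n + 1 := by exact_mod_cast hlt
        omega
      exact absurd hj.2 (not_le.2 (hc j hj' hj.1))
    have h2 : n + 1 ≤ n := by exact_mod_cast h1.trans h
    omega
  · rintro ⟨j, hjn, hj⟩
    exact (iInf₂_le j hj).trans (by exact_mod_cast hjn)

theorem measurableSet_rrT_le {ξ : ∀ k, 𝓧 k → ℝ} (hξ : ∀ k, Measurable (ξ k))
    (σ : Equiv.Perm (Fin K)) (A : ℝ) (n : ℕ) :
    MeasurableSet[obsSigma (rrS ξ σ) n] {ω | rrT ξ σ A ω ≤ n} := by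
  letI : MeasurableSpace (Unit × (ℕ → ∀ k, 𝓧 k)) := obsSigma (rrS ξ σ) n
  have : {ω | rrT ξ σ A ω ≤ n} = ⋃ j ∈ {j : ℕ | j ≤ n ∧ 1 ≤ j},
      {ω : Unit × (ℕ → ∀ k, 𝓧 k) | A ≤ (rrState ξ σ ω.2 j).2} := by
    ext ω
    simp [rrT_le_iff, and_assoc]
  rw [this]
  refine MeasurableSet.biUnion (Set.to_countable _) fun j hj => ?_
  have hm : Measurable (fun ω : Unit × (ℕ → ∀ k, 𝓧 k) => rrState ξ σ ω.2 j) :=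
    (measurable_rrState hξ σ j).mono (obsSigma_mono _ hj.1) le_rfl
  exact measurableSet_le measurable_const hm.snd

/-- The round robin CUSUM policy with increments `ξ`, order of the sources given by the permutation
`σ`, and threshold `A`. -/
def roundRobin (ξ : ∀ k, 𝓧 k → ℝ) (hξ : ∀ k, Measurable (ξ k)) (σ : Equiv.Perm (Fin K)) (A : ℝ) :
    Policy K 𝓧 where
  R := Unit
  ρ := ⟨Measure.dirac (), inferInstance⟩
  S := rrS ξ σ
  T := rrT ξ σ A
  measurable_S n :=
    @Measurable.comp _ _ _ (obsSigma (rrS ξ σ) n) _ _ _ _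
      (measurable_of_countable fun d : Fin K => σ d) (measurable_rrState hξ σ n).fst
  one_le_T ω := le_iInf₂ fun n hn => by exact_mod_cast hn.1
  measurableSet_T n := by
    have h := measurableSet_rrT_le hξ σ A n
    cases n with
    | zero =>
      have : {ω | rrT ξ σ A ω = (0 : ℕ)} = {ω | rrT ξ σ A ω ≤ (0 : ℕ)} := by
        ext ω; simp
      rw [this]; exact h
    | succ n =>
      have h' := obsSigma_mono (rrS ξ σ) n.le_succ _ (measurableSet_rrT_le hξ σ A n)
      have : {ω | rrT ξ σ A ω = (n + 1 : ℕ)} =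
          {ω | rrT ξ σ A ω ≤ (n + 1 : ℕ)} \ {ω | rrT ξ σ A ω ≤ n} := by
        ext ω
        simp only [Set.mem_ofPred_eq, Set.mem_sdiff, not_le]
        rw [← ENat.add_one_le_iff (ENat.natCast_ne_top n), ← Nat.cast_succ]
        exact le_antisymm_iff
      rw [this]
      exact @MeasurableSet.diff _ (obsSigma (rrS ξ σ) (n + 1)) _ _ h h'

theorem measurable_xi (F : ProbabilityMeasure (∀ k, 𝓧 k))
    (𝒢 : Set (ProbabilityMeasure (∀ k, 𝓧 k))) (k : Fin K) : Measurable (xi F 𝒢 k) :=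
  measurable_llr _ _

/-- The round robin CUSUM policy at the level `γ`: its increments are the log-likelihood ratios of
the mixtures versus the pre-change marginals, and its threshold is `A = log γ`. -/
def rrPolicy (F : ProbabilityMeasure (∀ k, 𝓧 k)) (𝒢 : Set (ProbabilityMeasure (∀ k, 𝓧 k)))
    (σ : Equiv.Perm (Fin K)) (γ : ℝ) : Policy K 𝓧 :=
  roundRobin (xi F 𝒢) (measurable_xi F 𝒢) σ (Real.log γ)

/-- The ratio of the worst-case delay of the round robin CUSUM policy to the optimal one. -/
def delayRatio (F : ProbabilityMeasure (∀ k, 𝓧 k)) (𝒢 : Set (ProbabilityMeasure (∀ k, 𝓧 k)))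
    (σ : Equiv.Perm (Fin K)) (G : ProbabilityMeasure (∀ k, 𝓧 k)) (γ : ℝ) : ℝ≥0∞ :=
  (rrPolicy F 𝒢 σ γ).delay F G / optimalDelay F G γ

/-- The asymptotic relative efficiency of the round robin CUSUM policy under `G`. -/
def ARE (F : ProbabilityMeasure (∀ k, 𝓧 k)) (𝒢 : Set (ProbabilityMeasure (∀ k, 𝓧 k)))
    (σ : Equiv.Perm (Fin K)) (G : ProbabilityMeasure (∀ k, 𝓧 k)) : ℝ≥0∞ :=
  limsup (delayRatio F 𝒢 σ G) atTop

/-- Asymptotic optimality of the round robin CUSUM policy under `G`: its worst-case delay is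
asymptotically equivalent to the optimal one as `γ → ∞`. -/
def AsymptoticallyOptimal (F : ProbabilityMeasure (∀ k, 𝓧 k))
    (𝒢 : Set (ProbabilityMeasure (∀ k, 𝓧 k)))
    (σ : Equiv.Perm (Fin K)) (G : ProbabilityMeasure (∀ k, 𝓧 k)) : Prop :=
  Tendsto (delayRatio F 𝒢 σ G) atTop (𝓝 1)

end RoundRobinCusum

end

/-! Put A = log γ, let I be the largest information number and J the smallest drift over the
affected sources. The optimal delay is asymptotically at least A/I and the delay of the Round Robin
CUSUM is asymptotically at most A/J; dividing gives (i).

Lower bound (`le_optimalDelay`). If the mean time to false alarm is at least γ, some ν has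
conditional probability at most 2m/γ of an alarm in the next m steps. Passing to the law with change
at ν multiplies this by the likelihood ratio of the sampled observations. Whatever is sampled, its
logarithm has conditional drift at most I per step, so up to a deviation controlled by Chebyshev's
inequality the factor is at most exp(mI + b). With m slightly below A/I an alarm within m steps
stays unlikely, and the delay is nearly m.

Upper bound (`roundRobin_delay_le`). A Lyapunov function of the state decreases by at least one per
step in the mean after the change. On affected sources it is about (A - y)/c with c just below J,
plus a bounded cost for possibly leaving the source. On unaffected sources it adds a bounded cost
and y/j, the time to drift back below 0. The affected drifts are positive because they coincide with
the drift under the mixture, which is a Kullback-Leibler number.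

The obstacle is y/j: at the change-point an unaffected source may be under sampling with a statistic
of order A, and the change-point and the affected history are chosen adversarially. During such a
run that history is frozen, so the statistic is a random walk started at 0 and conditioned to stay
in (0, A) for n steps. Its mean has to be o(A) uniformly in n
(`eventually_killedStep_iterate_ofReal_le`). Here the n-th iterate of `killedStep` maps f to the
expectation of f at time n on survival. Let θ minimize the moment generating function, with minimum
ρ. Chernoff's inequality bounds the probability of survival ending above εA/2 by ρ^n exp(θ(y -
εA/2)). Steering the walk down with a tilting just below θ, and then keeping it in a tube by the
centred tilting, gives survival probability at least ρ^n exp(θy) up to a factor exp(-κηA) with η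
arbitrarily small. The quotient is negligible. Only periods of length O(A) need this estimate, since
a longer survival can be conditioned on its state that many steps before the end.

For (ii) the mixture is the true marginal, so I = J. The ratio is at least one because the policy
meets the false alarm constraint, by a supermartingale argument (`exp_le_lintegral_rrT`). -/

noncomputable section

namespace RoundRobinCusum

/-! ### Random walks killed outside an interval -/

/-- One step of a random walk with increment law `μ`, reflected at `0` before the step and killed
when it leaves `(0, A)`. -/
def killedStep (μ : Measure ℝ) (A : ℝ) (f : ℝ → ℝ≥0∞) (y : ℝ) : ℝ≥0∞ :=
  ∫⁻ x, (Set.Ioo 0 A).indicator f (max y 0 + x) ∂μ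

variable {μ : Measure ℝ} {A : ℝ}

theorem killedStep_mono_of_Ioo {f g : ℝ → ℝ≥0∞} (h : ∀ y ∈ Set.Ioo 0 A, f y ≤ g y) (y : ℝ) :
    killedStep μ A f y ≤ killedStep μ A g y := by
  refine lintegral_mono fun x => ?_
  by_cases hx : max y 0 + x ∈ Set.Ioo 0 A
  · simpa [Set.indicator_of_mem hx] using h _ hx
  · simp [Set.indicator_of_notMem hx]

theorem killedStep_iterate_mono (n : ℕ) {f g : ℝ → ℝ≥0∞} (h : ∀ y, f y ≤ g y) (y : ℝ) :
    (killedStep μ A)^[n] f y ≤ (killedStep μ A)^[n] g y := by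
  induction n generalizing f g with
  | zero => exact h y
  | succ n ih =>
    rw [Function.iterate_succ_apply, Function.iterate_succ_apply]
    exact ih fun y => killedStep_mono_of_Ioo (fun y _ => h y) y

/-- The first application of the operator reads f only on (0, A), so a comparison there is enough.
This fails for zero steps, hence the exponent n + 1. -/
theorem killedStep_iterate_succ_mono (n : ℕ) {f g : ℝ → ℝ≥0∞}
    (h : ∀ y ∈ Set.Ioo 0 A, f y ≤ g y) (y : ℝ) :
    (killedStep μ A)^[n + 1] f y ≤ (killedStep μ A)^[n + 1] g y := by
  rw [Function.iterate_succ_apply, Function.iterate_succ_apply]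
  exact killedStep_iterate_mono n (killedStep_mono_of_Ioo h) y

theorem measurable_killedStep [SFinite μ] {f : ℝ → ℝ≥0∞} (hf : Measurable f) :
    Measurable (killedStep μ A f) := by
  have h : Measurable (fun p : ℝ × ℝ => (Set.Ioo 0 A).indicator f (max p.1 0 + p.2)) :=
    (hf.indicator measurableSet_Ioo).comp (by fun_prop)
  exact h.lintegral_prod_right'

theorem killedStep_iterate_const_mul (n : ℕ) {c : ℝ≥0∞} (hc : c ≠ ⊤) (f : ℝ → ℝ≥0∞) (y : ℝ) :
    (killedStep μ A)^[n] (fun z => c * f z) y = c * (killedStep μ A)^[n] f y := by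
  induction n generalizing f with
  | zero => rfl
  | succ n ih =>
    rw [Function.iterate_succ_apply, Function.iterate_succ_apply, ← ih]
    refine congrArg (fun g => (killedStep μ A)^[n] g y) (funext fun z => ?_)
    unfold killedStep
    rw [← lintegral_const_mul' _ _ hc]
    refine lintegral_congr fun x => ?_
    by_cases hx : max z 0 + x ∈ Set.Ioo 0 A
    · simp [Set.indicator_of_mem hx]
    · simp [Set.indicator_of_notMem hx]

theorem killedStep_iterate_add [SFinite μ] (n : ℕ) {f : ℝ → ℝ≥0∞} (hf : Measurable f)
    (g : ℝ → ℝ≥0∞) (y : ℝ) :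
    (killedStep μ A)^[n] (fun z => f z + g z) y =
      (killedStep μ A)^[n] f y + (killedStep μ A)^[n] g y := by
  induction n generalizing f g with
  | zero => rfl
  | succ n ih =>
    rw [Function.iterate_succ_apply, Function.iterate_succ_apply, Function.iterate_succ_apply,
      ← ih (measurable_killedStep hf)]
    refine congrArg (fun g => (killedStep μ A)^[n] g y) (funext fun z => ?_)
    unfold killedStep
    have hm : Measurable (fun x => (Set.Ioo 0 A).indicator f (max z 0 + x)) :=
      (hf.indicator measurableSet_Ioo).comp (by fun_prop)
    rw [← lintegral_add_left hm]
    refine lintegral_congr fun x => ?_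
    by_cases hx : max z 0 + x ∈ Set.Ioo 0 A
    · simp [Set.indicator_of_mem hx]
    · simp [Set.indicator_of_notMem hx]

/-- If the increments lie in `[u, v]` with probability at least `p`, the walk makes `j` such steps
in a row with probability at least `p ^ j`. -/
theorem pow_mul_le_killedStep_iterate {u v : ℝ} {p B : ℝ≥0∞} (hp : p ≤ μ (Set.Icc u v))
    (j : ℕ) (f : ℝ → ℝ≥0∞) (y : ℝ) (hy : 0 ≤ y)
    (hpos : ∀ i : ℕ, 1 ≤ i → i ≤ j → 0 < y + i * u ∧ y + i * v < A)
    (hf : ∀ z ∈ Set.Icc (y + j * u) (y + j * v), B ≤ f z) :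
    p ^ j * B ≤ (killedStep μ A)^[j] f y := by
  induction j generalizing f B with
  | zero => simpa using hf y (by simp)
  | succ j ih =>
    rw [Function.iterate_succ_apply, pow_succ, mul_assoc]
    refine ih _ (fun i h1 h2 => hpos i h1 (by omega)) fun z hz => ?_
    have hz0 : 0 ≤ z := by
      rcases Nat.eq_zero_or_pos j with rfl | hj
      · simp at hz; linarith
      · exact (hpos j hj (by omega)).1.le.trans hz.1
    obtain ⟨h3, h4⟩ := hpos (j + 1) (by omega) le_rfl
    push_cast at h3 h4 hf
    calc p * B ≤ ∫⁻ x in Set.Icc u v, B ∂μ := by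
          rw [setLIntegral_const, mul_comm]; gcongr
      _ ≤ ∫⁻ x in Set.Icc u v, (Set.Ioo 0 A).indicator f (max z 0 + x) ∂μ := by
          refine setLIntegral_mono' measurableSet_Icc fun x hx => ?_
          rw [max_eq_left hz0, Set.indicator_of_mem]
          · exact hf _ ⟨by linarith [hz.1, hx.1], by linarith [hz.2, hx.2]⟩
          · exact ⟨by linarith [hz.1, hx.1], by linarith [hz.2, hx.2]⟩
      _ ≤ _ := setLIntegral_le_lintegral _ _

/-- The exponential tilting of `μ` with parameter `θ` has mass `ψ`, mean `-δ` and variance `s`. -/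
structure Tilting (μ : Measure ℝ) (θ ψ δ s : ℝ) : Prop where
  integrable : Integrable (fun x => Real.exp (θ * x)) μ
  integrable_mul : Integrable (fun x => x * Real.exp (θ * x)) μ
  integrable_sq_mul : Integrable (fun x => x ^ 2 * Real.exp (θ * x)) μ
  mass : ∫ x, Real.exp (θ * x) ∂μ = ψ
  mean : ∫ x, x * Real.exp (θ * x) ∂μ = -δ * ψ
  variance : ∫ x, (x + δ) ^ 2 * Real.exp (θ * x) ∂μ = s * ψ
  pos : 0 < ψ

/-- Under the tilted law x + δ is centred with variance s, so the quadratic keeps its shape and b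
grows by s. Iterating this is Chebyshev's inequality for the tilted walk. -/
theorem Tilting.integral_quadratic {θ ψ δ s : ℝ} (t : Tilting μ θ ψ δ s) (w b q : ℝ) :
    Integrable (fun x => Real.exp (θ * x) * (1 - ((w + (x + δ)) ^ 2 + b) * q)) μ ∧
    ∫ x, Real.exp (θ * x) * (1 - ((w + (x + δ)) ^ 2 + b) * q) ∂μ =
      ψ * (1 - (w ^ 2 + s + b) * q) := by
  have e : (fun x : ℝ => Real.exp (θ * x) * (1 - ((w + (x + δ)) ^ 2 + b) * q)) =
      fun x => (1 - (w ^ 2 + 2 * w * δ + b) * q) * Real.exp (θ * x)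
        - (2 * w * q) * (x * Real.exp (θ * x)) - q * ((x + δ) ^ 2 * Real.exp (θ * x)) := by
    ext x; ring
  have i2 : Integrable (fun x => (x + δ) ^ 2 * Real.exp (θ * x)) μ := by
    have : (fun x : ℝ => (x + δ) ^ 2 * Real.exp (θ * x)) = fun x =>
        x ^ 2 * Real.exp (θ * x) + 2 * δ * (x * Real.exp (θ * x)) + δ ^ 2 * Real.exp (θ * x) := by
      ext x; ring
    rw [this]
    exact (t.integrable_sq_mul.add (t.integrable_mul.const_mul _)).add (t.integrable.const_mul _)
  have j0 := t.integrable.const_mul (1 - (w ^ 2 + 2 * w * δ + b) * q)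
  have j1 := t.integrable_mul.const_mul (2 * w * q)
  have j2 := i2.const_mul q
  rw [e]
  refine ⟨(j0.sub j1).sub j2, ?_⟩
  refine (integral_sub (j0.sub j1) j2).trans ?_
  rw [integral_sub' j0 j1, integral_const_mul, integral_const_mul,
    integral_const_mul, t.mass, t.mean, t.variance]
  ring

theorem ofReal_integral_le_lintegral_ofReal {α : Type*} [MeasurableSpace α] {m : Measure α}
    {f : α → ℝ} (hf : Integrable f m) :
    ENNReal.ofReal (∫ x, f x ∂m) ≤ ∫⁻ x, ENNReal.ofReal (f x) ∂m := by
  rw [integral_eq_lintegral_pos_part_sub_lintegral_neg_part hf]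
  refine (ENNReal.ofReal_le_ofReal (sub_le_self _ ENNReal.toReal_nonneg)).trans ?_
  exact ENNReal.ofReal_toReal_le

/-- The killed walk stays in a tube of radius `h` around a line of slope `-δ` at least with the
probability that the tilted walk does, up to the exponential change of measure. -/
theorem tube_le_killedStep_iterate {θ ψ δ s h c B : ℝ} (t : Tilting μ θ ψ δ s) (hh : 0 < h)
    (hB : 0 ≤ B) (hc : h ≤ c) (hδ : 0 ≤ δ) {f : ℝ → ℝ≥0∞}
    (hf : ∀ y, |y - c| < h → ENNReal.ofReal (B * Real.exp (θ * y)) ≤ f y) (hs : 0 ≤ s)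
    (m : ℕ) (hm : c + δ * m + h ≤ A) (y : ℝ) (hy : 0 ≤ y) :
    ENNReal.ofReal (B * ψ ^ m * Real.exp (θ * y) *
      (1 - ((y - c - δ * m) ^ 2 + m * s) * (1 / h ^ 2))) ≤ (killedStep μ A)^[m] f y := by
  -- Outside the tube the claimed bound is nonpositive, so nothing has to be known about the walk
  -- there; this replaces a stopping argument.
  have key : ∀ (m : ℕ) (y : ℝ), ¬ |y - c - δ * m| < h →
      B * ψ ^ m * Real.exp (θ * y) * (1 - ((y - c - δ * m) ^ 2 + m * s) * (1 / h ^ 2)) ≤ 0 := by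
    intro m y hy
    have h1 : h ^ 2 ≤ (y - c - δ * m) ^ 2 := by
      rw [← sq_abs (y - c - δ * m)]; gcongr; linarith
    have h2 : 1 ≤ ((y - c - δ * m) ^ 2 + m * s) * (1 / h ^ 2) := by
      rw [mul_one_div, le_div_iff₀ (by positivity)]
      nlinarith [mul_nonneg (Nat.cast_nonneg (α := ℝ) m) hs]
    exact mul_nonpos_of_nonneg_of_nonpos
      (mul_nonneg (mul_nonneg hB (pow_nonneg t.pos.le _)) (Real.exp_pos _).le) (by linarith)
  induction m generalizing y with
  | zero =>
    by_cases h0 : |y - c| < h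
    · refine le_trans (ENNReal.ofReal_le_ofReal ?_) (hf y h0)
      simp only [pow_zero, mul_one, Nat.cast_zero, mul_zero, zero_mul, sub_zero, add_zero]
      have : 0 ≤ (y - c) ^ 2 * (1 / h ^ 2) := by positivity
      nlinarith [mul_nonneg hB (Real.exp_pos (θ * y)).le]
    · rw [ENNReal.ofReal_of_nonpos (key 0 y (by simpa using h0))]
      exact zero_le
  | succ m ih =>
    rw [Function.iterate_succ_apply']
    have hm' : c + δ * m + h ≤ A := by push_cast at hm; linarith
    -- W is the bound for m steps; integrating it over one increment reproduces exactly the bound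
    -- for m + 1 steps.
    set W : ℝ → ℝ := fun z => B * ψ ^ m * Real.exp (θ * z) *
      (1 - ((z - c - δ * m) ^ 2 + m * s) * (1 / h ^ 2)) with hW
    have hint := t.integral_quadratic (y - c - δ * ((m : ℝ) + 1)) (m * s) (1 / h ^ 2)
    have e : (fun x => W (y + x)) = fun x => (B * ψ ^ m * Real.exp (θ * y)) *
        (Real.exp (θ * x) *
          (1 - ((y - c - δ * ((m : ℝ) + 1) + (x + δ)) ^ 2 + m * s) * (1 / h ^ 2))) := by
      ext x
      simp only [hW]
      rw [mul_add, Real.exp_add]; ring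
    have e2 : B * ψ ^ (m + 1) * Real.exp (θ * y) *
        (1 - ((y - c - δ * ((m + 1 : ℕ) : ℝ)) ^ 2 + ((m + 1 : ℕ) : ℝ) * s) * (1 / h ^ 2)) =
        ∫ x, W (y + x) ∂μ := by
      rw [e, integral_const_mul, hint.2]; push_cast; ring
    rw [e2]
    refine (ofReal_integral_le_lintegral_ofReal (by rw [e]; exact hint.1.const_mul _)).trans ?_
    refine lintegral_mono fun x => ?_
    rw [max_eq_left hy]
    by_cases hx : |y + x - c - δ * m| < h
    · have h1 := abs_lt.1 hx
      have h2 : 0 ≤ δ * m := mul_nonneg hδ (Nat.cast_nonneg _)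
      have hmem : y + x ∈ Set.Ioo 0 A := ⟨by linarith, by linarith⟩
      rw [Set.indicator_of_mem hmem]
      exact ih hm' _ hmem.1.le
    · rw [ENNReal.ofReal_of_nonpos (key m _ hx)]
      exact zero_le

/-- Chernoff's bound for the killed walk. -/
theorem killedStep_iterate_le_exp {θ ψ δ s : ℝ} (t : Tilting μ θ ψ δ s) (z : ℝ)
    {f : ℝ → ℝ≥0∞} (hf : ∀ y, f y ≤ ENNReal.ofReal (Real.exp (θ * (y - z)))) (n : ℕ) (y : ℝ)
    (hy : 0 ≤ y) :
    (killedStep μ A)^[n] f y ≤ ENNReal.ofReal (ψ ^ n * Real.exp (θ * (y - z))) := by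
  induction n generalizing y with
  | zero => simpa using hf y
  | succ n ih =>
    rw [Function.iterate_succ_apply']
    have e : (fun x => ψ ^ n * Real.exp (θ * (y + x - z))) =
        fun x => (ψ ^ n * Real.exp (θ * (y - z))) * Real.exp (θ * x) := by
      ext x
      rw [mul_assoc, ← Real.exp_add]; congr 2; ring
    calc killedStep μ A ((killedStep μ A)^[n] f) y
        ≤ ∫⁻ x, ENNReal.ofReal (ψ ^ n * Real.exp (θ * (y + x - z))) ∂μ := by
          refine lintegral_mono fun x => ?_
          rw [max_eq_left hy]
          by_cases hx : y + x ∈ Set.Ioo 0 A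
          · rw [Set.indicator_of_mem hx]; exact ih _ hx.1.le
          · rw [Set.indicator_of_notMem hx]; exact zero_le
      _ = ENNReal.ofReal (∫ x, ψ ^ n * Real.exp (θ * (y + x - z)) ∂μ) := by
          rw [ofReal_integral_eq_lintegral_ofReal]
          · rw [e]; exact t.integrable.const_mul _
          · exact ae_of_all _ fun x => mul_nonneg (pow_nonneg t.pos.le _) (Real.exp_pos _).le
      _ = _ := by
          rw [e, integral_const_mul, t.mass]; congr 1; ring

end RoundRobinCusum

namespace RoundRobinCusum

variable {μ : Measure ℝ} {A : ℝ}

/-! ### Exponential tiltings of an increment law with unit exponential moment -/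

section ExponentialTilting

variable [IsProbabilityMeasure μ]

theorem mem_interior_integrableExpSet
    (hexp : Integrable (fun x => Real.exp x) μ) {θ : ℝ} (hθ : θ ∈ Set.Ioo (0 : ℝ) 1) :
    θ ∈ interior (integrableExpSet id μ) := by
  refine interior_maximal (fun t ht => ?_) isOpen_Ioo hθ
  refine integrable_exp_mul_of_nonneg_of_le (u := 1) (X := id) ?_ ht.1.le ht.2.le
  simpa using hexp

theorem hasDerivAt_integral_exp
    (hexp : Integrable (fun x => Real.exp x) μ) {θ : ℝ} (hθ : θ ∈ Set.Ioo (0 : ℝ) 1) :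
    HasDerivAt (fun t => ∫ x, Real.exp (t * x) ∂μ) (∫ x, x * Real.exp (θ * x) ∂μ) θ :=
  hasDerivAt_mgf (X := id) (mem_interior_integrableExpSet hexp hθ)

theorem exists_tilting
    (hexp : Integrable (fun x => Real.exp x) μ) {θ : ℝ} (hθ : θ ∈ Set.Ioo (0 : ℝ) 1) :
    ∃ s, 0 ≤ s ∧ Tilting μ θ (∫ x, Real.exp (θ * x) ∂μ)
      (-(∫ x, x * Real.exp (θ * x) ∂μ) / ∫ x, Real.exp (θ * x) ∂μ) s := by
  have hi := mem_interior_integrableExpSet hexp hθ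
  have h0 : Integrable (fun x => Real.exp (θ * x)) μ :=
    integrable_of_mem_integrableExpSet (X := id) (interior_subset hi)
  have h1 : Integrable (fun x => x * Real.exp (θ * x)) μ := by
    simpa using integrable_pow_mul_exp_of_mem_interior_integrableExpSet (X := id) hi 1
  have h2 : Integrable (fun x => x ^ 2 * Real.exp (θ * x)) μ := by
    simpa using integrable_pow_mul_exp_of_mem_interior_integrableExpSet (X := id) hi 2
  have hpos : 0 < ∫ x, Real.exp (θ * x) ∂μ := integral_exp_pos h0
  refine ⟨(∫ x, (x + (-(∫ x, x * Real.exp (θ * x) ∂μ) / ∫ x, Real.exp (θ * x) ∂μ)) ^ 2 *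
    Real.exp (θ * x) ∂μ) / ∫ x, Real.exp (θ * x) ∂μ, ?_, ⟨h0, h1, h2, rfl, ?_, ?_, hpos⟩⟩
  · exact div_nonneg (integral_nonneg fun x => by positivity) hpos.le
  · rw [neg_div, neg_neg, div_mul_cancel₀ _ hpos.ne']
  · exact (div_mul_cancel₀ _ hpos.ne').symm

/-- Differentiability is established only inside (0, 1); continuity up to the endpoints is what
makes a minimizer exist. The domination uses exp(tx) ≤ 1 for x ≤ 0 and exp(tx) ≤ exp(x) for x ≥ 0.
-/
theorem continuousOn_integral_exp (hexp : Integrable (fun x => Real.exp x) μ) :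
    ContinuousOn (fun t => ∫ x, Real.exp (t * x) ∂μ) (Set.Icc (0 : ℝ) 1) := by
  refine continuousOn_of_dominated (bound := fun x => 1 + Real.exp x) ?_ ?_ ?_ ?_
  · intro t _
    exact Measurable.aestronglyMeasurable (by fun_prop)
  · intro t ht
    refine ae_of_all _ fun x => ?_
    rw [Real.norm_eq_abs, abs_of_pos (Real.exp_pos _)]
    rcases le_total x 0 with hx | hx
    · have : Real.exp (t * x) ≤ 1 := Real.exp_le_one_iff.2 (mul_nonpos_of_nonneg_of_nonpos ht.1 hx)
      linarith [Real.exp_pos x]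
    · have : Real.exp (t * x) ≤ Real.exp x := Real.exp_le_exp.2 (by nlinarith [ht.2])
      linarith
  · exact (integrable_const _).add hexp
  · exact ae_of_all _ fun x => Continuous.continuousOn (by fun_prop)

/-- The square (exp(x/2) - 1)² has integral 2 - 2M(1/2), where M is the moment generating function,
and it vanishes only at x = 0. As M(0) = M(1) = 1, minimizers of M are interior. -/
theorem integral_exp_half_lt_one
    (hexp : Integrable (fun x => Real.exp x) μ) (hone : ∫ x, Real.exp x ∂μ = 1)
    (hne : ¬ ∀ᵐ x ∂μ, x = 0) : ∫ x, Real.exp (1 / 2 * x) ∂μ < 1 := by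
  have h0 : Integrable (fun x => Real.exp (1 / 2 * x)) μ :=
    integrable_of_mem_integrableExpSet (X := id) (interior_subset
      (mem_interior_integrableExpSet hexp (θ := 1 / 2) ⟨by norm_num, by norm_num⟩))
  have e : (fun x => (Real.exp (1 / 2 * x) - 1) ^ 2) =
      fun x => Real.exp x - 2 * Real.exp (1 / 2 * x) + 1 := by
    ext x
    have : Real.exp x = Real.exp (1 / 2 * x) ^ 2 := by
      rw [← Real.exp_nat_mul]; congr 1; push_cast; ring
    rw [this]; ring
  have hi : Integrable (fun x => (Real.exp (1 / 2 * x) - 1) ^ 2) μ := by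
    rw [e]; exact (hexp.sub (h0.const_mul 2)).add (integrable_const _)
  have hpos : 0 < ∫ x, (Real.exp (1 / 2 * x) - 1) ^ 2 ∂μ := by
    refine lt_of_le_of_ne (integral_nonneg fun x => by positivity) fun h => hne ?_
    have := (integral_eq_zero_iff_of_nonneg (fun x => by positivity) hi).1 h.symm
    filter_upwards [this] with x hx
    have h1 : Real.exp (1 / 2 * x) = 1 := by
      have := pow_eq_zero_iff (two_ne_zero) |>.1 hx
      linarith
    have := Real.exp_eq_one_iff _ |>.1 h1
    linarith
  have e2 : ∫ x, (Real.exp (1 / 2 * x) - 1) ^ 2 ∂μ = 1 - 2 * ∫ x, Real.exp (1 / 2 * x) ∂μ + 1 := by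
    rw [e]
    refine (integral_add (hexp.sub (h0.const_mul 2)) (integrable_const _)).trans ?_
    rw [integral_sub' hexp (h0.const_mul 2), hone, integral_const_mul]
    simp
  linarith

/-- The smallest minimizer `θ` of the moment generating function on `[0, 1]` gives a centred
tilting, and parameters slightly smaller than `θ` give a negative drift. -/
theorem exists_centered_tilting
    (hexp : Integrable (fun x => Real.exp x) μ) (hone : ∫ x, Real.exp x ∂μ = 1)
    (hne : ¬ ∀ᵐ x ∂μ, x = 0) :
    ∃ θ ρ s : ℝ, 0 < θ ∧ θ < 1 ∧ ρ ≤ 1 ∧ 0 ≤ s ∧ Tilting μ θ ρ 0 s ∧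
      ∀ η > 0, ∃ θ' ψ δ s' : ℝ, θ - η < θ' ∧ θ' < θ ∧ 0 < θ' ∧ 0 < δ ∧ ρ ≤ ψ ∧ 0 ≤ s' ∧
        Tilting μ θ' ψ δ s' := by
  set M : ℝ → ℝ := fun t => ∫ x, Real.exp (t * x) ∂μ with hM
  have hcont : ContinuousOn M (Set.Icc 0 1) := continuousOn_integral_exp hexp
  have hM0 : M 0 = 1 := by simp [hM]
  have hM1 : M 1 = 1 := by simpa [hM] using hone
  have hhalf : M (1 / 2) < 1 := integral_exp_half_lt_one hexp hone hne
  obtain ⟨a, ha, hamin⟩ := isCompact_Icc.exists_isMinOn (Set.nonempty_Icc.2 zero_le_one) hcont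
  have hmin_le : M a ≤ M (1 / 2) := hamin ⟨by norm_num, by norm_num⟩
  -- the compact set of minimizers
  have hcl : IsCompact (Set.Icc (0 : ℝ) 1 ∩ M ⁻¹' {M a}) :=
    isCompact_Icc.of_isClosed_subset
      (hcont.preimage_isClosed_of_isClosed isClosed_Icc isClosed_singleton) Set.inter_subset_left
  obtain ⟨θ, ⟨hθI, hθm⟩, hθmin⟩ := hcl.exists_isLeast ⟨a, ha, rfl⟩
  have hθeq : M θ = M a := hθm
  have hθ0 : 0 < θ := by
    refine lt_of_le_of_ne hθI.1 fun h => ?_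
    rw [← h, hM0] at hθeq; linarith
  have hθ1 : θ < 1 := by
    refine lt_of_le_of_ne hθI.2 fun h => ?_
    rw [h, hM1] at hθeq; linarith
  have hmin : ∀ t ∈ Set.Icc (0 : ℝ) 1, M θ ≤ M t := fun t ht => hθeq ▸ hamin ht
  have hd := hasDerivAt_integral_exp hexp ⟨hθ0, hθ1⟩
  have hzero : ∫ x, x * Real.exp (θ * x) ∂μ = 0 := by
    refine IsLocalMin.hasDerivAt_eq_zero ?_ hd
    filter_upwards [Ioo_mem_nhds hθ0 hθ1] with t ht using hmin t ⟨ht.1.le, ht.2.le⟩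
  obtain ⟨s, hs, ht⟩ := exists_tilting hexp ⟨hθ0, hθ1⟩
  rw [hzero, neg_zero, zero_div] at ht
  refine ⟨θ, M θ, s, hθ0, hθ1, by linarith, hs, ht, fun η hη => ?_⟩
  set b := max (θ - η) (θ / 2) with hb
  have hbθ : b < θ := max_lt (by linarith) (by linarith)
  have hb0 : 0 < b := lt_max_of_lt_right (by linarith)
  -- Strict, because θ is the least of all minimizers.
  have hMb : M θ < M b := by
    refine lt_of_le_of_ne (hmin b ⟨hb0.le, by linarith⟩) fun h => ?_
    have : θ ≤ b := hθmin ⟨⟨hb0.le, by linarith⟩, by simp [← h, hθeq]⟩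
    linarith
  -- The mean value theorem on [b, θ] yields a parameter with negative derivative, that is, a
  -- tilting with downward drift.
  obtain ⟨c, hc, hc'⟩ := exists_hasDerivAt_eq_slope M (fun c => ∫ x, x * Real.exp (c * x) ∂μ) hbθ
    (hcont.mono (Set.Icc_subset_Icc hb0.le hθ1.le))
    (fun x hx => hasDerivAt_integral_exp hexp ⟨hb0.trans hx.1, hx.2.trans hθ1⟩)
  have hcI : c ∈ Set.Ioo (0 : ℝ) 1 := ⟨hb0.trans hc.1, hc.2.trans hθ1⟩
  obtain ⟨s', hs', ht'⟩ := exists_tilting hexp hcI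
  refine ⟨c, M c, _, s', lt_of_le_of_lt (le_max_left _ _) hc.1, hc.2, hcI.1, ?_,
    hmin c ⟨hcI.1.le, hcI.2.le⟩, hs', ht'⟩
  have hneg : ∫ x, x * Real.exp (c * x) ∂μ < 0 := by
    rw [hc']; exact div_neg_of_neg_of_pos (by linarith) (by linarith)
  exact div_pos (by linarith) ht'.pos

/-- The function exp(x) - 1 has integral zero and the sign of x, so it cannot be one-sided without
vanishing almost everywhere. -/
theorem measure_Ioi_pos_of_integral_exp (hone : ∫ x, Real.exp x ∂μ = 1)
    (hne : ¬ ∀ᵐ x ∂μ, x = 0) : 0 < μ (Set.Ioi 0) ∧ 0 < μ (Set.Iio 0) := by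
  have hexp : Integrable (fun x => Real.exp x) μ := by
    by_contra h
    rw [integral_undef h] at hone
    norm_num at hone
  have hint : ∫ x, (Real.exp x - 1) ∂μ = 0 := by
    rw [integral_sub hexp (integrable_const _), hone]; simp
  have hi := hexp.sub (integrable_const (1 : ℝ))
  constructor
  · by_contra h
    have h0 : ∀ᵐ x ∂μ, x ≤ 0 := by
      rw [ae_iff]; simpa [Set.Ioi] using h
    refine hne ?_
    have h1 : ∫ x, (1 - Real.exp x) ∂μ = 0 := by
      rw [← neg_eq_zero, ← integral_neg, ← hint]; congr 1; ext x; ring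
    have h2 := (integral_eq_zero_iff_of_nonneg_ae (f := fun x => 1 - Real.exp x) (by
      filter_upwards [h0] with x hx
      simpa using hx) ((integrable_const _).sub hexp)).1 h1
    filter_upwards [h2] with x hx
    have : 1 - Real.exp x = 0 := hx
    exact (Real.exp_eq_one_iff _).1 (by linarith)
  · by_contra h
    have h0 : ∀ᵐ x ∂μ, 0 ≤ x := by
      rw [ae_iff]; simpa [Set.Iio] using h
    refine hne ?_
    have h2 := (integral_eq_zero_iff_of_nonneg_ae (f := fun x => Real.exp x - 1) (by
      filter_upwards [h0] with x hx
      simpa using hx) hi).1 hint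
    filter_upwards [h2] with x hx
    have : Real.exp x - 1 = 0 := hx
    exact (Real.exp_eq_one_iff _).1 (by linarith)

/-- Both half-lines are exhausted by the intervals with endpoints ±1/(n+1) and ±(n+1), and one n
serves both. The resulting bounded steps push the walk away from either barrier at a cost of p per
step. -/
theorem exists_Icc_measure_pos (hone : ∫ x, Real.exp x ∂μ = 1)
    (hne : ¬ ∀ᵐ x ∂μ, x = 0) :
    ∃ u v p : ℝ, 0 < u ∧ u ≤ v ∧ 0 < p ∧ p ≤ 1 ∧ ENNReal.ofReal p ≤ μ (Set.Icc u v) ∧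
      ENNReal.ofReal p ≤ μ (Set.Icc (-v) (-u)) := by
  obtain ⟨h1, h2⟩ := measure_Ioi_pos_of_integral_exp hone hne
  have cover : ∀ x : ℝ, 0 < x → ∃ n : ℕ, 1 / ((n : ℝ) + 1) ≤ x ∧ x ≤ n + 1 := by
    intro x hx
    obtain ⟨n, hn⟩ := exists_nat_ge (max x (1 / x))
    refine ⟨n, ?_, by linarith [le_max_left x (1 / x)]⟩
    rw [div_le_iff₀ (by positivity)]
    have : 1 / x ≤ n + 1 := by linarith [le_max_right x (1 / x)]
    rwa [div_le_iff₀ hx, mul_comm] at this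
  obtain ⟨n, hn⟩ : ∃ n : ℕ, 0 < μ (Set.Icc (1 / ((n : ℝ) + 1)) (n + 1)) := by
    by_contra! h
    refine h1.ne' (measure_mono_null (fun x hx => ?_)
      (measure_iUnion_null fun n : ℕ => nonpos_iff_eq_zero.1 (h n)))
    simpa using cover x hx
  obtain ⟨m, hm⟩ : ∃ n : ℕ, 0 < μ (Set.Icc (-((n : ℝ) + 1)) (-(1 / ((n : ℝ) + 1)))) := by
    by_contra! h
    refine h2.ne' (measure_mono_null (fun x hx => ?_)
      (measure_iUnion_null fun n : ℕ => nonpos_iff_eq_zero.1 (h n)))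
    obtain ⟨n, h3, h4⟩ := cover (-x) (by simpa using hx)
    exact Set.mem_iUnion.2 ⟨n, by linarith, by linarith⟩
  set N := max n m
  have e1 : 1 / ((N : ℝ) + 1) ≤ 1 / ((n : ℝ) + 1) := by
    gcongr; exact le_max_left _ _
  have e2 : 1 / ((N : ℝ) + 1) ≤ 1 / ((m : ℝ) + 1) := by
    gcongr; exact le_max_right _ _
  have e3 : (n : ℝ) ≤ N := by exact_mod_cast le_max_left n m
  have e4 : (m : ℝ) ≤ N := by exact_mod_cast le_max_right n m
  have hn' := hn.trans_le (measure_mono (μ := μ) (Set.Icc_subset_Icc e1 (add_le_add_left e3 1)))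
  have hm' := hm.trans_le (measure_mono (μ := μ) (Set.Icc_subset_Icc
    (neg_le_neg (add_le_add_left e4 1)) (neg_le_neg e2)))
  have ne1 := measure_ne_top μ (Set.Icc (1 / ((N : ℝ) + 1)) (N + 1))
  have ne2 := measure_ne_top μ (Set.Icc (-((N : ℝ) + 1)) (-(1 / ((N : ℝ) + 1))))
  refine ⟨1 / ((N : ℝ) + 1), N + 1, min (μ (Set.Icc (1 / ((N : ℝ) + 1)) (N + 1))).toReal
    (μ (Set.Icc (-((N : ℝ) + 1)) (-(1 / ((N : ℝ) + 1))))).toReal, by positivity, ?_, ?_, ?_, ?_, ?_⟩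
  · have h5 : (0 : ℝ) ≤ N := Nat.cast_nonneg _
    rw [div_le_iff₀ (by positivity)]; nlinarith
  · exact lt_min (ENNReal.toReal_pos hn'.ne' ne1) (ENNReal.toReal_pos hm'.ne' ne2)
  · refine (min_le_left _ _).trans ?_
    exact measureReal_le_one
  · exact (ENNReal.ofReal_le_ofReal (min_le_left _ _)).trans ENNReal.ofReal_toReal_le
  · exact (ENNReal.ofReal_le_ofReal (min_le_right _ _)).trans ENNReal.ofReal_toReal_le

end ExponentialTilting

end RoundRobinCusum

/-! ### Lower bounds for the survival probability of the killed walk -/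

namespace RoundRobinCusum

variable {μ : Measure ℝ} {A : ℝ}

/-- Survival probability of the killed walk from a low starting point. -/
theorem low_le_killedStep_iterate {θ ρ s u v p h : ℝ} (t : Tilting μ θ ρ 0 s) (hθ0 : 0 < θ)
    (hθ1 : θ < 1) (hρ : ρ ≤ 1) (hs : 0 ≤ s) (hu : 0 < u) (huv : u ≤ v) (hp0 : 0 < p) (hp1 : p ≤ 1)
    (hp : ENNReal.ofReal p ≤ μ (Set.Icc u v)) {j n : ℕ} (hh : h = j * u) (hj : 0 < j)
    (htop : 4 * h + j * v ≤ A) (hn : n * s ≤ h ^ 2 / 2) {y : ℝ} (hy : y ∈ Set.Ico 0 (3 * h)) :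
    ENNReal.ofReal (1 / 2 * p ^ j * Real.exp (-h) * ρ ^ n) ≤
      (killedStep μ A)^[n] (fun _ => 1) y := by
  have hj' : (0 : ℝ) < j := by exact_mod_cast hj
  have hhpos : 0 < h := by rw [hh]; positivity
  have hexp : Real.exp (-h) ≤ 1 := Real.exp_le_one_iff.2 (by linarith)
  have hρ0 := t.pos
  have hv : 0 < v := hu.trans_le huv
  have hsteps : ∀ i : ℕ, 1 ≤ i → i ≤ j → 0 < y + i * u ∧ y + i * v < A := by
    intro i h1 h2
    have h1' : (1 : ℝ) ≤ i := by exact_mod_cast h1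
    have h2' : (i : ℝ) * v ≤ j * v := by gcongr
    exact ⟨by have := hy.1; positivity, by linarith [hy.2]⟩
  -- In a short period upward steps alone suffice.
  by_cases hnj : n ≤ j
  · have hb := pow_mul_le_killedStep_iterate (A := A) (B := 1) hp n (fun _ => 1) y hy.1
      (fun i h1 h2 => hsteps i h1 (h2.trans hnj)) (fun _ _ => le_rfl)
    refine le_trans ?_ hb
    rw [mul_one, ← ENNReal.ofReal_pow hp0.le]
    refine ENNReal.ofReal_le_ofReal ?_
    calc 1 / 2 * p ^ j * Real.exp (-h) * ρ ^ n ≤ 1 * p ^ n * 1 * 1 := by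
          gcongr ?_ * ?_ * ?_ * ?_
          · norm_num
          · exact pow_le_pow_of_le_one hp0.le hp1 hnj
          · exact pow_le_one₀ hρ0.le hρ
      _ = p ^ n := by ring
  · have hnj' : j + (n - j) = n := by omega
    rw [← hnj', Function.iterate_add_apply, hnj']
    have hrw : ENNReal.ofReal (1 / 2 * p ^ j * Real.exp (-h) * ρ ^ n) =
        ENNReal.ofReal p ^ j * ENNReal.ofReal (1 / 2 * Real.exp (-h) * ρ ^ n) := by
      rw [← ENNReal.ofReal_pow hp0.le, ← ENNReal.ofReal_mul (by positivity)]
      congr 1; ring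
    rw [hrw]
    -- The first j upward steps bring the walk to a height z ≥ h; the centred tilting then keeps it
    -- within h of z.
    refine pow_mul_le_killedStep_iterate hp j _ y hy.1 hsteps fun z hz => ?_
    have hz1 : h ≤ z := by linarith [hz.1, hy.1]
    have hz2 : z ≤ 3 * h + j * v := by linarith [hz.2, hy.2]
    -- This B makes B exp(θw) ≤ 1 throughout the tube, as the terminal function 1 requires.
    have htube := tube_le_killedStep_iterate (A := A) (c := z) (B := Real.exp (-(θ * (z + h))))
      (f := fun _ => 1) t hhpos (Real.exp_pos _).le hz1 le_rfl (fun w hw => by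
        rw [← Real.exp_add]
        refine ENNReal.ofReal_le_one.2 (Real.exp_le_one_iff.2 ?_)
        have := (abs_lt.1 hw).2
        nlinarith) hs (n - j) (by linarith) z (by linarith)
    refine le_trans (ENNReal.ofReal_le_ofReal ?_) htube
    have hm : ((n - j : ℕ) : ℝ) * s ≤ h ^ 2 / 2 := by
      refine le_trans ?_ hn
      gcongr
      exact Nat.sub_le _ _
    have h1 : (1 : ℝ) / 2 ≤ 1 - ((z - z - 0 * ((n - j : ℕ) : ℝ)) ^ 2 + ((n - j : ℕ) : ℝ) * s) *
        (1 / h ^ 2) := by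
      have : ((z - z - 0 * ((n - j : ℕ) : ℝ)) ^ 2 + ((n - j : ℕ) : ℝ) * s) * (1 / h ^ 2) ≤
          1 / 2 := by
        rw [mul_one_div, div_le_iff₀ (by positivity)]
        nlinarith
      linarith
    have h2 : Real.exp (-h) ≤ Real.exp (-(θ * (z + h))) * Real.exp (θ * z) := by
      rw [← Real.exp_add]
      exact Real.exp_le_exp.2 (by nlinarith)
    have h3 : ρ ^ n ≤ ρ ^ (n - j) := pow_le_pow_of_le_one hρ0.le hρ (Nat.sub_le _ _)
    calc 1 / 2 * Real.exp (-h) * ρ ^ n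
        ≤ 1 / 2 * (Real.exp (-(θ * (z + h))) * Real.exp (θ * z)) * ρ ^ (n - j) := by gcongr
      _ = (Real.exp (-(θ * (z + h))) * ρ ^ (n - j) * Real.exp (θ * z)) * (1 / 2) := by ring
      _ ≤ _ := by gcongr

/-- Survival probability of the killed walk from any starting point that is not close to the upper
barrier, over a period that is long enough for steering the walk downwards. -/
theorem mid_le_killedStep_iterate {θ ρ s u v p h θ' ψ δ s' : ℝ} (t : Tilting μ θ ρ 0 s)
    (t' : Tilting μ θ' ψ δ s') (hθ0 : 0 < θ) (hθ'0 : 0 < θ') (hθ' : θ' < θ) (hρψ : ρ ≤ ψ)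
    (hθ1 : θ < 1) (hρ : ρ ≤ 1) (hs : 0 ≤ s) (hs' : 0 ≤ s') (hδ : 0 < δ)
    (hu : 0 < u) (huv : u ≤ v) (hp0 : 0 < p) (hp1 : p ≤ 1)
    (hp : ENNReal.ofReal p ≤ μ (Set.Icc u v)) {j n : ℕ} (hh : h = j * u) (hj : 0 < j)
    (htop : 4 * h + j * v ≤ A) (hn : n * s ≤ h ^ 2 / 2) (hn' : n * s' ≤ h ^ 2 / 2) (hδh : δ ≤ h)
    (hlong : A ≤ n * δ) {y : ℝ} (hy : y ∈ Set.Icc h (A - h)) :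
    ENNReal.ofReal (1 / 4 * p ^ j * Real.exp (-4 * h) * ρ ^ n * Real.exp (θ' * y)) ≤
      (killedStep μ A)^[n] (fun _ => 1) y := by
  have hj' : (0 : ℝ) < j := by exact_mod_cast hj
  have hhpos : 0 < h := by rw [hh]; positivity
  have hρ0 := t.pos
  -- After m steps along slope -δ the centre of the tube is at a height c with h ≤ c < h + δ ≤ 2h.
  -- So the tube ends inside (0, 3h), where the bound for low starting points applies.
  set m : ℕ := ⌊(y - h) / δ⌋₊ with hm
  have hq : 0 ≤ (y - h) / δ := div_nonneg (by linarith [hy.1]) hδ.le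
  have hm1 : (m : ℝ) * δ ≤ y - h := (le_div_iff₀ hδ).1 (Nat.floor_le hq)
  have hm2 : y - h < (m + 1) * δ := (div_lt_iff₀ hδ).1 (Nat.lt_floor_add_one _)
  have hmn : m ≤ n := by
    have : (m : ℝ) * δ < n * δ := by linarith [hy.2]
    have := lt_of_mul_lt_mul_right this hδ.le
    exact_mod_cast this.le
  rw [← Nat.add_sub_cancel' hmn, Function.iterate_add_apply, Nat.add_sub_cancel' hmn]
  set c := y - δ * m with hc
  have hch : h ≤ c := by linarith
  -- The first four factors bound survival over the remaining n - m steps; exp(-3h) compensates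
  -- exp(θ'z) ≤ exp(3h).
  set B := 1 / 2 * p ^ j * Real.exp (-h) * ρ ^ (n - m) * Real.exp (-3 * h) with hB
  have hB0 : 0 ≤ B := by positivity
  have hlow : ∀ z, |z - c| < h → ENNReal.ofReal (B * Real.exp (θ' * z)) ≤
      (killedStep μ A)^[n - m] (fun _ => 1) z := by
    intro z hz
    obtain ⟨h1, h2⟩ := abs_lt.1 hz
    have hz3 : z < 3 * h := by linarith
    refine le_trans (ENNReal.ofReal_le_ofReal ?_)
      (low_le_killedStep_iterate t hθ0 hθ1 hρ hs hu huv hp0 hp1 hp hh hj htop ?_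
        (y := z) ⟨by linarith, hz3⟩)
    · have : Real.exp (-3 * h) * Real.exp (θ' * z) ≤ 1 := by
        rw [← Real.exp_add]
        exact Real.exp_le_one_iff.2 (by nlinarith)
      calc B * Real.exp (θ' * z) = 1 / 2 * p ^ j * Real.exp (-h) * ρ ^ (n - m) *
            (Real.exp (-3 * h) * Real.exp (θ' * z)) := by rw [hB]; ring
        _ ≤ 1 / 2 * p ^ j * Real.exp (-h) * ρ ^ (n - m) * 1 := by gcongr
        _ = _ := mul_one _
    · refine le_trans ?_ hn
      gcongr
      exact Nat.sub_le _ _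
  have htube := tube_le_killedStep_iterate (A := A) t' hhpos hB0 hch hδ.le hlow hs' m
    (by linarith [hy.2]) y (by linarith [hy.1])
  refine le_trans (ENNReal.ofReal_le_ofReal ?_) htube
  have h1 : (1 : ℝ) / 2 ≤ 1 - ((y - c - δ * m) ^ 2 + m * s') * (1 / h ^ 2) := by
    have h0 : y - c - δ * m = 0 := by rw [hc]; ring
    have : ((y - c - δ * m) ^ 2 + m * s') * (1 / h ^ 2) ≤ 1 / 2 := by
      rw [h0, mul_one_div, div_le_iff₀ (by positivity)]
      have : (m : ℝ) * s' ≤ n * s' := by gcongr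
      nlinarith
    linarith
  have h2 : ρ ^ n ≤ ρ ^ (n - m) * ψ ^ m := by
    calc ρ ^ n = ρ ^ (n - m) * ρ ^ m := by rw [← pow_add, Nat.sub_add_cancel hmn]
      _ ≤ _ := by gcongr
  calc 1 / 4 * p ^ j * Real.exp (-4 * h) * ρ ^ n * Real.exp (θ' * y)
      ≤ 1 / 4 * p ^ j * Real.exp (-4 * h) * (ρ ^ (n - m) * ψ ^ m) * Real.exp (θ' * y) := by gcongr
    _ = B * ψ ^ m * Real.exp (θ' * y) * (1 / 2) := by
        rw [hB, show -4 * h = -h + -3 * h by ring, Real.exp_add]; ring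
    _ ≤ _ := by
        have := t'.pos
        gcongr

/-- Lower bound for the survival probability of the killed walk, over a long period and from any
starting point. -/
theorem exp_le_killedStep_iterate {θ ρ s u v p h θ' ψ δ s' : ℝ} (t : Tilting μ θ ρ 0 s)
    (t' : Tilting μ θ' ψ δ s') (hθ0 : 0 < θ) (hθ'0 : 0 < θ') (hθ' : θ' < θ) (hρψ : ρ ≤ ψ)
    (hθ1 : θ < 1) (hρ : ρ ≤ 1) (hs : 0 ≤ s) (hs' : 0 ≤ s') (hδ : 0 < δ)
    (hu : 0 < u) (huv : u ≤ v) (hp0 : 0 < p) (hp1 : p ≤ 1)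
    (hp : ENNReal.ofReal p ≤ μ (Set.Icc u v)) (hp' : ENNReal.ofReal p ≤ μ (Set.Icc (-v) (-u)))
    {j n : ℕ} (hh : h = j * u) (hj : 0 < j)
    (htop : 4 * h + j * v ≤ A) (hn : n * s ≤ h ^ 2 / 2) (hn' : n * s' ≤ h ^ 2 / 2) (hδh : δ ≤ h)
    (hjn : j ≤ n) (hlong : A ≤ (n - j : ℕ) * δ) {y : ℝ} (hy : y ∈ Set.Ioo 0 A) :
    ENNReal.ofReal (1 / 4 * p ^ (2 * j) * Real.exp (-(4 * h + j * v)) * ρ ^ n *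
      Real.exp (θ' * y)) ≤ (killedStep μ A)^[n] (fun _ => 1) y := by
  have hj' : (0 : ℝ) < j := by exact_mod_cast hj
  have hhpos : 0 < h := by rw [hh]; positivity
  have hρ0 := t.pos
  have hv : 0 < v := hu.trans_le huv
  have hjv : 0 < j * v := by positivity
  have hp2 : p ^ (2 * j) ≤ p ^ j := pow_le_pow_of_le_one hp0.le hp1 (by omega)
  have hle4 : Real.exp (-(4 * h + j * v)) ≤ Real.exp (-4 * h) :=
    Real.exp_le_exp.2 (by linarith)
  -- Three zones: low starts need no descent, middle ones descend by the tilting, and starts within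
  -- h of the top first make j downward steps.
  rcases lt_or_ge y (3 * h) with h3 | h3
  · refine le_trans (ENNReal.ofReal_le_ofReal ?_)
      (low_le_killedStep_iterate t hθ0 hθ1 hρ hs hu huv hp0 hp1 hp hh hj htop hn ⟨hy.1.le, h3⟩)
    have h4 : Real.exp (-4 * h) * Real.exp (θ' * y) ≤ Real.exp (-h) := by
      rw [← Real.exp_add]
      refine Real.exp_le_exp.2 ?_
      nlinarith [hy.1]
    calc 1 / 4 * p ^ (2 * j) * Real.exp (-(4 * h + j * v)) * ρ ^ n * Real.exp (θ' * y)
        ≤ 1 / 2 * p ^ j * Real.exp (-4 * h) * ρ ^ n * Real.exp (θ' * y) := by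
          gcongr; norm_num
      _ = 1 / 2 * p ^ j * (Real.exp (-4 * h) * Real.exp (θ' * y)) * ρ ^ n := by ring
      _ ≤ _ := by gcongr
  have hmid : ∀ m : ℕ, m ≤ n → A ≤ m * δ → ∀ z ∈ Set.Icc h (A - h),
      ENNReal.ofReal (1 / 4 * p ^ j * Real.exp (-4 * h) * ρ ^ m * Real.exp (θ' * z)) ≤
      (killedStep μ A)^[m] (fun _ => 1) z := by
    intro m hm hmA z hz
    have hmn : (m : ℝ) ≤ n := by exact_mod_cast hm
    exact mid_le_killedStep_iterate t t' hθ0 hθ'0 hθ' hρψ hθ1 hρ hs hs' hδ hu huv hp0 hp1 hp hh hj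
      htop (le_trans (by gcongr) hn) (le_trans (by gcongr) hn') hδh hmA hz
  rcases le_or_gt y (A - h) with h4 | h4
  · refine le_trans (ENNReal.ofReal_le_ofReal ?_)
      (hmid n le_rfl (hlong.trans ?_) y ⟨by linarith, h4⟩)
    · gcongr
    · gcongr
      exact Nat.sub_le _ _
  · rw [← Nat.add_sub_cancel' hjn, Function.iterate_add_apply, Nat.add_sub_cancel' hjn]
    have hrw : ENNReal.ofReal (1 / 4 * p ^ (2 * j) * Real.exp (-(4 * h + j * v)) * ρ ^ n *
        Real.exp (θ' * y)) = ENNReal.ofReal p ^ j * ENNReal.ofReal (1 / 4 * p ^ j *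
          Real.exp (-(4 * h + j * v)) * ρ ^ n * Real.exp (θ' * y)) := by
      rw [← ENNReal.ofReal_pow hp0.le, ← ENNReal.ofReal_mul (by positivity)]
      congr 1; rw [two_mul, pow_add]; ring
    rw [hrw]
    refine pow_mul_le_killedStep_iterate hp' j _ y hy.1.le (fun i h1 h2 => ?_) fun z hz => ?_
    · have h1' : (1 : ℝ) ≤ i := by exact_mod_cast h1
      have h2' : (i : ℝ) * v ≤ j * v := by gcongr
      have h3' : 0 < (i : ℝ) * u := by positivity
      exact ⟨by linarith, by linarith [hy.2]⟩
    · have hz1 : y - j * v ≤ z := by linarith [hz.1]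
      have hz2 : z ≤ y - h := by linarith [hz.2]
      refine le_trans (ENNReal.ofReal_le_ofReal ?_)
        (hmid (n - j) (Nat.sub_le _ _) hlong z ⟨by linarith, by linarith [hy.2]⟩)
      have h5 : ρ ^ n ≤ ρ ^ (n - j) := pow_le_pow_of_le_one hρ0.le hρ (Nat.sub_le _ _)
      have h6 : Real.exp (-(4 * h + j * v)) * Real.exp (θ' * y) ≤
          Real.exp (-4 * h) * Real.exp (θ' * z) := by
        rw [← Real.exp_add, ← Real.exp_add]
        refine Real.exp_le_exp.2 ?_
        nlinarith
      calc 1 / 4 * p ^ j * Real.exp (-(4 * h + j * v)) * ρ ^ n * Real.exp (θ' * y)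
          = 1 / 4 * p ^ j * ρ ^ n * (Real.exp (-(4 * h + j * v)) * Real.exp (θ' * y)) := by ring
        _ ≤ 1 / 4 * p ^ j * ρ ^ (n - j) * (Real.exp (-4 * h) * Real.exp (θ' * z)) := by gcongr
        _ = _ := by ring

end RoundRobinCusum

/-! ### The mean position of the walk conditioned on survival -/

namespace RoundRobinCusum

variable {μ : Measure ℝ} {A : ℝ}

/-- If the survival probability of the killed walk is not too small, then its conditional
expectation given survival is small relative to the barrier. -/
theorem killedStep_iterate_ofReal_le [SFinite μ] {θ ρ s ε L : ℝ} (t : Tilting μ θ ρ 0 s)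
    (hθ : 0 < θ) (hε : 0 < ε) (hA : 0 < A)
    (hL : Real.exp (-(θ * (ε * A / 2))) ≤ ε / 2 * L) {n : ℕ} (hn : 1 ≤ n) {y : ℝ} (hy : 0 ≤ y)
    (hlow : ENNReal.ofReal (L * ρ ^ n * Real.exp (θ * y)) ≤
      (killedStep μ A)^[n] (fun _ => 1) y) :
    (killedStep μ A)^[n] ENNReal.ofReal y ≤
      ENNReal.ofReal (ε * A) * (killedStep μ A)^[n] (fun _ => 1) y := by
  obtain ⟨n, rfl⟩ : ∃ m, n = m + 1 := ⟨n - 1, by omega⟩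
  set g : ℝ → ℝ≥0∞ := (Set.Ici (ε * A / 2)).indicator (fun _ => 1) with hg
  have hρ0 := t.pos
  -- Values below εA/2 contribute half of the allowance; the rest is bounded by A times the tail
  -- indicator g.
  have hsplit : ∀ z ∈ Set.Ioo 0 A, ENNReal.ofReal z ≤
      ENNReal.ofReal (ε * A / 2) * 1 + ENNReal.ofReal A * g z := by
    intro z hz
    by_cases h : ε * A / 2 ≤ z
    · rw [hg, Set.indicator_of_mem (by exact h), mul_one, mul_one]
      exact (ENNReal.ofReal_le_ofReal hz.2.le).trans le_add_self
    · rw [mul_one]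
      exact (ENNReal.ofReal_le_ofReal (not_le.1 h).le).trans le_self_add
  have hgexp : ∀ z, g z ≤ ENNReal.ofReal (Real.exp (θ * (z - ε * A / 2))) := by
    intro z
    by_cases h : ε * A / 2 ≤ z
    · rw [hg, Set.indicator_of_mem (by exact h)]
      refine ENNReal.one_le_ofReal.2 (Real.one_le_exp (mul_nonneg hθ.le (by linarith)))
    · rw [hg, Set.indicator_of_notMem (by exact h)]
      exact zero_le
  -- Chernoff's bound and the survival bound share the factor ρ^n exp(θy), so their quotient depends
  -- only on A, ε and L.
  have htail : ENNReal.ofReal A * (killedStep μ A)^[n + 1] g y ≤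
      ENNReal.ofReal (ε * A / 2) * (killedStep μ A)^[n + 1] (fun _ => 1) y := by
    calc ENNReal.ofReal A * (killedStep μ A)^[n + 1] g y
        ≤ ENNReal.ofReal A * ENNReal.ofReal (ρ ^ (n + 1) * Real.exp (θ * (y - ε * A / 2))) := by
          gcongr
          exact killedStep_iterate_le_exp t _ hgexp _ _ hy
      _ = ENNReal.ofReal (A * (ρ ^ (n + 1) * Real.exp (θ * (y - ε * A / 2)))) := by
          rw [ENNReal.ofReal_mul hA.le]
      _ ≤ ENNReal.ofReal (ε * A / 2 * (L * ρ ^ (n + 1) * Real.exp (θ * y))) := by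
          refine ENNReal.ofReal_le_ofReal ?_
          have e : Real.exp (θ * (y - ε * A / 2)) =
              Real.exp (-(θ * (ε * A / 2))) * Real.exp (θ * y) := by
            rw [← Real.exp_add]; congr 1; ring
          rw [e]
          calc A * (ρ ^ (n + 1) * (Real.exp (-(θ * (ε * A / 2))) * Real.exp (θ * y)))
              ≤ A * (ρ ^ (n + 1) * (ε / 2 * L * Real.exp (θ * y))) := by gcongr
            _ = _ := by ring
      _ ≤ _ := by
          rw [ENNReal.ofReal_mul (by positivity)]
          gcongr
  calc (killedStep μ A)^[n + 1] ENNReal.ofReal y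
      ≤ (killedStep μ A)^[n + 1]
          (fun z => ENNReal.ofReal (ε * A / 2) * 1 + ENNReal.ofReal A * g z) y :=
        killedStep_iterate_succ_mono n hsplit y
    _ = ENNReal.ofReal (ε * A / 2) * (killedStep μ A)^[n + 1] (fun _ => 1) y +
          ENNReal.ofReal A * (killedStep μ A)^[n + 1] g y := by
        rw [killedStep_iterate_add _ measurable_const,
          killedStep_iterate_const_mul _ ENNReal.ofReal_ne_top (fun _ => 1),
          killedStep_iterate_const_mul _ ENNReal.ofReal_ne_top]
    _ ≤ ENNReal.ofReal (ε * A / 2) * (killedStep μ A)^[n + 1] (fun _ => 1) y +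
          ENNReal.ofReal (ε * A / 2) * (killedStep μ A)^[n + 1] (fun _ => 1) y := by gcongr
    _ = _ := by
        rw [← add_mul, ← ENNReal.ofReal_add (by positivity) (by positivity)]
        congr 2; ring

set_option maxHeartbeats 800000 in
/-- For a log-likelihood-ratio random walk started at `0` and conditioned to stay in `(0, A)` for
`n` steps, the expected position after `n` steps is `o(A)`, uniformly in `n`. -/
theorem eventually_killedStep_iterate_ofReal_le [IsProbabilityMeasure μ]
    (hone : ∫ x, Real.exp x ∂μ = 1) (hne : ¬ ∀ᵐ x ∂μ, x = 0) {ε : ℝ} (hε : 0 < ε) :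
    ∀ᶠ A in atTop, ∀ n : ℕ, (killedStep μ A)^[n] ENNReal.ofReal 0 ≤
      ENNReal.ofReal (ε * A) * (killedStep μ A)^[n] (fun _ => 1) 0 := by
  have hexp : Integrable (fun x => Real.exp x) μ := by
    by_contra h
    rw [integral_undef h] at hone
    norm_num at hone
  obtain ⟨θ, ρ, s, hθ0, hθ1, hρ, hs, t, hθ'⟩ := exists_centered_tilting hexp hone hne
  obtain ⟨u, v, p, hu, huv, hp0, hp1, hp, hp'⟩ := exists_Icc_measure_pos hone hne
  have hv : 0 < v := hu.trans_le huv
  have hlogp : 0 ≤ -Real.log p := by linarith [Real.log_nonpos hp0.le hp1]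
  -- All losses in the survival bound amount to at most a factor exp(-κηA)/4. The choice of η gives
  -- κη ≤ θε/4, half of the Chernoff exponent, and its other branch gives 4h + jv ≤ A.
  set κ := 2 * (-Real.log p) + (4 * u + v) + 1 with hκ
  have hκ0 : 0 < κ := by positivity
  set η := min (1 / (4 * u + v)) (θ * ε / (4 * κ)) with hη
  have hη0 : 0 < η := lt_min (by positivity) (by positivity)
  have hη1 : η * (4 * u + v) ≤ 1 := (le_div_iff₀ (by positivity)).1 (min_le_left _ _)
  have hη2 : η * (4 * κ) ≤ θ * ε := (le_div_iff₀ (by positivity)).1 (min_le_right _ _)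
  obtain ⟨θ', ψ, δ, s', h1, h2, h3, hδ, hρψ, hs', t'⟩ := hθ' η hη0
  set C := 1 / δ + 1 + η with hC
  have hC0 : 0 < C := by positivity
  have hlim : Tendsto (fun A : ℝ => Real.exp (-(θ * ε / 4 * A))) atTop (𝓝 0) := by
    refine Real.tendsto_exp_neg_atTop_nhds_zero.comp ?_
    exact tendsto_id.const_mul_atTop (by positivity)
  filter_upwards [eventually_ge_atTop 1, eventually_ge_atTop (2 / η),
    eventually_ge_atTop (8 * C * s / (η * u) ^ 2), eventually_ge_atTop (8 * C * s' / (η * u) ^ 2),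
    eventually_ge_atTop (2 * δ / (η * u)), hlim.eventually_le_const (show 0 < ε / 8 by positivity)]
    with A hA1 hA2 hA3 hA4 hA5 hA6
  have hA0 : 0 < A := by linarith
  rw [div_le_iff₀ (by positivity)] at hA2 hA3 hA4 hA5
  -- The tube radius h = ju is proportional to A. Variances over N = O(A) steps are O(A), hence
  -- eventually below h²/2.
  set j : ℕ := ⌊η * A⌋₊ with hj
  have hj1 : (j : ℝ) ≤ η * A := Nat.floor_le (by positivity)
  have hj2 : η * A / 2 ≤ j := by
    have := Nat.lt_floor_add_one (η * A)
    rw [← hj] at this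
    linarith
  have hj0 : 0 < j := by
    have : (0 : ℝ) < j := by linarith
    exact_mod_cast this
  set h := (j : ℝ) * u with hh
  have hh2 : η * u * A / 2 ≤ h := by rw [hh]; nlinarith
  have hhpos : 0 < h := by positivity
  -- Time to descend from height A at slope -δ, preceded by j steps away from the upper barrier.
  set N : ℕ := ⌈A / δ⌉₊ + j with hN
  have hNle : (N : ℝ) ≤ C * A := by
    have := Nat.ceil_lt_add_one (show 0 ≤ A / δ by positivity)
    rw [hN, hC]; push_cast
    have e : (1 / δ + 1 + η) * A = A / δ + A + η * A := by ring
    rw [e]; linarith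
  have hsq : (η * u * A / 2) ^ 2 ≤ h ^ 2 := by gcongr
  have hNs : ∀ q : ℝ, 0 ≤ q → 8 * C * q ≤ A * (η * u) ^ 2 → N * q ≤ h ^ 2 / 2 := by
    intro q hq h
    have h4 : (N : ℝ) * q ≤ C * A * q := by gcongr
    have h5 : 8 * C * q * A ≤ A * (η * u) ^ 2 * A := by gcongr
    nlinarith
  have hNs1 := hNs s hs hA3
  have hNs2 := hNs s' hs' hA4
  have htop : 4 * h + j * v ≤ A := by
    have : (j : ℝ) * (4 * u + v) ≤ η * A * (4 * u + v) := by gcongr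
    rw [hh]; nlinarith
  have hδh : δ ≤ h := by linarith
  have hlong : A ≤ (N - j : ℕ) * δ := by
    rw [hN, Nat.add_sub_cancel]
    exact (div_le_iff₀ hδ).1 (Nat.le_ceil _)
  set L := 1 / 4 * p ^ (2 * j) * Real.exp (-(4 * h + j * v)) * Real.exp (-(η * A)) with hL
  have hL0 : 0 < L := by positivity
  have hLexp : Real.exp (-(θ * (ε * A / 2))) ≤ ε / 2 * L := by
    have e1 : p ^ (2 * j) = Real.exp (-(2 * (-Real.log p) * j)) := by
      rw [← Real.exp_log (pow_pos hp0 _), Real.log_pow]; congr 1; push_cast; ring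
    have e2 : 1 / 4 * Real.exp (-(κ * η * A)) ≤ L := by
      rw [hL, e1, mul_assoc (1 / 4 : ℝ), mul_assoc (1 / 4 : ℝ), ← Real.exp_add, ← Real.exp_add]
      gcongr
      have : (2 * (-Real.log p) + (4 * u + v)) * j ≤ (2 * (-Real.log p) + (4 * u + v)) * (η * A) :=
        by gcongr
      rw [hh, hκ]; linarith
    have e3 : Real.exp (-(θ * (ε * A / 2))) =
        Real.exp (-(θ * ε / 4 * A)) * Real.exp (-(θ * ε / 4 * A)) := by
      rw [← Real.exp_add]; congr 1; ring
    have e4 : Real.exp (-(θ * ε / 4 * A)) ≤ Real.exp (-(κ * η * A)) := by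
      refine Real.exp_le_exp.2 ?_
      linarith [mul_le_mul_of_nonneg_right hη2 hA0.le]
    calc Real.exp (-(θ * (ε * A / 2))) ≤ ε / 8 * Real.exp (-(κ * η * A)) := by
          rw [e3]; gcongr
      _ = ε / 2 * (1 / 4 * Real.exp (-(κ * η * A))) := by ring
      _ ≤ _ := by gcongr
  intro n
  rcases Nat.eq_zero_or_pos n with rfl | hn
  · simp
  rcases le_or_gt n N with hnN | hnN
  · refine killedStep_iterate_ofReal_le t hθ0 hε hA0 hLexp hn le_rfl ?_
    have hnN' : (n : ℝ) ≤ N := by exact_mod_cast hnN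
    refine le_trans (ENNReal.ofReal_le_ofReal ?_) (low_le_killedStep_iterate (A := A) (n := n)
      t hθ0 hθ1 hρ hs hu huv hp0 hp1 hp hh hj0 htop (le_trans (by gcongr) hNs1)
      (y := 0) ⟨le_rfl, by positivity⟩)
    have hρ0 := t.pos
    have q1 : p ^ (2 * j) ≤ p ^ j := pow_le_pow_of_le_one hp0.le hp1 (by omega)
    have q2 : Real.exp (-(4 * h + j * v)) ≤ Real.exp (-h) :=
      Real.exp_le_exp.2 (by have : 0 < j * v := by positivity
                            linarith)
    have q3 : Real.exp (-(η * A)) ≤ 1 := Real.exp_le_one_iff.2 (by nlinarith)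
    calc L * ρ ^ n * Real.exp (θ * 0) = L * ρ ^ n := by simp
      _ ≤ 1 / 2 * p ^ j * Real.exp (-h) * 1 * ρ ^ n := by
          rw [hL]; gcongr; norm_num
      _ = _ := by ring
  -- For long periods the estimate is applied to the last N steps, from the state in (0, A) reached
  -- after m + 1 steps, and then integrated over that state.
  · obtain ⟨m, rfl⟩ : ∃ m, n = (m + 1) + N := ⟨n - N - 1, by omega⟩
    have e : ∀ f, (killedStep μ A)^[m + 1 + N] f = (killedStep μ A)^[m + 1]
        ((killedStep μ A)^[N] f) := fun f => Function.iterate_add_apply _ (m + 1) N f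
    rw [e, e, ← killedStep_iterate_const_mul (m + 1) ENNReal.ofReal_ne_top]
    refine killedStep_iterate_succ_mono m (fun y hy => ?_) 0
    refine killedStep_iterate_ofReal_le t hθ0 hε hA0 hLexp (by omega) hy.1.le ?_
    refine le_trans (ENNReal.ofReal_le_ofReal ?_) (exp_le_killedStep_iterate t t' hθ0 h3 h2 hρψ hθ1
      hρ hs hs' hδ hu huv hp0 hp1 hp hp' hh hj0 htop hNs1 hNs2 hδh (by omega) hlong hy)
    have hρ0 := t.pos
    -- Replacing θ' by θ costs at most exp(-ηA), since θ - θ' < η and y < A.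
    have q : Real.exp (-(η * A)) * Real.exp (θ * y) ≤ Real.exp (θ' * y) := by
      rw [← Real.exp_add]
      refine Real.exp_le_exp.2 ?_
      nlinarith [hy.1, hy.2]
    calc L * ρ ^ N * Real.exp (θ * y) = 1 / 4 * p ^ (2 * j) * Real.exp (-(4 * h + j * v)) * ρ ^ N *
          (Real.exp (-(η * A)) * Real.exp (θ * y)) := by rw [hL]; ring
      _ ≤ _ := by gcongr

end RoundRobinCusum

namespace RoundRobinCusum

/-! ### Log-likelihood ratios -/

section LogLikelihoodRatio

variable {X : Type*} [MeasurableSpace X] {H F G : Measure X} [IsProbabilityMeasure H]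
  [IsProbabilityMeasure F]

theorem integrable_exp_llr (hFH : F ≪ H) : Integrable (fun x => Real.exp (llr H F x)) F :=
  (integrable_congr (exp_llr_of_ac' H F hFH)).2 Measure.integrable_toReal_rnDeriv

theorem integral_exp_llr (hHF : H ≪ F) (hFH : F ≪ H) : ∫ x, Real.exp (llr H F x) ∂F = 1 := by
  rw [integral_congr_ae (exp_llr_of_ac' H F hFH), Measure.integral_toReal_rnDeriv hHF]
  simp

theorem not_ae_llr_eq_zero (hHF : H ≪ F) (hFH : F ≪ H) (hne : H ≠ F) :
    ¬ ∀ᵐ x ∂F, llr H F x = 0 := by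
  intro h
  refine hne ?_
  have h1 : H.rnDeriv F =ᵐ[F] 1 := by
    filter_upwards [h, exp_llr_of_ac' H F hFH, Measure.rnDeriv_ne_top H F] with x h1 h2 h3
    rw [h1, Real.exp_zero] at h2
    rw [← ENNReal.ofReal_toReal h3, ← h2]; simp
  rw [← Measure.withDensity_rnDeriv_eq H F hHF, withDensity_congr_ae h1, withDensity_one]

/-- The function exp(t) - 1 - t is nonnegative and vanishes only at t = 0; its integral along the
log-likelihood ratio is minus the mean because the exponential has mean one. -/
theorem integral_llr_neg (hHF : H ≪ F) (hFH : F ≪ H) (hne : H ≠ F)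
    (hint : Integrable (llr H F) F) : ∫ x, llr H F x ∂F < 0 := by
  have hexp := integrable_exp_llr (F := F) hFH
  have hi : Integrable (fun x => Real.exp (llr H F x) - 1 - llr H F x) F :=
    (hexp.sub (integrable_const _)).sub hint
  have h0 : ∀ x, 0 ≤ Real.exp (llr H F x) - 1 - llr H F x := fun x => by
    linarith [Real.add_one_le_exp (llr H F x)]
  have e : ∫ x, (Real.exp (llr H F x) - 1 - llr H F x) ∂F = - ∫ x, llr H F x ∂F := by
    refine (integral_sub (hexp.sub (integrable_const _)) hint).trans ?_
    rw [integral_sub' hexp (integrable_const _), integral_exp_llr hHF hFH]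
    simp
  have hpos : 0 < ∫ x, (Real.exp (llr H F x) - 1 - llr H F x) ∂F := by
    refine lt_of_le_of_ne (integral_nonneg h0) fun h => not_ae_llr_eq_zero hHF hFH hne ?_
    filter_upwards [(integral_eq_zero_iff_of_nonneg h0 hi).1 h.symm] with x hx
    by_contra hx0
    have := Real.add_one_lt_exp hx0
    have hx' : Real.exp (llr H F x) - 1 - llr H F x = 0 := hx
    linarith
  linarith

theorem integral_llr_pos (hHF : H ≪ F) (hFH : F ≪ H) (hne : H ≠ F)
    (hint : Integrable (llr H F) H) : 0 < ∫ x, llr H F x ∂H := by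
  have h := neg_llr hHF
  have h1 : Integrable (llr F H) H := (integrable_congr h).1 hint.neg
  have h2 := integral_llr_neg hFH hHF hne.symm h1
  rw [← integral_congr_ae h] at h2
  simp only [Pi.neg_apply, integral_neg] at h2
  linarith

theorem integrable_exp_neg_llr (hHF : H ≪ F) : Integrable (fun x => Real.exp (-llr H F x)) H :=
  (integrable_congr (exp_neg_llr hHF)).2 Measure.integrable_toReal_rnDeriv

/-- A random variable with positive mean and an exponential moment has a Laplace transform that is
smaller than one somewhere. -/
theorem exists_integral_exp_neg_lt_one [IsProbabilityMeasure G] {f : X → ℝ}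
    (hf : Integrable f G) (hexp : Integrable (fun x => Real.exp (-f x)) G) (hpos : 0 < ∫ x, f x ∂G) :
    ∃ r : ℝ, 0 < r ∧ Integrable (fun x => Real.exp (-(r * f x))) G ∧
      ∫ x, Real.exp (-(r * f x)) ∂G < 1 := by
  have hupper : ∀ r ∈ Set.Ioc (0 : ℝ) 1, ∀ t : ℝ, Real.exp (-(r * t)) ≤ 1 - r + r * Real.exp (-t) := by
    intro r hr t
    have := convexOn_exp.2 (Set.mem_univ 0) (Set.mem_univ (-t)) (sub_nonneg.2 hr.2) hr.1.le
      (by ring : (1 - r) + r = 1)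
    simpa using this
  have hlower : ∀ r t : ℝ, 1 - r * t ≤ Real.exp (-(r * t)) := fun r t => by
    linarith [Real.add_one_le_exp (-(r * t))]
  have hr : ∀ n : ℕ, 1 / ((n : ℝ) + 1) ∈ Set.Ioc (0 : ℝ) 1 := fun n =>
    ⟨Nat.one_div_pos_of_nat, by
      rw [div_le_one (by positivity)]
      linarith [Nat.cast_nonneg (α := ℝ) n]⟩
  have hmeas : ∀ r : ℝ, AEStronglyMeasurable (fun x => Real.exp (-(r * f x))) G := fun r =>
    Real.continuous_exp.comp_aestronglyMeasurable (hf.aestronglyMeasurable.const_mul r).neg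
  have hint : ∀ r ∈ Set.Ioc (0 : ℝ) 1, Integrable (fun x => Real.exp (-(r * f x))) G := by
    intro r hr
    refine Integrable.mono' ((integrable_const (1 - r)).add (hexp.const_mul r)) (hmeas r)
      (ae_of_all _ fun x => ?_)
    rw [Real.norm_eq_abs, abs_of_pos (Real.exp_pos _)]
    exact hupper r hr _
  -- The Laplace transform is differentiated at 0 along r = 1/(n+1). Convexity of the exponential
  -- bounds the difference quotients by |f| + exp(-f) + 1.
  have hlim : Tendsto (fun n : ℕ => ∫ x, (1 - Real.exp (-(1 / ((n : ℝ) + 1) * f x))) /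
      (1 / ((n : ℝ) + 1)) ∂G) atTop (𝓝 (∫ x, f x ∂G)) := by
    refine tendsto_integral_of_dominated_convergence (fun x => |f x| + Real.exp (-f x) + 1)
      (fun n => ?_) ((hf.abs.add hexp).add (integrable_const _)) (fun n => ?_) ?_
    · exact (((hmeas _).aemeasurable.const_sub 1).div_const _).aestronglyMeasurable
    · refine ae_of_all _ fun x => ?_
      have h1 := (hr n).1
      have h2 := hupper _ (hr n) (f x)
      have h3 := hlower (1 / ((n : ℝ) + 1)) (f x)
      rw [Real.norm_eq_abs, abs_le]
      constructor
      · rw [le_div_iff₀ h1]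
        nlinarith [abs_nonneg (f x), Real.exp_pos (-f x)]
      · rw [div_le_iff₀ h1]
        nlinarith [le_abs_self (f x), Real.exp_pos (-f x)]
    · refine ae_of_all _ fun x => ?_
      have hd : HasDerivAt (fun r : ℝ => Real.exp (-(r * f x))) (-(f x)) 0 := by
        have := ((hasDerivAt_id (0 : ℝ)).mul_const (f x)).neg.exp
        simpa using this
      have ht := hd.tendsto_slope_zero.comp (tendsto_nhdsWithin_iff.2
        ⟨tendsto_one_div_add_atTop_nhds_zero_nat (𝕜 := ℝ),
          Eventually.of_forall fun n => (hr n).1.ne'⟩)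
      have ht' := ht.neg
      rw [neg_neg] at ht'
      refine ht'.congr fun n => ?_
      simp only [Function.comp_apply, smul_eq_mul, zero_add, zero_mul, neg_zero, Real.exp_zero]
      field_simp
      ring
  obtain ⟨n, hn⟩ := (hlim.eventually_const_lt hpos).exists
  refine ⟨1 / ((n : ℝ) + 1), (hr n).1, hint _ (hr n), ?_⟩
  rw [integral_div, integral_sub (integrable_const _) (hint _ (hr n))] at hn
  have := (div_pos_iff_of_pos_right (hr n).1).1 hn
  simp at this
  simpa using this

end LogLikelihoodRatio

/-! ### Marginals and mixtures -/

section Mixture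

variable {K : ℕ} {𝓧 : Fin K → Type*} [∀ k, MeasurableSpace (𝓧 k)]
  {F : ProbabilityMeasure (∀ k, 𝓧 k)} {𝒢 : Set (ProbabilityMeasure (∀ k, 𝓧 k))}

instance (G : ProbabilityMeasure (∀ k, 𝓧 k)) (k : Fin K) : IsProbabilityMeasure (marginal G k) :=
  Measure.isProbabilityMeasure_map (measurable_pi_apply k).aemeasurable

theorem mem_affected {G : ProbabilityMeasure (∀ k, 𝓧 k)} {k : Fin K} :
    k ∈ affected F G ↔ marginal G k ≠ marginal F k := by
  simp [affected]

theorem marginal_mem_postFamily {G : ProbabilityMeasure (∀ k, 𝓧 k)} (hG : G ∈ 𝒢) {k : Fin K}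
    (hk : k ∈ affected F G) : marginal G k ∈ postFamily F 𝒢 k :=
  ⟨G, hG, rfl, mem_affected.1 hk⟩

theorem isProbabilityMeasure_of_mem_postFamily {k : Fin K} {P : Measure (𝓧 k)}
    (hP : P ∈ postFamily F 𝒢 k) : IsProbabilityMeasure P := by
  obtain ⟨G, -, rfl, -⟩ := hP
  infer_instance

/-- This domination passes both absolute continuity and the exponential moment from each member to
the mixture or back. -/
theorem le_smul_mixture {k : Fin K} (hfam : (postFamily F 𝒢 k).Finite) {P : Measure (𝓧 k)}
    (hP : P ∈ postFamily F 𝒢 k) : P ≤ ((postFamily F 𝒢 k).ncard : ℝ≥0∞) • mixture F 𝒢 k := by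
  have h0 : ((postFamily F 𝒢 k).ncard : ℝ≥0∞) ≠ 0 := by
    simpa [Set.ncard_eq_zero hfam] using (Set.nonempty_of_mem hP).ne_empty
  rw [mixture, smul_smul, ENNReal.mul_inv_cancel h0 (ENNReal.natCast_ne_top _), one_smul]
  exact Measure.le_sum (fun P : postFamily F 𝒢 k => (P : Measure (𝓧 k))) ⟨P, hP⟩

theorem integral_mixture {k : Fin K} (hfam : (postFamily F 𝒢 k).Nonempty)
    (hfin : (postFamily F 𝒢 k).Finite) {f : 𝓧 k → ℝ} {c : ℝ}
    (hf : ∀ P ∈ postFamily F 𝒢 k, Integrable f P ∧ ∫ x, f x ∂P = c) :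
    Integrable f (mixture F 𝒢 k) ∧ ∫ x, f x ∂(mixture F 𝒢 k) = c := by
  have h0 : (postFamily F 𝒢 k).ncard ≠ 0 := by
    simpa [Set.ncard_eq_zero hfin] using hfam.ne_empty
  have := hfin.fintype
  have hi : Integrable f (Measure.sum (fun P : postFamily F 𝒢 k => (P : Measure (𝓧 k)))) := by
    rw [Measure.sum_fintype]
    exact integrable_finsetSum_measure.2 fun P _ => (hf P P.2).1
  refine ⟨hi.smul_measure (by simp [h0]), ?_⟩
  rw [mixture, integral_smul_measure, Measure.sum_fintype,
    integral_finsetSum_measure (s := Finset.univ)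
      (μ := fun P : postFamily F 𝒢 k => (P : Measure (𝓧 k))) fun P _ => (hf P P.2).1,
    Finset.sum_congr rfl fun (P : postFamily F 𝒢 k) _ => (hf (P : Measure (𝓧 k)) P.2).2]
  simp only [Finset.sum_const, Finset.card_univ, ENNReal.toReal_inv, ENNReal.toReal_natCast,
    nsmul_eq_mul, smul_eq_mul]
  rw [← Nat.card_eq_fintype_card, Nat.card_coe_set_eq]
  field_simp

theorem isProbabilityMeasure_mixture {k : Fin K} (hfam : (postFamily F 𝒢 k).Nonempty)
    (hfin : (postFamily F 𝒢 k).Finite) : IsProbabilityMeasure (mixture F 𝒢 k) := by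
  have h0 : (postFamily F 𝒢 k).ncard ≠ 0 := by
    simpa [Set.ncard_eq_zero hfin] using hfam.ne_empty
  have := hfin.fintype
  constructor
  have h1 : ∀ P : postFamily F 𝒢 k, (P : Measure (𝓧 k)) Set.univ = 1 := fun P =>
    (isProbabilityMeasure_of_mem_postFamily P.2).measure_univ
  rw [mixture, Measure.smul_apply, Measure.sum_fintype, Measure.finsetSum_apply]
  simp only [h1, Finset.sum_const, Finset.card_univ, smul_eq_mul, nsmul_eq_mul, mul_one]
  rw [← Nat.card_eq_fintype_card, Nat.card_coe_set_eq]
  exact ENNReal.inv_mul_cancel (by exact_mod_cast h0) (ENNReal.natCast_ne_top _)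

theorem mixture_ac {k : Fin K} (hac : ∀ P ∈ postFamily F 𝒢 k, P ≪ marginal F k) :
    mixture F 𝒢 k ≪ marginal F k :=
  Measure.smul_absolutelyContinuous.trans
    (Measure.absolutelyContinuous_sum_left fun P : postFamily F 𝒢 k => hac P P.2)

theorem ac_mixture {k : Fin K} (hfin : (postFamily F 𝒢 k).Finite) {P : Measure (𝓧 k)}
    (hP : P ∈ postFamily F 𝒢 k) : P ≪ mixture F 𝒢 k :=
  (Measure.absolutelyContinuous_of_le (le_smul_mixture hfin hP)).trans
    Measure.smul_absolutelyContinuous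

theorem mixture_eq_of_singleton {k : Fin K} {P : Measure (𝓧 k)} (h : postFamily F 𝒢 k = {P}) :
    mixture F 𝒢 k = P := by
  rw [mixture, h]
  simp only [Set.ncard_singleton, Nat.cast_one, inv_one, one_smul]
  have : Unique ({P} : Set (Measure (𝓧 k))) := Set.uniqueSingleton P
  rw [Measure.sum_fintype, Fintype.sum_unique]
  exact (default : ({P} : Set (Measure (𝓧 k)))).2

end Mixture

end RoundRobinCusum

namespace RoundRobinCusum

universe u

/-! ### Independence of the next observation from the past -/

section Past

variable {R : Type*} [MeasurableSpace R] {Z : Type*} [MeasurableSpace Z]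

/-- The σ-algebra of the randomization and of the data up to time `N`. -/
abbrev pastSigma (R Z : Type*) [MeasurableSpace R] [MeasurableSpace Z] (N : ℕ) :
    MeasurableSpace (R × (ℕ → Z)) :=
  MeasurableSpace.comap (fun ω => (ω.1, (Finset.range N).restrict ω.2)) inferInstance

theorem measurable_pastSigma_fst (N : ℕ) :
    Measurable[pastSigma R Z N] (fun ω : R × (ℕ → Z) => ω.1) :=
  (measurable_fst (α := R) (β := Finset.range N → Z)).comp
    (comap_measurable (fun ω : R × (ℕ → Z) => (ω.1, (Finset.range N).restrict ω.2)))

theorem measurable_pastSigma_eval {n N : ℕ} (h : n < N) :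
    Measurable[pastSigma R Z N] (fun ω : R × (ℕ → Z) => ω.2 n) :=
  ((measurable_pi_apply (⟨n, Finset.mem_range.2 h⟩ : Finset.range N)).comp measurable_snd).comp
    (comap_measurable (fun ω : R × (ℕ → Z) => (ω.1, (Finset.range N).restrict ω.2)))

theorem pastSigma_le (N : ℕ) : pastSigma R Z N ≤ (inferInstance : MeasurableSpace (R × (ℕ → Z))) :=
  Measurable.comap_le (by fun_prop)

theorem pastSigma_mono {M N : ℕ} (h : M ≤ N) : pastSigma R Z M ≤ pastSigma R Z N := by
  have hr : Measurable (fun q : R × (Finset.range N → Z) =>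
      (q.1, fun i : Finset.range M => q.2 ⟨i, Finset.range_mono h i.2⟩)) :=
    measurable_fst.prodMk (measurable_pi_lambda _ fun i =>
      (measurable_pi_apply _).comp measurable_snd)
  exact (hr.comp (comap_measurable
    (fun ω : R × (ℕ → Z) => (ω.1, (Finset.range N).restrict ω.2)))).comap_le

variable {B : Type*} [MeasurableSpace B] (ρ : Measure R) [IsProbabilityMeasure ρ]
  (ℓ : ℕ → Measure Z) [∀ n, IsProbabilityMeasure (ℓ n)]

/-- Independence under the infinite product of two disjoint blocks of coordinates, combined with the
independent randomization by reassociating the triple product. All one-step computations rest on it.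
-/
theorem indepFun_past_eval (N : ℕ) :
    IndepFun (fun ω : R × (ℕ → Z) => (ω.1, (Finset.range N).restrict ω.2))
      (fun ω : R × (ℕ → Z) => ω.2 N) (ρ.prod (Measure.infinitePi ℓ)) := by
  set π := Measure.infinitePi ℓ with hπ
  have hr : Measurable (fun x : ℕ → Z => (Finset.range N).restrict x) := by fun_prop
  have he : Measurable (fun x : ℕ → Z => x N) := by fun_prop
  have h1 : IndepFun (fun x : ℕ → Z => (Finset.range N).restrict x) (fun x : ℕ → Z => x N) π := by
    have h := iIndepFun_infinitePi (P := ℓ) (X := fun _ x => x) (fun _ => measurable_id)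
    have h' := h.indepFun_finset (Finset.range N) {N} (by simp) (fun i => by fun_prop)
    have hψ : Measurable (fun x : ({N} : Finset ℕ) → Z => x ⟨N, Finset.mem_singleton_self N⟩) :=
      measurable_pi_apply _
    exact h'.comp measurable_id hψ
  have h2 := (indepFun_iff_map_prod_eq_prod_map_map hr.aemeasurable he.aemeasurable).1 h1
  have hprob : IsProbabilityMeasure (π.map fun x : ℕ → Z => (Finset.range N).restrict x) :=
    Measure.isProbabilityMeasure_map hr.aemeasurable
  have hprob' : IsProbabilityMeasure (π.map fun x : ℕ → Z => x N) :=
    Measure.isProbabilityMeasure_map he.aemeasurable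
  have hu : (ρ.prod π).map (fun ω : R × (ℕ → Z) => (ω.1, (Finset.range N).restrict ω.2)) =
      ρ.prod (π.map fun x : ℕ → Z => (Finset.range N).restrict x) := by
    have := Measure.map_prod_map ρ π measurable_id hr
    rw [Measure.map_id] at this
    exact this.symm
  have hv : (ρ.prod π).map (fun ω : R × (ℕ → Z) => ω.2 N) = π.map fun x : ℕ → Z => x N := by
    have : (fun ω : R × (ℕ → Z) => ω.2 N) = (fun x : ℕ → Z => x N) ∘ Prod.snd := rfl
    rw [this, ← Measure.map_map he measurable_snd]
    change Measure.map _ ((ρ.prod π).snd) = _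
    rw [Measure.snd_prod]
  rw [indepFun_iff_map_prod_eq_prod_map_map (by fun_prop) (by fun_prop), hu, hv]
  have hw := Measure.map_prod_map ρ π measurable_id (hr.prodMk he)
  rw [Measure.map_id, h2, ← Measure.prodAssoc_prod] at hw
  have hx := congrArg (Measure.map (MeasurableEquiv.prodAssoc
    (α := R) (β := Finset.range N → Z) (γ := Z)).symm) hw
  rw [MeasurableEquiv.map_symm_map, Measure.map_map (MeasurableEquiv.measurable _) (by fun_prop)]
    at hx
  rw [hx]
  rfl

theorem map_eval_prod (N : ℕ) :
    (ρ.prod (Measure.infinitePi ℓ)).map (fun ω : R × (ℕ → Z) => ω.2 N) = ℓ N := by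
  have : (fun ω : R × (ℕ → Z) => ω.2 N) = (fun x : ℕ → Z => x N) ∘ Prod.snd := rfl
  rw [this, ← Measure.map_map (by fun_prop) measurable_snd]
  change Measure.map _ ((ρ.prod _).snd) = _
  rw [Measure.snd_prod, Measure.infinitePi_map_eval]

/-- The next observation can be integrated out, given the past. -/
theorem lintegral_next (N : ℕ) {u : R × (ℕ → Z) → B} (hu : Measurable[pastSigma R Z N] u)
    {f : B × Z → ℝ≥0∞} (hf : Measurable f) :
    ∫⁻ ω, f (u ω, ω.2 N) ∂(ρ.prod (Measure.infinitePi ℓ)) =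
      ∫⁻ ω, ∫⁻ z, f (u ω, z) ∂(ℓ N) ∂(ρ.prod (Measure.infinitePi ℓ)) := by
  set P := ρ.prod (Measure.infinitePi ℓ)
  have hu' : Measurable u := hu.mono (pastSigma_le N) le_rfl
  have hY : Measurable (fun ω : R × (ℕ → Z) => ω.2 N) := by fun_prop
  have hind : IndepFun u (fun ω : R × (ℕ → Z) => ω.2 N) P := by
    have h := (IndepFun_iff_Indep _ _ _).1 (indepFun_past_eval ρ ℓ N)
    exact (IndepFun_iff_Indep _ _ _).2 (indep_of_indep_of_le_left h hu.comap_le)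
  have hmap := (indepFun_iff_map_prod_eq_prod_map_map hu'.aemeasurable hY.aemeasurable).1 hind
  have hprob : IsProbabilityMeasure (P.map u) := Measure.isProbabilityMeasure_map hu'.aemeasurable
  rw [← lintegral_map (f := f) (g := fun ω => (u ω, ω.2 N)) hf (hu'.prodMk hY), hmap,
    map_eval_prod, lintegral_prod _ hf.aemeasurable,
    lintegral_map (f := fun b => ∫⁻ z, f (b, z) ∂(ℓ N)) hf.lintegral_prod_right' hu']

end Past

/-! ### Policies -/

section Policy

variable {K : ℕ} {𝓧 : Fin K → Type u} [∀ k, MeasurableSpace (𝓧 k)] (p : Policy K 𝓧)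
  {F G : ProbabilityMeasure (∀ k, 𝓧 k)}

instance (ν : ℕ) : IsProbabilityMeasure (p.law F G ν) := by
  unfold Policy.law; infer_instance

instance : IsProbabilityMeasure (p.lawInf F) := by
  unfold Policy.lawInf; infer_instance

/-- The sampled source at each time depends on the past alone, so observed quantities are covered by
`lintegral_next`. -/
theorem obsSigma_le_pastSigma (n : ℕ) : obsSigma p.S n ≤ pastSigma p.R (∀ k, 𝓧 k) n := by
  induction n with
  | zero => exact (measurable_pastSigma_fst 0).comap_le
  | succ n ih =>
    refine sup_le (ih.trans (pastSigma_mono n.le_succ)) (Measurable.comap_le ?_)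
    have hS : Measurable[pastSigma p.R (∀ k, 𝓧 k) (n + 1)] (p.S n) :=
      (p.measurable_S n).mono (ih.trans (pastSigma_mono n.le_succ)) le_rfl
    intro B hB
    have : obs p.S n ⁻¹' B = ⋃ k, {ω : p.Ω | p.S n ω = k} ∩
        (fun ω : p.Ω => ω.2 n k) ⁻¹' (Sigma.mk k ⁻¹' B) := by
      ext ω
      simp only [obs, Set.mem_preimage, Set.mem_iUnion, Set.mem_inter_iff]
      constructor
      · intro h
        exact ⟨p.S n ω, rfl, h⟩
      · rintro ⟨k, rfl, h⟩
        exact h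
    rw [this]
    refine MeasurableSet.iUnion fun k => (hS (measurableSet_singleton k)).inter ?_
    have hB' := MeasurableSpace.measurableSet_iInf.1 hB k
    exact ((measurable_pi_apply k).comp (measurable_pastSigma_eval n.lt_succ_self)) hB'

theorem measurableSet_lt_T (n : ℕ) : MeasurableSet[obsSigma p.S n] {ω | (n : ℕ∞) < p.T ω} := by
  have : {ω | (n : ℕ∞) < p.T ω} = (⋃ j ∈ Set.Iic n, {ω | p.T ω = j})ᶜ := by
    ext ω
    simp only [Set.mem_ofPred_eq, Set.mem_compl_iff, Set.mem_iUnion, Set.mem_Iic, not_exists]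
    constructor
    · rintro h j hj h'
      rw [h'] at h
      have : n < j := by exact_mod_cast h
      omega
    · intro h
      by_contra hc
      obtain ⟨j, hj⟩ := ENat.ne_top_iff_exists.1 (ne_top_of_le_ne_top (ENat.natCast_ne_top n)
        (not_lt.1 hc))
      have : (j : ℕ∞) ≤ n := hj ▸ not_lt.1 hc
      exact h j (by exact_mod_cast this) hj.symm
  rw [this]
  refine MeasurableSet.compl (MeasurableSet.biUnion (Set.to_countable _) fun j hj => ?_)
  have hle : obsSigma p.S j ≤ obsSigma p.S n :=
    monotone_nat_of_le_succ (f := obsSigma p.S) (fun _ => le_sup_left) hj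
  exact hle _ (p.measurableSet_T j)

theorem measurableSet_lt_T' (n : ℕ) : MeasurableSet {ω | (n : ℕ∞) < p.T ω} :=
  p.obsSigma_le n _ (measurableSet_lt_T p n)

/-- The tail-sum formula: expected delays become sums of survival probabilities, also when the alarm
time is infinite. -/
theorem toENNReal_sub_natCast_eq_tsum (t : ℕ∞) (ν : ℕ) :
    ((t - (ν : ℕ∞) : ℕ∞) : ℝ≥0∞) = ∑' n : ℕ, if ((ν + n : ℕ) : ℕ∞) < t then 1 else 0 := by
  induction t using ENat.recTopCoe with
  | top =>
    simp
  | coe m =>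
    have h : ∀ n : ℕ, (((ν + n : ℕ) : ℕ∞) < (m : ℕ∞)) ↔ n ∈ Finset.range (m - ν) := by
      intro n
      rw [Finset.mem_range]
      constructor
      · intro h
        have : ν + n < m := by exact_mod_cast h
        omega
      · intro h
        have : ν + n < m := by omega
        exact_mod_cast this
    simp_rw [h]
    rw [tsum_eq_sum (s := Finset.range (m - ν)) (fun n hn => by simp [hn])]
    rw [Finset.sum_congr rfl fun n hn => if_pos hn]
    simp only [Finset.sum_const, Finset.card_range, nsmul_eq_mul, mul_one]
    norm_cast

theorem setLIntegral_T_sub (P : Measure p.Ω) (E : Set p.Ω) (ν : ℕ) :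
    ∫⁻ ω in E, ((p.T ω - (ν : ℕ∞) : ℕ∞) : ℝ≥0∞) ∂P =
      ∑' n : ℕ, P (E ∩ {ω | ((ν + n : ℕ) : ℕ∞) < p.T ω}) := by
  simp_rw [toENNReal_sub_natCast_eq_tsum]
  have hind : ∀ n : ℕ, (fun ω => if ((ν + n : ℕ) : ℕ∞) < p.T ω then (1 : ℝ≥0∞) else 0) =
      {ω | ((ν + n : ℕ) : ℕ∞) < p.T ω}.indicator 1 := fun n => by
    ext ω; simp [Set.indicator_apply]
  rw [lintegral_tsum]
  · refine tsum_congr fun n => ?_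
    rw [hind, lintegral_indicator_one (measurableSet_lt_T' p _),
      Measure.restrict_apply (measurableSet_lt_T' p _), Set.inter_comm]
  · intro n
    rw [hind]
    exact (measurable_one.indicator (measurableSet_lt_T' p _)).aemeasurable

/-- A bound for the worst-case delay, from bounds on all events of the history. -/
theorem delay_le {C : ℝ≥0∞}
    (h : ∀ ν : ℕ, ∀ E, MeasurableSet[p.affectedHistory F G ν] E →
      ∑' n : ℕ, p.law F G ν (E ∩ {ω | ((ν + n : ℕ) : ℕ∞) < p.T ω}) ≤
        C * p.law F G ν (E ∩ {ω | (ν : ℕ∞) < p.T ω})) :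
    p.delay F G ≤ C := by
  refine iSup_le fun ν => ?_
  have hm := p.affectedHistory_le F G ν
  set Q := cond (p.law F G ν) {ω | (ν : ℕ∞) < p.T ω} with hQ
  have hfin : IsFiniteMeasure Q := by
    rw [hQ]; infer_instance
  refine essSup_le_of_ae_le _ ?_
  -- A pointwise bound on the conditional expectation is tested on the events of the history, for
  -- the restricted measure.
  refine ae_of_ae_trim hm (μ := Q) ?_
  refine ae_le_of_forall_setLIntegral_le_of_sigmaFinite (measurable_condLExp _ _ _) ?_
  intro E hE _
  rw [setLIntegral_condLExp_trim hm _ _ hE, setLIntegral_const, trim_measurableSet_eq hm hE]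
  have hT := measurableSet_lt_T' p ν
  have hE' := hm E hE
  rw [hQ, ProbabilityTheory.cond, Measure.restrict_smul, lintegral_smul_measure,
    Measure.restrict_restrict hE', setLIntegral_T_sub p, Measure.smul_apply,
    Measure.restrict_apply hE', smul_eq_mul, smul_eq_mul, mul_left_comm]
  gcongr
  refine le_trans (le_of_eq (tsum_congr fun n => ?_)) (h ν E hE)
  congr 1
  ext ω
  simp only [Set.mem_inter_iff, Set.mem_ofPred_eq]
  constructor
  · rintro ⟨⟨h1, _⟩, h3⟩; exact ⟨h1, h3⟩
  · rintro ⟨h1, h3⟩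
    refine ⟨⟨h1, lt_of_le_of_lt ?_ h3⟩, h3⟩
    exact_mod_cast Nat.le_add_right ν n

/-- The worst-case delay is at least the conditional expected delay for any change-point. -/
theorem le_delay (ν : ℕ) :
    ∑' n : ℕ, p.law F G ν {ω | ((ν + n : ℕ) : ℕ∞) < p.T ω} ≤
      p.delay F G * p.law F G ν {ω | (ν : ℕ∞) < p.T ω} := by
  set P := p.law F G ν with hP
  have hT := measurableSet_lt_T' p ν
  have hsub : ∀ n : ℕ, {ω | ((ν + n : ℕ) : ℕ∞) < p.T ω} ⊆ {ω | (ν : ℕ∞) < p.T ω} := by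
    intro n ω hω
    have hω' : ((ν + n : ℕ) : ℕ∞) < p.T ω := hω
    refine lt_of_le_of_lt (b := ((ν + n : ℕ) : ℕ∞)) ?_ hω'
    exact_mod_cast Nat.le_add_right ν n
  by_cases h0 : P {ω | (ν : ℕ∞) < p.T ω} = 0
  · have : ∀ n : ℕ, P {ω | ((ν + n : ℕ) : ℕ∞) < p.T ω} = 0 := fun n =>
      measure_mono_null (hsub n) h0
    rw [ENNReal.tsum_eq_zero.2 this]
    exact zero_le
  have hm := p.affectedHistory_le F G ν
  set Q := cond P {ω | (ν : ℕ∞) < p.T ω} with hQ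
  have hprob : IsProbabilityMeasure Q := cond_isProbabilityMeasure h0
  set f : p.Ω → ℝ≥0∞ := fun ω => ((p.T ω - (ν : ℕ∞) : ℕ∞) : ℝ≥0∞) with hf
  -- The conditional mean of the delay is the average of its conditional expectation, hence at most
  -- the essential supremum.
  have h1 : ∫⁻ ω, f ω ∂Q ≤ p.delay F G := by
    calc ∫⁻ ω, f ω ∂Q = ∫⁻ ω, condLExp (p.affectedHistory F G ν) Q f ω ∂Q :=
          (lintegral_condLExp hm Q f).symm
      _ ≤ ∫⁻ _, essSup (condLExp (p.affectedHistory F G ν) Q f) Q ∂Q :=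
          lintegral_mono_ae (ENNReal.ae_le_essSup _)
      _ = essSup (condLExp (p.affectedHistory F G ν) Q f) Q := by simp
      _ ≤ _ := le_iSup (fun ν : ℕ => essSup (condLExp (p.affectedHistory F G ν)
          (cond (p.law F G ν) {ω | (ν : ℕ∞) < p.T ω})
          (fun ω => ((p.T ω - (ν : ℕ∞) : ℕ∞) : ℝ≥0∞)))
          (cond (p.law F G ν) {ω | (ν : ℕ∞) < p.T ω})) ν
  rw [hQ, ProbabilityTheory.cond, lintegral_smul_measure, setLIntegral_T_sub p,
    smul_eq_mul] at h1
  have h2 : ∑' n : ℕ, P {ω | ((ν + n : ℕ) : ℕ∞) < p.T ω} =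
      ∑' n : ℕ, P ({ω | (ν : ℕ∞) < p.T ω} ∩ {ω | ((ν + n : ℕ) : ℕ∞) < p.T ω}) :=
    tsum_congr fun n => by rw [Set.inter_eq_self_of_subset_right (hsub n)]
  rw [h2]
  calc _ = (P {ω | (ν : ℕ∞) < p.T ω})⁻¹ * (∑' n : ℕ, P ({ω | (ν : ℕ∞) < p.T ω} ∩
        {ω | ((ν + n : ℕ) : ℕ∞) < p.T ω})) * P {ω | (ν : ℕ∞) < p.T ω} := by
        rw [mul_right_comm, ENNReal.inv_mul_cancel h0 (measure_ne_top _ _), one_mul]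
    _ ≤ _ := by gcongr

end Policy

end RoundRobinCusum

/-! ### Transitions of the round robin CUSUM and its mean time to false alarm -/

namespace RoundRobinCusum

universe u

variable {K : ℕ} {𝓧 : Fin K → Type u} [∀ k, MeasurableSpace (𝓧 k)]

/-- The law of a policy and of independent data with distributions `ℓ 0, ℓ 1, …`. -/
def Policy.seqLaw (p : Policy K 𝓧) (ℓ : ℕ → ProbabilityMeasure (∀ k, 𝓧 k)) : Measure p.Ω :=
  (p.ρ : Measure p.R).prod (Measure.infinitePi (fun n => (ℓ n : Measure (∀ k, 𝓧 k))))

theorem law_eq_seqLaw (p : Policy K 𝓧) (F G : ProbabilityMeasure (∀ k, 𝓧 k)) (ν : ℕ) :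
    p.law F G ν = p.seqLaw (fun n => if n < ν then F else G) := rfl

theorem lawInf_eq_seqLaw (p : Policy K 𝓧) (F : ProbabilityMeasure (∀ k, 𝓧 k)) :
    p.lawInf F = p.seqLaw (fun _ => F) := rfl

instance (p : Policy K 𝓧) (ℓ : ℕ → ProbabilityMeasure (∀ k, 𝓧 k)) :
    IsProbabilityMeasure (p.seqLaw ℓ) := by
  unfold Policy.seqLaw; infer_instance

variable {p : Policy K 𝓧} {ℓ : ℕ → ProbabilityMeasure (∀ k, 𝓧 k)}

theorem seqLaw_lintegral_next {B : Type*} [MeasurableSpace B] (N : ℕ) {u : p.Ω → B}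
    (hu : Measurable[pastSigma p.R (∀ k, 𝓧 k) N] u) {f : B × (∀ k, 𝓧 k) → ℝ≥0∞}
    (hf : Measurable f) :
    ∫⁻ ω, f (u ω, ω.2 N) ∂(p.seqLaw ℓ) =
      ∫⁻ ω, ∫⁻ z, f (u ω, z) ∂(ℓ N : Measure (∀ k, 𝓧 k)) ∂(p.seqLaw ℓ) :=
  lintegral_next _ _ N hu hf

variable [NeZero K]

/-- The transition of the state of the round robin CUSUM when the increment is `t`. -/
def rrNext (s : Fin K × ℝ) (t : ℝ) : Fin K × ℝ :=
  (if max s.2 0 + t ≤ 0 then s.1 + 1 else s.1, max s.2 0 + t)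

theorem measurable_rrNext : Measurable (fun q : (Fin K × ℝ) × ℝ => rrNext q.1 q.2) := by
  have hy : Measurable (fun q : (Fin K × ℝ) × ℝ => max q.1.2 0 + q.2) := by fun_prop
  have hd : Measurable (fun q : (Fin K × ℝ) × ℝ => q.1.1 + 1) :=
    (measurable_of_countable (fun d : Fin K => d + 1)).comp (by fun_prop)
  exact (Measurable.ite (measurableSet_le hy measurable_const) hd (by fun_prop)).prodMk hy

variable {ξ : ∀ k, 𝓧 k → ℝ} {σ : Equiv.Perm (Fin K)} {A : ℝ}

/-- The current state of the round robin CUSUM. -/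
abbrev rrSt (ξ : ∀ k, 𝓧 k → ℝ) (σ : Equiv.Perm (Fin K)) (N : ℕ)
    (ω : Unit × (ℕ → ∀ k, 𝓧 k)) : Fin K × ℝ := rrState ξ σ ω.2 N

/-- The event that the round robin CUSUM has not stopped up to time `N`. -/
abbrev rrAlive (ξ : ∀ k, 𝓧 k → ℝ) (σ : Equiv.Perm (Fin K)) (A : ℝ) (N : ℕ) :
    Set (Unit × (ℕ → ∀ k, 𝓧 k)) := {ω | (N : ℕ∞) < rrT ξ σ A ω}

theorem measurable_rrSt (hξ : ∀ k, Measurable (ξ k)) (N : ℕ) :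
    Measurable[pastSigma Unit (∀ k, 𝓧 k) N] (rrSt ξ σ N) :=
  (measurable_rrState hξ σ N).mono (obsSigma_le_pastSigma (roundRobin ξ hξ σ 0) N) le_rfl

theorem measurableSet_rrAlive (hξ : ∀ k, Measurable (ξ k)) (N : ℕ) :
    MeasurableSet[pastSigma Unit (∀ k, 𝓧 k) N] (rrAlive ξ σ A N) :=
  obsSigma_le_pastSigma (roundRobin ξ hξ σ A) N _ (measurableSet_lt_T (roundRobin ξ hξ σ A) N)

theorem mem_rrAlive {N : ℕ} {ω : Unit × (ℕ → ∀ k, 𝓧 k)} :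
    ω ∈ rrAlive ξ σ A N ↔ ∀ j ≤ N, 1 ≤ j → (rrSt ξ σ j ω).2 < A := by
  rw [Set.mem_ofPred_eq, ← not_le, rrT_le_iff]
  push Not
  rfl

theorem mem_rrAlive_succ {N : ℕ} {ω : Unit × (ℕ → ∀ k, 𝓧 k)} :
    ω ∈ rrAlive ξ σ A (N + 1) ↔ ω ∈ rrAlive ξ σ A N ∧ (rrSt ξ σ (N + 1) ω).2 < A := by
  rw [mem_rrAlive, mem_rrAlive]
  constructor
  · intro h
    exact ⟨fun j hj => h j (by omega), h _ le_rfl (by omega)⟩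
  · rintro ⟨h1, h2⟩ j hj hj1
    rcases Nat.lt_or_ge j (N + 1) with h | h
    · exact h1 j (by omega) hj1
    · obtain rfl : j = N + 1 := by omega
      exact h2

theorem rrAlive_zero : rrAlive ξ σ A 0 = Set.univ := by
  ext ω
  rw [mem_rrAlive]
  simp only [Set.mem_univ, iff_true]
  intro j h1 h2
  omega

variable (𝓧) in
/-- The law of independent data with distributions `ℓ 0, ℓ 1, …`, without randomization. -/
def unitLaw (ℓ : ℕ → ProbabilityMeasure (∀ k, 𝓧 k)) : Measure (Unit × (ℕ → ∀ k, 𝓧 k)) :=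
  (Measure.dirac ()).prod (Measure.infinitePi (fun n => (ℓ n : Measure (∀ k, 𝓧 k))))

instance (ℓ : ℕ → ProbabilityMeasure (∀ k, 𝓧 k)) : IsProbabilityMeasure (unitLaw 𝓧 ℓ) := by
  unfold unitLaw; infer_instance

/-- One step of the round robin CUSUM, given the past. -/
theorem setLIntegral_rrSt_succ (hξ : ∀ k, Measurable (ξ k)) (N : ℕ)
    {E : Set (Unit × (ℕ → ∀ k, 𝓧 k))}
    (hE : MeasurableSet[pastSigma Unit (∀ k, 𝓧 k) N] E) {g : Fin K × ℝ → ℝ≥0∞}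
    (hg : Measurable g) :
    ∫⁻ ω in E, g (rrSt ξ σ (N + 1) ω) ∂(unitLaw 𝓧 ℓ) =
      ∫⁻ ω in E, ∫⁻ w, g (rrNext (rrSt ξ σ N ω) (ξ (σ (rrSt ξ σ N ω).1) w))
        ∂(marginal (ℓ N) (σ (rrSt ξ σ N ω).1)) ∂(unitLaw 𝓧 ℓ) := by
  have hE' : MeasurableSet E := pastSigma_le N _ hE
  rw [← lintegral_indicator hE', ← lintegral_indicator hE']
  -- The indicator of E is carried as a component of the past, which turns integrals over E into
  -- integrals over the whole space.
  set u : Unit × (ℕ → ∀ k, 𝓧 k) → ℝ≥0∞ × (Fin K × ℝ) := fun ω =>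
    (E.indicator (fun _ => 1) ω, rrSt ξ σ N ω) with hu
  have hum : Measurable[pastSigma Unit (∀ k, 𝓧 k) N] u :=
    Measurable.prodMk (Measurable.indicator measurable_const hE) (measurable_rrSt hξ N)
  set f : (ℝ≥0∞ × (Fin K × ℝ)) × (∀ k, 𝓧 k) → ℝ≥0∞ := fun q =>
    q.1.1 * g (rrNext q.1.2 (ξ (σ q.1.2.1) (q.2 (σ q.1.2.1)))) with hf
  have hinc : Measurable (fun q : (Fin K × ℝ) × (∀ k, 𝓧 k) => ξ (σ q.1.1) (q.2 (σ q.1.1))) := by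
    have h : Measurable (fun q : (∀ k, 𝓧 k) × Fin K => ξ (σ q.2) (q.1 (σ q.2))) :=
      measurable_from_prod_countable_left fun d => (hξ (σ d)).comp (measurable_pi_apply _)
    exact h.comp (measurable_snd.prodMk (measurable_fst.comp measurable_fst))
  have hfm : Measurable f := by
    refine (measurable_fst.comp measurable_fst).mul (hg.comp ?_)
    refine measurable_rrNext.comp ((measurable_snd.comp measurable_fst).prodMk ?_)
    exact hinc.comp ((measurable_snd.comp measurable_fst).prodMk measurable_snd)
  have key := lintegral_next (Measure.dirac ())
    (fun n => (ℓ n : Measure (∀ k, 𝓧 k))) N hum hfm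
  calc _ = ∫⁻ ω, f (u ω, ω.2 N) ∂(unitLaw 𝓧 ℓ) := by
        refine lintegral_congr fun ω => ?_
        by_cases hω : ω ∈ E
        · simp only [hf, hu, Set.indicator_of_mem hω, one_mul]
          rfl
        · simp only [hf, hu, Set.indicator_of_notMem hω, zero_mul]
    _ = _ := key
    _ = _ := by
        refine lintegral_congr fun ω => ?_
        by_cases hω : ω ∈ E
        · simp only [hf, hu, Set.indicator_of_mem hω, one_mul]
          rw [marginal, lintegral_map (f := fun w => g (rrNext (rrSt ξ σ N ω)
            (ξ (σ (rrSt ξ σ N ω).1) w))) _ (measurable_pi_apply _)]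
          exact hg.comp (measurable_rrNext.comp (measurable_const.prodMk (hξ _)))
        · simp only [hf, hu, Set.indicator_of_notMem hω, zero_mul, lintegral_zero]

/-- The expected time to false alarm of the round robin CUSUM is at least the exponential of its
threshold, if the increments are log-likelihood ratios. -/
theorem exp_le_lintegral_rrT {F : ProbabilityMeasure (∀ k, 𝓧 k)} (hξ : ∀ k, Measurable (ξ k))
    (hone : ∀ k, ∫⁻ w, ENNReal.ofReal (Real.exp (ξ k w)) ∂(marginal F k) = 1) :
    ENNReal.ofReal (Real.exp A) ≤ ∫⁻ ω, (rrT ξ σ A ω : ℝ≥0∞) ∂(unitLaw 𝓧 fun _ => F) := by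
  set P := unitLaw 𝓧 fun _ => F with hP
  set alive : ℕ → Set (Unit × (ℕ → ∀ k, 𝓧 k)) := rrAlive ξ σ A with halive
  have hT : ∫⁻ ω, (rrT ξ σ A ω : ℝ≥0∞) ∂P = ∑' n : ℕ, P (alive n) := by
    have h : ∫⁻ ω in Set.univ, ((rrT ξ σ A ω - (0 : ℕ) : ℕ∞) : ℝ≥0∞) ∂P =
        ∑' n : ℕ, P (Set.univ ∩ alive (0 + n)) :=
      setLIntegral_T_sub (roundRobin ξ hξ σ A) P Set.univ 0
    simpa using h
  have hmeas : ∀ n, MeasurableSet (alive n) := fun n =>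
    pastSigma_le n _ (measurableSet_rrAlive hξ n)
  set r : ℕ → ℝ≥0∞ := fun n => ∫⁻ ω in alive n, ENNReal.ofReal (Real.exp (rrSt ξ σ n ω).2) ∂P
    with hr
  have hg : Measurable (fun s : Fin K × ℝ => ENNReal.ofReal (Real.exp s.2)) := by fun_prop
  -- one step of the supermartingale
  have hstep : ∀ n, r (n + 1) + ENNReal.ofReal (Real.exp A) * P (alive n \ alive (n + 1)) ≤
      ∫⁻ ω in alive n, ENNReal.ofReal (Real.exp (max (rrSt ξ σ n ω).2 0)) ∂P := by
    intro n
    have h1 := setLIntegral_rrSt_succ (σ := σ) (ℓ := fun _ => F) hξ n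
      (measurableSet_rrAlive (A := A) (σ := σ) hξ n) hg
    have h2 : ∀ s : Fin K × ℝ, ∫⁻ w, ENNReal.ofReal (Real.exp (rrNext s (ξ (σ s.1) w)).2)
        ∂(marginal F (σ s.1)) = ENNReal.ofReal (Real.exp (max s.2 0)) := by
      intro s
      simp only [rrNext, Real.exp_add]
      simp_rw [ENNReal.ofReal_mul (Real.exp_pos _).le]
      rw [lintegral_const_mul' _ _ ENNReal.ofReal_ne_top, hone, mul_one]
    simp only [h2] at h1
    rw [← h1]
    have hsub : alive (n + 1) ⊆ alive n := fun ω hω => (mem_rrAlive_succ.1 hω).1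
    have hdiff : ENNReal.ofReal (Real.exp A) * P (alive n \ alive (n + 1)) ≤
        ∫⁻ ω in alive n \ alive (n + 1), ENNReal.ofReal (Real.exp (rrSt ξ σ (n + 1) ω).2) ∂P := by
      rw [← setLIntegral_const]
      refine setLIntegral_mono' ((hmeas n).diff (hmeas _)) fun ω hω => ?_
      refine ENNReal.ofReal_le_ofReal (Real.exp_le_exp.2 ?_)
      by_contra hlt
      exact hω.2 (mem_rrAlive_succ.2 ⟨hω.1, not_le.1 hlt⟩)
    calc _ ≤ r (n + 1) + ∫⁻ ω in alive n \ alive (n + 1),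
          ENNReal.ofReal (Real.exp (rrSt ξ σ (n + 1) ω).2) ∂P := by gcongr
      _ = ∫⁻ ω in alive n, ENNReal.ofReal (Real.exp (rrSt ξ σ (n + 1) ω).2) ∂P := by
          rw [← lintegral_inter_add_sdiff (μ := P) _ (alive n) (hmeas (n + 1)),
            Set.inter_eq_self_of_subset_right hsub]
      _ = _ := rfl
  -- Since exp(max(y, 0)) ≤ 1 + exp(y), each restart from 0 raises the mean by at most the
  -- probability of survival. Stopped paths have collected at least exp(A).
  have hbound : ∀ n, r (n + 1) + ENNReal.ofReal (Real.exp A) * P (alive (n + 1))ᶜ ≤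
      ∑ i ∈ Finset.range (n + 1), P (alive i) := by
    intro n
    induction n with
    | zero =>
      have h := hstep 0
      have h0 : alive 0 = Set.univ := rrAlive_zero
      rw [h0, ← Set.compl_eq_univ_sdiff] at h
      refine h.trans ?_
      simp [rrState, h0]
    | succ n ih =>
      have h := hstep (n + 1)
      have hc : (alive (n + 2))ᶜ ⊆ (alive (n + 1))ᶜ ∪ (alive (n + 1) \ alive (n + 2)) := by
        intro ω hω
        by_cases h1 : ω ∈ alive (n + 1)
        · exact Or.inr ⟨h1, hω⟩
        · exact Or.inl h1
      have h3 : ∫⁻ ω in alive (n + 1), ENNReal.ofReal (Real.exp (max (rrSt ξ σ (n + 1) ω).2 0)) ∂P ≤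
          P (alive (n + 1)) + r (n + 1) := by
        rw [hr]
        have : P (alive (n + 1)) = ∫⁻ _ in alive (n + 1), 1 ∂P := by simp
        rw [this, ← lintegral_add_left measurable_const]
        refine lintegral_mono fun ω => ?_
        rcases le_total (rrSt ξ σ (n + 1) ω).2 0 with h0 | h0
        · rw [max_eq_right h0]; simp
        · rw [max_eq_left h0]; exact le_add_self
      rw [Finset.sum_range_succ]
      calc r (n + 2) + ENNReal.ofReal (Real.exp A) * P (alive (n + 2))ᶜ
          ≤ r (n + 2) + ENNReal.ofReal (Real.exp A) *
            (P (alive (n + 1))ᶜ + P (alive (n + 1) \ alive (n + 2))) := by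
            gcongr
            exact (measure_mono hc).trans (measure_union_le _ _)
        _ = (r (n + 1 + 1) + ENNReal.ofReal (Real.exp A) *
              P (alive (n + 1) \ alive (n + 1 + 1))) +
            ENNReal.ofReal (Real.exp A) * P (alive (n + 1))ᶜ := by ring
        _ ≤ (P (alive (n + 1)) + r (n + 1)) + ENNReal.ofReal (Real.exp A) * P (alive (n + 1))ᶜ := by
            exact add_le_add_left (h.trans h3) _
        _ = (r (n + 1) + ENNReal.ofReal (Real.exp A) * P (alive (n + 1))ᶜ) + P (alive (n + 1)) := by
            ring
        _ ≤ _ := by gcongr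
  rw [hT]
  by_cases htop : ∑' n : ℕ, P (alive n) = ⊤
  · rw [htop]; exact le_top
  -- If the mean alarm time is finite, the alarm is almost surely raised, and the bound passes to
  -- the limit.
  have hlim0 : Tendsto (fun n => P (alive n)) atTop (𝓝 0) := by
    have := ENNReal.tendsto_atTop_zero_of_tsum_ne_top htop
    exact this
  have hlim : Tendsto (fun n => P (alive (n + 1))ᶜ) atTop (𝓝 1) := by
    have h1 : ∀ n, P (alive (n + 1))ᶜ = 1 - P (alive (n + 1)) := fun n =>
      prob_compl_eq_one_sub (hmeas _)
    simp_rw [h1]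
    have := ENNReal.Tendsto.sub (tendsto_const_nhds (x := (1 : ℝ≥0∞)))
      ((tendsto_add_atTop_iff_nat 1).2 hlim0) (Or.inl ENNReal.one_ne_top)
    simpa using this
  have hlim' : Tendsto (fun n => ENNReal.ofReal (Real.exp A) * P (alive (n + 1))ᶜ) atTop
      (𝓝 (ENNReal.ofReal (Real.exp A))) := by
    have := ENNReal.Tendsto.const_mul (a := ENNReal.ofReal (Real.exp A)) hlim
      (Or.inl one_ne_zero)
    simpa using this
  refine le_of_tendsto' hlim' fun n => ?_
  exact le_add_self.trans ((hbound n).trans (ENNReal.sum_le_tsum _))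

end RoundRobinCusum

namespace RoundRobinCusum

universe u

/-! ### Lower bound for the worst-case delay -/

section ChangeOfMeasure

variable {K : ℕ} [NeZero K] {𝓧 : Fin K → Type u} [∀ k, MeasurableSpace (𝓧 k)]
  {p : Policy K 𝓧} {F G : ProbabilityMeasure (∀ k, 𝓧 k)}

/-- Laws of the data that agree up to time `N` agree on the past. -/
theorem seqLaw_lintegral_congr {ℓ ℓ' : ℕ → ProbabilityMeasure (∀ k, 𝓧 k)} {N : ℕ}
    (h : ∀ n < N, ℓ n = ℓ' n) {φ : p.Ω → ℝ≥0∞}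
    (hφ : Measurable[pastSigma p.R (∀ k, 𝓧 k) N] φ) :
    ∫⁻ ω, φ ω ∂(p.seqLaw ℓ) = ∫⁻ ω, φ ω ∂(p.seqLaw ℓ') := by
  have hle := pastSigma_le (R := p.R) (Z := ∀ k, 𝓧 k) N
  have hum : Measurable (fun ω : p.Ω => (ω.1, (Finset.range N).restrict ω.2)) := by fun_prop
  have hr : Measurable (fun x : ℕ → ∀ k, 𝓧 k => (Finset.range N).restrict x) := by fun_prop
  have hmap : ∀ ℓ : ℕ → ProbabilityMeasure (∀ k, 𝓧 k),
      (p.seqLaw ℓ).map (fun ω : p.Ω => (ω.1, (Finset.range N).restrict ω.2)) =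
        (p.ρ : Measure p.R).prod
          (Measure.pi fun i : Finset.range N => (ℓ i : Measure (∀ k, 𝓧 k))) := by
    intro ℓ
    rw [← Measure.infinitePi_map_restrict (μ := fun n => (ℓ n : Measure (∀ k, 𝓧 k)))]
    have := Measure.map_prod_map (p.ρ : Measure p.R)
      (Measure.infinitePi (fun n => (ℓ n : Measure (∀ k, 𝓧 k)))) measurable_id hr
    rw [Measure.map_id] at this
    exact this.symm
  have hmap' : (p.seqLaw ℓ).map (fun ω : p.Ω => (ω.1, (Finset.range N).restrict ω.2)) =
      (p.seqLaw ℓ').map (fun ω : p.Ω => (ω.1, (Finset.range N).restrict ω.2)) := by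
    rw [hmap, hmap]
    have : (fun i : Finset.range N => (ℓ i : Measure (∀ k, 𝓧 k))) =
        fun i : Finset.range N => (ℓ' i : Measure (∀ k, 𝓧 k)) := by
      ext1 i
      rw [h i (Finset.mem_range.1 i.2)]
    rw [this]
  have htrim : (p.seqLaw ℓ).trim hle = (p.seqLaw ℓ').trim hle := by
    refine @Measure.ext _ (pastSigma p.R (∀ k, 𝓧 k) N) _ _ fun E hE => ?_
    rw [trim_measurableSet_eq hle hE, trim_measurableSet_eq hle hE]
    obtain ⟨B, hB, rfl⟩ := hE
    rw [← Measure.map_apply hum hB, ← Measure.map_apply hum hB, hmap']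
  rw [← lintegral_trim hle hφ, ← lintegral_trim hle hφ, htrim]

/-- The increment of the log-likelihood ratio when the source `k` is observed. -/
def llrObs (F G : ProbabilityMeasure (∀ k, 𝓧 k)) (s : Σ k, 𝓧 k) : ℝ :=
  llr (marginal G s.1) (marginal F s.1) s.2

theorem measurable_llrObs : Measurable (llrObs F G) :=
  measurable_sigma_uncurry (ξ := fun k => llr (marginal G k) (marginal F k))
    fun _ => measurable_llr _ _

/-- The log-likelihood ratio of the observations at the times `ν + 1, …, ν + m`. -/
def logRatio (p : Policy K 𝓧) (F G : ProbabilityMeasure (∀ k, 𝓧 k)) (ν m : ℕ) (ω : p.Ω) : ℝ :=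
  ∑ i ∈ Finset.range m, llrObs F G (obs p.S (ν + i) ω)

theorem measurable_obs (n : ℕ) : Measurable[obsSigma p.S (n + 1)] (obs p.S n) :=
  (comap_measurable (obs p.S n)).mono le_sup_right le_rfl

theorem measurable_logRatio (ν m : ℕ) :
    Measurable[obsSigma p.S (ν + m)] (logRatio p F G ν m) := by
  refine Finset.measurable_sum _ fun i hi => ?_
  refine (measurable_llrObs.comp (measurable_obs (ν + i))).mono ?_ le_rfl
  exact obsSigma_mono p.S (by have := Finset.mem_range.1 hi; omega)

theorem marginal_ac (h : ∀ k ∈ affected F G, marginal G k ≪ marginal F k ∧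
    marginal F k ≪ marginal G k) (k : Fin K) :
    marginal G k ≪ marginal F k ∧ marginal F k ≪ marginal G k := by
  by_cases hk : k ∈ affected F G
  · exact h k hk
  · have : marginal G k = marginal F k := not_not.1 (fun h' => hk (mem_affected.2 h'))
    rw [this]
    exact ⟨Measure.AbsolutelyContinuous.rfl, Measure.AbsolutelyContinuous.rfl⟩

theorem withDensity_exp_llr (h : ∀ k ∈ affected F G, marginal G k ≪ marginal F k ∧
    marginal F k ≪ marginal G k) (k : Fin K) :
    (marginal F k).withDensity
      (fun x => ENNReal.ofReal (Real.exp (llr (marginal G k) (marginal F k) x))) =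
      marginal G k := by
  obtain ⟨h1, h2⟩ := marginal_ac h k
  rw [← Measure.withDensity_rnDeriv_eq _ _ h1]
  refine withDensity_congr_ae ?_
  rw [Measure.withDensity_rnDeriv_eq _ _ h1]
  filter_upwards [exp_llr_of_ac' (marginal G k) (marginal F k) h2,
    Measure.rnDeriv_ne_top (marginal G k) (marginal F k)] with x hx hx'
  rw [hx, ENNReal.ofReal_toReal hx']

/-- Integrating out the next observation, as a function of the past and of the observation. -/
theorem seqLaw_lintegral_obs {ℓ : ℕ → ProbabilityMeasure (∀ k, 𝓧 k)} {B : Type*}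
    [MeasurableSpace B] (N : ℕ) {u : p.Ω → B} (hu : Measurable[obsSigma p.S N] u)
    {f : B × (Σ k, 𝓧 k) → ℝ≥0∞} (hf : ∀ k, Measurable (fun q : B × 𝓧 k => f (q.1, ⟨k, q.2⟩))) :
    ∫⁻ ω, f (u ω, obs p.S N ω) ∂(p.seqLaw ℓ) =
      ∫⁻ ω, ∫⁻ w, f (u ω, ⟨p.S N ω, w⟩) ∂(marginal (ℓ N) (p.S N ω)) ∂(p.seqLaw ℓ) := by
  have hle := obsSigma_le_pastSigma p N
  have hu' : Measurable[pastSigma p.R (∀ k, 𝓧 k) N] (fun ω => (u ω, p.S N ω)) :=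
    (hu.mono hle le_rfl).prodMk ((p.measurable_S N).mono hle le_rfl)
  have hf' : Measurable (fun q : (B × Fin K) × (∀ k, 𝓧 k) => f (q.1.1, ⟨q.1.2, q.2 q.1.2⟩)) := by
    have h : Measurable (fun q : (B × (∀ k, 𝓧 k)) × Fin K => f (q.1.1, ⟨q.2, q.1.2 q.2⟩)) :=
      measurable_from_prod_countable_left fun k => (hf k).comp
        (measurable_fst.prodMk ((measurable_pi_apply k).comp measurable_snd))
    exact h.comp (((measurable_fst.comp measurable_fst).prodMk measurable_snd).prodMk
      (measurable_snd.comp measurable_fst))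
  refine (seqLaw_lintegral_next (p := p) (ℓ := ℓ) N hu' hf').trans ?_
  refine lintegral_congr fun ω => ?_
  rw [marginal, lintegral_map (f := fun w => f (u ω, ⟨p.S N ω, w⟩))
    ((hf _).comp (measurable_const.prodMk measurable_id)) (measurable_pi_apply _)]

/-- Change of measure from the post-change to the pre-change regime, for functions of the
observations. -/
theorem lintegral_law_eq (h : ∀ k ∈ affected F G, marginal G k ≪ marginal F k ∧
    marginal F k ≪ marginal G k) (ν m : ℕ) {φ : p.Ω → ℝ≥0∞}
    (hφ : Measurable[obsSigma p.S (ν + m)] φ) :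
    ∫⁻ ω, φ ω ∂(p.law F G ν) =
      ∫⁻ ω, φ ω * ENNReal.ofReal (Real.exp (logRatio p F G ν m ω)) ∂(p.lawInf F) := by
  rw [law_eq_seqLaw, lawInf_eq_seqLaw]
  induction m generalizing φ with
  | zero =>
    simp only [logRatio, Finset.range_zero, Finset.sum_empty, Real.exp_zero, ENNReal.ofReal_one,
      mul_one]
    -- Up to the change-point both laws give the same past.
    exact seqLaw_lintegral_congr (N := ν) (fun n hn => if_pos hn)
      (hφ.mono (obsSigma_le_pastSigma p ν) le_rfl)
  | succ m ih =>
    set P := p.seqLaw (fun n => if n < ν then F else G) with hP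
    set Q := p.seqLaw (fun _ => F) with hQ
    set n := ν + m with hn
    have hle := p.obsSigma_le (n + 1)
    set L : ℕ → p.Ω → ℝ≥0∞ := fun m ω => ENNReal.ofReal (Real.exp (logRatio p F G ν m ω)) with hL
    have hLm : ∀ m, Measurable[obsSigma p.S (ν + m)] (L m) := fun m =>
      (ENNReal.measurable_ofReal.comp Real.measurable_exp).comp (measurable_logRatio ν m)
    have hLm' : ∀ m, Measurable (L m) := fun m => (hLm m).mono (p.obsSigma_le _) le_rfl
    have hLsucc : ∀ ω, L (m + 1) ω =
        L m ω * ENNReal.ofReal (Real.exp (llrObs F G (obs p.S n ω))) := by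
      intro ω
      simp only [hL, logRatio, Finset.sum_range_succ, Real.exp_add]
      rw [ENNReal.ofReal_mul (Real.exp_pos _).le]
    have htrim : P.trim hle = (Q.withDensity (L (m + 1))).trim hle := by
      have hfin : IsFiniteMeasure (P.trim hle) := isFiniteMeasure_trim hle
      -- Rectangles of a past event and an event of the new observation form a generating π-system,
      -- on which the new observation can be integrated out.
      set C : Set (Set p.Ω) := {E | ∃ A, MeasurableSet[obsSigma p.S n] A ∧
        ∃ B, MeasurableSet B ∧ E = A ∩ obs p.S n ⁻¹' B} with hC
      have hgen : obsSigma p.S (n + 1) = MeasurableSpace.generateFrom C := by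
        refine le_antisymm (sup_le (fun A hA => ?_) ?_) ?_
        · exact MeasurableSpace.measurableSet_generateFrom
            ⟨A, hA, Set.univ, MeasurableSet.univ, by simp⟩
        · rintro _ ⟨B, hB, rfl⟩
          exact MeasurableSpace.measurableSet_generateFrom
            ⟨Set.univ, @MeasurableSet.univ _ (obsSigma p.S n), B, hB, by simp⟩
        · refine MeasurableSpace.generateFrom_le ?_
          rintro _ ⟨A, hA, B, hB, rfl⟩
          exact @MeasurableSet.inter _ (obsSigma p.S (n + 1)) _ _
            (obsSigma_mono p.S n.le_succ _ hA) (measurable_obs n hB)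
      have hpi : IsPiSystem C := by
        rintro _ ⟨A, hA, B, hB, rfl⟩ _ ⟨A', hA', B', hB', rfl⟩ -
        refine ⟨A ∩ A', @MeasurableSet.inter _ (obsSigma p.S n) _ _ hA hA', B ∩ B', hB.inter hB', ?_⟩
        rw [Set.preimage_inter]
        ext ω
        simp only [Set.mem_inter_iff]
        tauto
      have hagree : ∀ E ∈ C, P.trim hle E = (Q.withDensity (L (m + 1))).trim hle E := by
        intro E hEC
        have hE : MeasurableSet[obsSigma p.S (n + 1)] E := by
          rw [hgen]; exact MeasurableSpace.measurableSet_generateFrom hEC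
        rw [trim_measurableSet_eq hle hE, trim_measurableSet_eq hle hE,
          withDensity_apply _ (hle _ hE)]
        obtain ⟨A, hA, B, hB, rfl⟩ := hEC
        have hBk : ∀ k, MeasurableSet (Sigma.mk k ⁻¹' B) := fun k =>
          MeasurableSpace.measurableSet_iInf.1 hB k
        have hind : ∀ ω, (A ∩ obs p.S n ⁻¹' B).indicator (1 : p.Ω → ℝ≥0∞) ω =
            A.indicator 1 ω * B.indicator 1 (obs p.S n ω) := by
          intro ω
          by_cases h1 : ω ∈ A
          · by_cases h2 : obs p.S n ω ∈ B
            · have h3 : ω ∈ A ∩ obs p.S n ⁻¹' B := ⟨h1, h2⟩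
              rw [Set.indicator_of_mem h1, Set.indicator_of_mem h2, Set.indicator_of_mem h3]
              simp
            · rw [Set.indicator_of_notMem h2, Set.indicator_of_notMem fun h => h2 h.2, mul_zero]
          · rw [Set.indicator_of_notMem h1, Set.indicator_of_notMem fun h => h1 h.1, zero_mul]
        have hAm : Measurable[obsSigma p.S n] (A.indicator (1 : p.Ω → ℝ≥0∞)) :=
          Measurable.indicator (@measurable_const _ _ _ (obsSigma p.S n) 1) hA
        have hBm : ∀ k, Measurable (fun w : 𝓧 k => B.indicator (1 : (Σ k, 𝓧 k) → ℝ≥0∞) ⟨k, w⟩) :=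
          fun k => measurable_one.indicator (hBk k)
        set q : Fin K → ℝ≥0∞ := fun k => marginal G k (Sigma.mk k ⁻¹' B) with hq
        have hqm : Measurable[obsSigma p.S n] (fun ω => q (p.S n ω)) :=
          (measurable_of_countable q).comp (p.measurable_S n)
        have h1 : P (A ∩ obs p.S n ⁻¹' B) = ∫⁻ ω, A.indicator 1 ω * q (p.S n ω) ∂P := by
          rw [← lintegral_indicator_one (hle _ hE)]
          simp_rw [hind]
          have := seqLaw_lintegral_obs (p := p) (ℓ := fun n => if n < ν then F else G) n hAm
            (f := fun q => q.1 * B.indicator 1 q.2) (fun k =>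
              measurable_fst.mul ((hBm k).comp measurable_snd))
          refine this.trans (lintegral_congr fun ω => ?_)
          rw [lintegral_const_mul _ (hBm _), if_neg (by omega)]
          congr 1
          exact lintegral_indicator_one (hBk _)
        have h2 : ∫⁻ ω in A ∩ obs p.S n ⁻¹' B, L (m + 1) ω ∂Q =
            ∫⁻ ω, A.indicator 1 ω * q (p.S n ω) * L m ω ∂Q := by
          rw [← lintegral_indicator (hle _ hE)]
          have e : ∀ ω, (A ∩ obs p.S n ⁻¹' B).indicator (L (m + 1)) ω =
              (A.indicator 1 ω * L m ω) * (B.indicator 1 (obs p.S n ω) *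
                ENNReal.ofReal (Real.exp (llrObs F G (obs p.S n ω)))) := by
            intro ω
            have : (A ∩ obs p.S n ⁻¹' B).indicator (L (m + 1)) ω =
                (A ∩ obs p.S n ⁻¹' B).indicator 1 ω * L (m + 1) ω := by
              by_cases h3 : ω ∈ A ∩ obs p.S n ⁻¹' B
              · rw [Set.indicator_of_mem h3, Set.indicator_of_mem h3, Pi.one_apply, one_mul]
              · rw [Set.indicator_of_notMem h3, Set.indicator_of_notMem h3, zero_mul]
            rw [this, hind, hLsucc]; ring
          simp_rw [e]
          have hEm : ∀ k, Measurable (fun w : 𝓧 k =>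
              ENNReal.ofReal (Real.exp (llrObs F G ⟨k, w⟩))) := fun k =>
            (ENNReal.measurable_ofReal.comp Real.measurable_exp).comp
              (measurable_llr (marginal G k) (marginal F k))
          have := seqLaw_lintegral_obs (p := p) (ℓ := fun _ => F) n (hAm.mul (hLm m))
            (f := fun q => q.1 * (B.indicator 1 q.2 *
              ENNReal.ofReal (Real.exp (llrObs F G q.2)))) (fun k =>
              measurable_fst.mul (((hBm k).mul (hEm k)).comp measurable_snd))
          refine this.trans (lintegral_congr fun ω => ?_)
          refine (lintegral_const_mul _ ((hBm (p.S n ω)).mul (hEm (p.S n ω)))).trans ?_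
          rw [mul_right_comm]
          refine congrArg (A.indicator 1 ω * L m ω * ·) ?_
          have e2 := withDensity_exp_llr h (p.S n ω)
          simp only [hq]
          conv_rhs => rw [← e2]
          rw [withDensity_apply _ (hBk _), ← lintegral_indicator (hBk _)]
          refine lintegral_congr fun w => ?_
          rw [Pi.mul_apply]
          by_cases hw : (⟨p.S n ω, w⟩ : Σ k, 𝓧 k) ∈ B
          · have hw' : w ∈ Sigma.mk (p.S n ω) ⁻¹' B := hw
            rw [Set.indicator_of_mem hw, Set.indicator_of_mem hw', Pi.one_apply, one_mul]
            rfl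
          · have hw' : w ∉ Sigma.mk (p.S n ω) ⁻¹' B := hw
            rw [Set.indicator_of_notMem hw, Set.indicator_of_notMem hw', zero_mul]
        rw [h1, h2]
        -- Integrating out the new observation yields the same function of the past under both laws:
        -- the extra likelihood factor has turned F into G for the sampled source.
        exact ih (hAm.mul hqm)
      refine ext_of_generate_finite C hgen hpi hagree ?_
      exact hagree _ ⟨Set.univ, @MeasurableSet.univ _ (obsSigma p.S n), Set.univ,
        MeasurableSet.univ, by simp⟩
    have hφ' : Measurable φ := hφ.mono hle le_rfl
    rw [← lintegral_trim hle hφ, htrim, lintegral_trim hle hφ,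
      lintegral_withDensity_eq_lintegral_mul _ (hLm' _) hφ']
    refine lintegral_congr fun ω => ?_
    rw [Pi.mul_apply, mul_comm]

end ChangeOfMeasure

end RoundRobinCusum

namespace RoundRobinCusum

universe u

/-! ### Second moments, a quiet period, and the lower bound -/

section LowerBound

variable {K : ℕ} [NeZero K] {𝓧 : Fin K → Type u} [∀ k, MeasurableSpace (𝓧 k)]
  {p : Policy K 𝓧} {F G : ProbabilityMeasure (∀ k, 𝓧 k)}

/-- The second moment of a sum of conditionally centered functions of the observations. -/
theorem setLIntegral_sum_sq_le {ℓ : ℕ → ProbabilityMeasure (∀ k, 𝓧 k)} {g : (Σ k, 𝓧 k) → ℝ} {v : ℝ}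
    {ν : ℕ} (hv : 0 ≤ v) (hℓ : ∀ n, ν ≤ n → ℓ n = G) (hg : ∀ k, Measurable fun w : 𝓧 k => g ⟨k, w⟩)
    (hint : ∀ k, Integrable (fun w => g ⟨k, w⟩) (marginal G k))
    (hzero : ∀ k, ∫ w, g ⟨k, w⟩ ∂(marginal G k) = 0)
    (hsq : ∀ k, Integrable (fun w => g ⟨k, w⟩ ^ 2) (marginal G k))
    (hvar : ∀ k, ∫ w, g ⟨k, w⟩ ^ 2 ∂(marginal G k) ≤ v)
    {E : Set p.Ω} (hE : MeasurableSet[obsSigma p.S ν] E) (m : ℕ) :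
    ∫⁻ ω in E, ENNReal.ofReal ((∑ i ∈ Finset.range m, g (obs p.S (ν + i) ω)) ^ 2) ∂(p.seqLaw ℓ) ≤
      ENNReal.ofReal (m * v) * p.seqLaw ℓ E := by
  set P := p.seqLaw ℓ with hP
  have hgm : Measurable g := by
    intro B hB
    exact MeasurableSpace.measurableSet_iInf.2 fun k => hg k hB
  have hE' : MeasurableSet E := p.obsSigma_le ν _ hE
  induction m with
  | zero => simp
  | succ m ih =>
    set W : p.Ω → ℝ := fun ω => ∑ i ∈ Finset.range m, g (obs p.S (ν + i) ω) with hW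
    have hWm : Measurable[obsSigma p.S (ν + m)] W := by
      refine Finset.measurable_sum _ fun i hi => ?_
      refine (hgm.comp (measurable_obs (ν + i))).mono ?_ le_rfl
      exact obsSigma_mono p.S (by have := Finset.mem_range.1 hi; omega)
    have hEm : MeasurableSet[obsSigma p.S (ν + m)] E := obsSigma_mono p.S (by omega) _ hE
    have hum : Measurable[obsSigma p.S (ν + m)]
        (fun ω => (E.indicator (fun _ => (1 : ℝ≥0∞)) ω, W ω)) :=
      (Measurable.indicator measurable_const hEm).prodMk hWm
    have key := seqLaw_lintegral_obs (p := p) (ℓ := ℓ) (ν + m) hum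
      (f := fun q => q.1.1 * ENNReal.ofReal ((q.1.2 + g q.2) ^ 2)) (fun k => by
        have h1 : Measurable (fun q : (ℝ≥0∞ × ℝ) × 𝓧 k => g ⟨k, q.2⟩) := (hg k).comp measurable_snd
        have h2 : Measurable (fun q : (ℝ≥0∞ × ℝ) × 𝓧 k =>
            q.1.1 * ENNReal.ofReal ((q.1.2 + g ⟨k, q.2⟩) ^ 2)) :=
          (measurable_fst.comp measurable_fst).mul (ENNReal.measurable_ofReal.comp
            (((measurable_snd.comp measurable_fst).add h1).pow_const 2))
        exact h2)
    -- The cross term vanishes by centring, whichever source is sampled, so the second moment grows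
    -- by at most v.
    have hstep : ∀ (k : Fin K) (w : ℝ),
        ∫⁻ x, ENNReal.ofReal ((w + g ⟨k, x⟩) ^ 2) ∂(marginal G k) ≤
          ENNReal.ofReal (w ^ 2) + ENNReal.ofReal v := by
      intro k w
      have e : ∀ x : 𝓧 k, (w + g ⟨k, x⟩) ^ 2 = w ^ 2 + (2 * w) * g ⟨k, x⟩ + g ⟨k, x⟩ ^ 2 :=
        fun x => by ring
      have i1 : Integrable (fun x => w ^ 2 + (2 * w) * g ⟨k, x⟩) (marginal G k) :=
        (integrable_const _).add ((hint k).const_mul _)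
      rw [← ofReal_integral_eq_lintegral_ofReal, ← ENNReal.ofReal_add (sq_nonneg _) hv]
      · refine ENNReal.ofReal_le_ofReal ?_
        simp_rw [e]
        rw [integral_add i1 (hsq k), integral_add (integrable_const _) ((hint k).const_mul _),
          integral_const_mul, hzero]
        simp only [integral_const, probReal_univ, smul_eq_mul, one_mul, mul_zero, add_zero]
        linarith [hvar k]
      · simp_rw [e]
        exact i1.add (hsq k)
      · exact Eventually.of_forall fun x => sq_nonneg _
    rw [← lintegral_indicator hE']
    calc ∫⁻ ω, E.indicator (fun ω => ENNReal.ofReal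
            ((∑ i ∈ Finset.range (m + 1), g (obs p.S (ν + i) ω)) ^ 2)) ω ∂P
        = ∫⁻ ω, E.indicator (fun _ => (1 : ℝ≥0∞)) ω *
            ENNReal.ofReal ((W ω + g (obs p.S (ν + m) ω)) ^ 2) ∂P := by
          refine lintegral_congr fun ω => ?_
          by_cases hω : ω ∈ E
          · rw [Set.indicator_of_mem hω, Set.indicator_of_mem hω, one_mul, Finset.sum_range_succ]
          · rw [Set.indicator_of_notMem hω, Set.indicator_of_notMem hω, zero_mul]
      _ = _ := key
      _ ≤ ∫⁻ ω, E.indicator (fun ω => ENNReal.ofReal (W ω ^ 2) + ENNReal.ofReal v) ω ∂P := by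
          refine lintegral_mono fun ω => ?_
          rw [hℓ _ (Nat.le_add_right ν m)]
          by_cases hω : ω ∈ E
          · simp only [Set.indicator_of_mem hω, one_mul]
            exact hstep _ _
          · simp only [Set.indicator_of_notMem hω, zero_mul, lintegral_zero, le_refl]
      _ = ∫⁻ ω in E, ENNReal.ofReal (W ω ^ 2) ∂P + ENNReal.ofReal v * P E := by
          rw [lintegral_indicator hE', lintegral_add_right _ measurable_const, setLIntegral_const]
      _ ≤ ENNReal.ofReal (m * v) * P E + ENNReal.ofReal v * P E := by gcongr
      _ = _ := by
          rw [← add_mul, ← ENNReal.ofReal_add (by positivity) hv]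
          push_cast
          ring_nf

/-- If the expected time to false alarm is at least `γ`, then there is a time at which the
conditional probability of a false alarm within `m` steps is small. -/
theorem exists_falseAlarm_le {γ : ℝ} (hγ : 0 < γ) (hp : p ∈ Delta F γ) {m : ℕ} (hm : 1 ≤ m) :
    ∃ ν : ℕ, p.lawInf F {ω | (ν : ℕ∞) < p.T ω} ≠ 0 ∧
      p.lawInf F ({ω | (ν : ℕ∞) < p.T ω} \ {ω | ((ν + m : ℕ) : ℕ∞) < p.T ω}) ≤
        ENNReal.ofReal (2 * m / γ) * p.lawInf F {ω | (ν : ℕ∞) < p.T ω} := by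
  set P := p.lawInf F with hP
  set a : ℕ → ℝ≥0∞ := fun n => P {ω | (n : ℕ∞) < p.T ω} with ha
  set q := ENNReal.ofReal (2 * m / γ) with hq
  have hsub : ∀ n : ℕ, {ω | ((n + m : ℕ) : ℕ∞) < p.T ω} ⊆ {ω | (n : ℕ∞) < p.T ω} := by
    intro n ω hω
    have hω' : ((n + m : ℕ) : ℕ∞) < p.T ω := hω
    refine lt_of_le_of_lt (b := ((n + m : ℕ) : ℕ∞)) ?_ hω'
    exact_mod_cast Nat.le_add_right n m
  have hT : ENNReal.ofReal γ ≤ ∑' n, a n := by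
    have h : ∫⁻ ω in Set.univ, ((p.T ω - (0 : ℕ) : ℕ∞) : ℝ≥0∞) ∂P =
        ∑' n : ℕ, P (Set.univ ∩ {ω | ((0 + n : ℕ) : ℕ∞) < p.T ω}) :=
      setLIntegral_T_sub p P Set.univ 0
    have h' : ENNReal.ofReal γ ≤ ∫⁻ ω, (p.T ω : ℝ≥0∞) ∂P := hp
    refine h'.trans (le_of_eq ?_)
    simpa using h
  -- Otherwise every block of m steps loses a fraction q of the survival probability. Summing over
  -- all starting times gives q Σ a ≤ m, whereas qγ = 2m; the factor 2 makes the contradiction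
  -- strict.
  have hex : ∃ ν, ¬ (a (ν + m) + q * a ν ≤ a ν) := by
    by_contra! hc
    have hsum : ∀ n, q * ∑ i ∈ Finset.range n, a i ≤ m := by
      intro n
      have h1 : ∑ i ∈ Finset.range n, a (i + m) + q * ∑ i ∈ Finset.range n, a i ≤
          ∑ i ∈ Finset.range n, a i := by
        rw [Finset.mul_sum, ← Finset.sum_add_distrib]
        exact Finset.sum_le_sum fun i _ => hc i
      have h2 : ∑ i ∈ Finset.range n, a i ≤ m + ∑ i ∈ Finset.range n, a (i + m) := by
        calc ∑ i ∈ Finset.range n, a i ≤ ∑ i ∈ Finset.range (m + n), a i :=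
              Finset.sum_le_sum_of_subset (Finset.range_mono (by omega))
          _ = ∑ i ∈ Finset.range m, a i + ∑ i ∈ Finset.range n, a (i + m) := by
              rw [Finset.sum_range_add]
              simp_rw [add_comm m]
          _ ≤ ∑ i ∈ Finset.range m, 1 + ∑ i ∈ Finset.range n, a (i + m) := by
              gcongr
              exact prob_le_one
          _ = _ := by simp
      have hfin : ∑ i ∈ Finset.range n, a (i + m) ≠ ⊤ :=
        ENNReal.sum_ne_top.2 fun i _ => measure_ne_top _ _
      refine (ENNReal.add_le_add_iff_left hfin).1 ?_
      refine (h1.trans h2).trans (le_of_eq (add_comm _ _))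
    have hle : q * ∑' i, a i ≤ m := by
      rw [← ENNReal.tsum_mul_left]
      refine ENNReal.tsum_le_of_sum_range_le fun n => ?_
      rw [← Finset.mul_sum]
      exact hsum n
    have h3 : ENNReal.ofReal (2 * m / γ * γ) ≤ ENNReal.ofReal m := by
      rw [ENNReal.ofReal_mul (by positivity), ENNReal.ofReal_natCast]
      exact (mul_le_mul_right hT q).trans hle
    rw [div_mul_cancel₀ _ hγ.ne'] at h3
    have h4 := (ENNReal.ofReal_le_ofReal_iff (by positivity)).1 h3
    have : (1 : ℝ) ≤ m := by exact_mod_cast hm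
    linarith
  obtain ⟨ν, hν⟩ := hex
  have hdec : a ν = a (ν + m) +
      P ({ω | (ν : ℕ∞) < p.T ω} \ {ω | ((ν + m : ℕ) : ℕ∞) < p.T ω}) := by
    have := measure_inter_add_sdiff (μ := P) {ω | (ν : ℕ∞) < p.T ω} (measurableSet_lt_T' p (ν + m))
    rw [Set.inter_eq_self_of_subset_right (hsub ν)] at this
    exact this.symm
  refine ⟨ν, fun h0 => hν ?_, ?_⟩
  · have h0' : a ν = 0 := h0
    have h1 : a (ν + m) = 0 := measure_mono_null (hsub ν) h0
    rw [h0', h1]; simp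
  · have h1 := (not_le.1 hν).le
    rw [hdec] at h1
    have h2 := (ENNReal.add_le_add_iff_left (measure_ne_top _ _)).1 h1
    rw [← hdec] at h2
    exact h2

/-- The centered second moment of the log-likelihood ratio of every source. -/
theorem exists_integral_llr_sq_le (h_moment : ∀ k ∈ affected F G,
      Integrable (fun x => llr (marginal G k) (marginal F k) x ^ 2) (marginal G k)) :
    ∃ v : ℝ, 0 ≤ v ∧ ∀ k,
      Integrable (fun x => llr (marginal G k) (marginal F k) x) (marginal G k) ∧
      Integrable (fun x => (llr (marginal G k) (marginal F k) x - infoI F G k) ^ 2)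
        (marginal G k) ∧
      ∫ x, (llr (marginal G k) (marginal F k) x - infoI F G k) ^ 2 ∂(marginal G k) ≤ v := by
  have hsq : ∀ k, Integrable (fun x => llr (marginal G k) (marginal F k) x ^ 2) (marginal G k) := by
    intro k
    by_cases hk : k ∈ affected F G
    · exact h_moment k hk
    · have : marginal G k = marginal F k := not_not.1 (fun h' => hk (mem_affected.2 h'))
      rw [this]
      refine (integrable_zero _ ℝ _).congr ?_
      filter_upwards [llr_self (marginal F k)] with x hx
      simp [hx]
  have hint : ∀ k, Integrable (fun x => llr (marginal G k) (marginal F k) x) (marginal G k) := by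
    intro k
    have : MemLp (fun x => llr (marginal G k) (marginal F k) x) 2 (marginal G k) :=
      (memLp_two_iff_integrable_sq (measurable_llr _ _).aestronglyMeasurable).2 (hsq k)
    exact this.integrable one_le_two
  have hc : ∀ k, Integrable (fun x => (llr (marginal G k) (marginal F k) x - infoI F G k) ^ 2)
      (marginal G k) := by
    intro k
    have e : ∀ x, (llr (marginal G k) (marginal F k) x - infoI F G k) ^ 2 =
        llr (marginal G k) (marginal F k) x ^ 2 -
          (2 * infoI F G k) * llr (marginal G k) (marginal F k) x + infoI F G k ^ 2 :=
      fun x => by ring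
    simp_rw [e]
    exact ((hsq k).sub ((hint k).const_mul _)).add (integrable_const _)
  refine ⟨∑ k, ∫ x, (llr (marginal G k) (marginal F k) x - infoI F G k) ^ 2 ∂(marginal G k),
    Finset.sum_nonneg fun k _ => integral_nonneg fun x => sq_nonneg _, fun k =>
    ⟨hint k, hc k, ?_⟩⟩
  exact Finset.single_le_sum (f := fun k => ∫ x,
    (llr (marginal G k) (marginal F k) x - infoI F G k) ^ 2 ∂(marginal G k))
    (fun k _ => integral_nonneg fun x => sq_nonneg _) (Finset.mem_univ k)

/-- A non-asymptotic lower bound for the optimal worst-case delay. -/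
theorem le_optimalDelay (h : ∀ k ∈ affected F G, marginal G k ≪ marginal F k ∧
    marginal F k ≪ marginal G k) {v I : ℝ} (hv : 0 ≤ v)
    (hvar : ∀ k, Integrable (fun x => llr (marginal G k) (marginal F k) x) (marginal G k) ∧
      Integrable (fun x => (llr (marginal G k) (marginal F k) x - infoI F G k) ^ 2)
        (marginal G k) ∧
      ∫ x, (llr (marginal G k) (marginal F k) x - infoI F G k) ^ 2 ∂(marginal G k) ≤ v)
    (hI : ∀ k, infoI F G k ≤ I) {γ b : ℝ} (hγ : 0 < γ) (hb : 0 < b) {m : ℕ} (hm : 1 ≤ m) :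
    ENNReal.ofReal (m * (1 - (2 * m / γ * Real.exp (m * I + b) + m * v / b ^ 2))) ≤
      optimalDelay F G γ := by
  refine le_iInf₂ fun p hp => ?_
  obtain ⟨ν, hν0, hν⟩ := exists_falseAlarm_le hγ hp hm
  set E : Set p.Ω := {ω | (ν : ℕ∞) < p.T ω} with hE
  set E' : Set p.Ω := {ω | ((ν + m : ℕ) : ℕ∞) < p.T ω} with hE'
  have hEm : MeasurableSet[obsSigma p.S ν] E := measurableSet_lt_T p ν
  have hE'm : MeasurableSet[obsSigma p.S (ν + m)] E' := measurableSet_lt_T p (ν + m)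
  have hEmm : MeasurableSet[obsSigma p.S (ν + m)] E := obsSigma_mono p.S (by omega) _ hEm
  set P := p.law F G ν with hP
  -- No alarm up to ν is an event before the change, so its probability is the same under both laws.
  have hPE : P E = p.lawInf F E := by
    have hind : Measurable[pastSigma p.R (∀ k, 𝓧 k) ν] (E.indicator fun _ => (1 : ℝ≥0∞)) :=
      Measurable.indicator measurable_const (obsSigma_le_pastSigma p ν _ hEm)
    have h1 := seqLaw_lintegral_congr (p := p) (ℓ := fun n => if n < ν then F else G)
      (ℓ' := fun _ => F) (N := ν) (fun n hn => if_pos hn) hind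
    rw [lintegral_indicator (p.obsSigma_le ν _ hEm),
      lintegral_indicator (p.obsSigma_le ν _ hEm)] at h1
    simp only [lintegral_const, one_mul, Measure.restrict_apply_univ] at h1
    exact h1
  set g : (Σ k, 𝓧 k) → ℝ := fun s => llrObs F G s - infoI F G s.1 with hg
  have hgk : ∀ k, Measurable fun w : 𝓧 k => g ⟨k, w⟩ := fun k =>
    (measurable_llr (marginal G k) (marginal F k)).sub
      (measurable_const (a := infoI F G k))
  have hgm : Measurable g := by
    intro B hB
    exact MeasurableSpace.measurableSet_iInf.2 fun k => hgk k hB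
  set W : p.Ω → ℝ := fun ω => ∑ i ∈ Finset.range m, g (obs p.S (ν + i) ω) with hW
  have hWm : Measurable[obsSigma p.S (ν + m)] W := by
    refine Finset.measurable_sum _ fun i hi => ?_
    refine (hgm.comp (measurable_obs (ν + i))).mono ?_ le_rfl
    exact obsSigma_mono p.S (by have := Finset.mem_range.1 hi; omega)
  have hcheb : ∫⁻ ω in E, ENNReal.ofReal (W ω ^ 2) ∂P ≤ ENNReal.ofReal (m * v) * P E :=
    setLIntegral_sum_sq_le (p := p) (ℓ := fun n => if n < ν then F else G) hv
      (fun n hn => if_neg (by omega)) hgk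
      (fun k => (hvar k).1.sub (integrable_const (infoI F G k)))
      (fun k => by
        simp only [hg, llrObs]
        rw [integral_sub (hvar k).1 (integrable_const _)]
        simp [infoI])
      (fun k => (hvar k).2.1) (fun k => (hvar k).2.2) hEm m
  have hWms : MeasurableSet {ω | b < W ω} :=
    measurableSet_lt measurable_const (hWm.mono (p.obsSigma_le _) le_rfl)
  have hbad : P (E ∩ {ω | b < W ω}) ≤ ENNReal.ofReal (m * v / b ^ 2) * P E := by
    have h1 : ENNReal.ofReal (b ^ 2) * P (E ∩ {ω | b < W ω}) ≤
        ENNReal.ofReal (m * v) * P E := by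
      refine le_trans ?_ hcheb
      rw [← setLIntegral_const]
      calc _ ≤ ∫⁻ ω in E ∩ {ω | b < W ω}, ENNReal.ofReal (W ω ^ 2) ∂P := by
            refine setLIntegral_mono' ((p.obsSigma_le ν _ hEm).inter hWms) fun ω hω => ?_
            refine ENNReal.ofReal_le_ofReal ?_
            have : b < W ω := hω.2
            gcongr
        _ ≤ _ := lintegral_mono_set Set.inter_subset_left
    have hb2 : 0 < b ^ 2 := by positivity
    rw [ENNReal.ofReal_div_of_pos hb2, ENNReal.div_eq_inv_mul, mul_assoc,
      ← ENNReal.mul_le_iff_le_inv (by simpa using hb.ne') ENNReal.ofReal_ne_top]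
    exact h1
  -- An alarm within m steps without a large deviation: its probability before the change is
  -- inflated by at most exp(mI + b).
  have hgood : P ((E \ E') ∩ {ω | b < W ω}ᶜ) ≤
      ENNReal.ofReal (2 * m / γ * Real.exp (m * I + b)) * P E := by
    set C := (E \ E') ∩ {ω | b < W ω}ᶜ with hC
    have hWms' : MeasurableSet[obsSigma p.S (ν + m)] {ω | b < W ω} :=
      hWm measurableSet_Ioi
    have hCm : MeasurableSet[obsSigma p.S (ν + m)] C :=
      @MeasurableSet.inter _ (obsSigma p.S (ν + m)) _ _
        (@MeasurableSet.diff _ (obsSigma p.S (ν + m)) _ _ hEmm hE'm)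
        (@MeasurableSet.compl _ _ (obsSigma p.S (ν + m)) hWms')
    have hCm' := p.obsSigma_le _ _ hCm
    have h1 := lintegral_law_eq (p := p) h ν m (φ := C.indicator fun _ => 1)
      (Measurable.indicator measurable_const hCm)
    rw [lintegral_indicator hCm'] at h1
    simp only [lintegral_const, one_mul, Measure.restrict_apply_univ] at h1
    change P C = _ at h1
    rw [h1]
    calc _ ≤ ∫⁻ ω, (E \ E').indicator (fun _ => ENNReal.ofReal (Real.exp (m * I + b))) ω
          ∂(p.lawInf F) := by
          refine lintegral_mono fun ω => ?_
          by_cases hω : ω ∈ C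
          · have hω1 : ω ∈ E \ E' := hω.1
            rw [Set.indicator_of_mem hω, Set.indicator_of_mem hω1, one_mul]
            refine ENNReal.ofReal_le_ofReal (Real.exp_le_exp.2 ?_)
            have hb' : W ω ≤ b := not_lt.1 hω.2
            -- The log-likelihood ratio is its centred part plus the information of the sampled
            -- sources, which no sampling rule can raise above I per step.
            have : logRatio p F G ν m ω =
                W ω + ∑ i ∈ Finset.range m, infoI F G (obs p.S (ν + i) ω).1 := by
              simp only [hW, hg, logRatio, Finset.sum_sub_distrib]
              ring
            have h2 : ∑ i ∈ Finset.range m, infoI F G (obs p.S (ν + i) ω).1 ≤ m * I := by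
              calc _ ≤ ∑ _i ∈ Finset.range m, I := Finset.sum_le_sum fun i _ => hI _
                _ = _ := by simp
            linarith
          · rw [Set.indicator_of_notMem hω, zero_mul]; exact zero_le
      _ = ENNReal.ofReal (Real.exp (m * I + b)) * p.lawInf F (E \ E') := by
          rw [lintegral_indicator ((p.obsSigma_le _ _ hEm).diff (p.obsSigma_le _ _ hE'm)),
            setLIntegral_const]
      _ ≤ ENNReal.ofReal (Real.exp (m * I + b)) *
            (ENNReal.ofReal (2 * m / γ) * p.lawInf F E) := by gcongr
      _ = _ := by
          rw [hPE, ← mul_assoc, ENNReal.ofReal_mul (by positivity), mul_comm (ENNReal.ofReal _)]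
  set c := 2 * m / γ * Real.exp (m * I + b) + m * v / b ^ 2 with hc
  have hc0 : 0 ≤ c := by positivity
  have hE'E : E' ⊆ E := by
    intro ω hω
    have hω' : ((ν + m : ℕ) : ℕ∞) < p.T ω := hω
    refine lt_of_le_of_lt (b := ((ν + m : ℕ) : ℕ∞)) ?_ hω'
    exact_mod_cast Nat.le_add_right ν m
  have hsplit : P E ≤ P E' + ENNReal.ofReal c * P E := by
    calc P E ≤ P (E' ∪ ((E \ E') ∩ {ω | b < W ω}ᶜ ∪ E ∩ {ω | b < W ω})) := by
          refine measure_mono fun ω hω => ?_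
          by_cases h1 : ω ∈ E'
          · exact Or.inl h1
          · by_cases h2 : b < W ω
            · exact Or.inr (Or.inr ⟨hω, h2⟩)
            · exact Or.inr (Or.inl ⟨⟨hω, h1⟩, h2⟩)
      _ ≤ P E' + (P ((E \ E') ∩ {ω | b < W ω}ᶜ) + P (E ∩ {ω | b < W ω})) :=
          (measure_union_le _ _).trans (by gcongr; exact measure_union_le _ _)
      _ ≤ P E' + (ENNReal.ofReal (2 * m / γ * Real.exp (m * I + b)) * P E +
            ENNReal.ofReal (m * v / b ^ 2) * P E) := by gcongr
      _ = _ := by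
          rw [← add_mul, ← ENNReal.ofReal_add (by positivity) (by positivity)]
  have hdelay : m * P E' ≤ p.delay F G * P E := by
    refine le_trans ?_ (le_delay (F := F) (G := G) p ν)
    calc (m : ℝ≥0∞) * P E' = ∑ n ∈ Finset.range m, P E' := by simp
      _ ≤ ∑ n ∈ Finset.range m, P {ω | ((ν + n : ℕ) : ℕ∞) < p.T ω} := by
          refine Finset.sum_le_sum fun n hn => measure_mono fun ω hω => ?_
          have hω' : ((ν + m : ℕ) : ℕ∞) < p.T ω := hω
          refine lt_of_le_of_lt (b := ((ν + m : ℕ) : ℕ∞)) ?_ hω'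
          have := Finset.mem_range.1 hn
          exact_mod_cast (by omega : ν + n ≤ ν + m)
      _ ≤ _ := ENNReal.sum_le_tsum _
  have hfinal : (m : ℝ≥0∞) * P E ≤ (p.delay F G + m * ENNReal.ofReal c) * P E := by
    calc (m : ℝ≥0∞) * P E ≤ m * (P E' + ENNReal.ofReal c * P E) := by gcongr
      _ = m * P E' + m * ENNReal.ofReal c * P E := by ring
      _ ≤ p.delay F G * P E + m * ENNReal.ofReal c * P E := by gcongr
      _ = _ := by ring
  have hPE0 : P E ≠ 0 := by rw [hPE]; exact hν0
  have h5 : (m : ℝ≥0∞) ≤ p.delay F G + m * ENNReal.ofReal c :=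
    (ENNReal.mul_le_mul_iff_left hPE0 (measure_ne_top _ _)).1 hfinal
  rw [mul_sub, mul_one, ENNReal.ofReal_sub _ (by positivity), ENNReal.ofReal_natCast,
    tsub_le_iff_right, ENNReal.ofReal_mul (by positivity), ENNReal.ofReal_natCast]
  exact h5

end LowerBound

end RoundRobinCusum

namespace RoundRobinCusum

universe u

/-! ### A Lyapunov function for the delay of the round robin CUSUM -/

section Potential

variable {K : ℕ} [NeZero K]

/-- Bounds for the increments of the round robin CUSUM: those of the sources at the positions in
`good` drift upwards, the other ones downwards. -/
structure DriftBounds (μ : Fin K → Measure ℝ) (good : Finset (Fin K)) where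
  /-- the upward drift after truncation -/
  c : ℝ
  /-- the truncation level from above -/
  M : ℝ
  /-- the downward drift after truncation -/
  j : ℝ
  /-- the truncation level from below -/
  L : ℝ
  /-- a bound for the exponential moments -/
  κ : ℝ
  /-- the exponents -/
  r : Fin K → ℝ
  /-- the distance to the next good position -/
  D : Fin K → ℕ
  c_pos : 0 < c
  M_nonneg : 0 ≤ M
  j_pos : 0 < j
  L_nonneg : 0 ≤ L
  κ_nonneg : 0 ≤ κ
  κ_lt_one : κ < 1
  r_pos : ∀ d ∈ good, 0 < r d
  integrable_min : ∀ d ∈ good, Integrable (fun t => min t M) (μ d)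
  le_integral_min : ∀ d ∈ good, c ≤ ∫ t, min t M ∂(μ d)
  integrable_exp : ∀ d ∈ good, Integrable (fun t => Real.exp (-(r d * t))) (μ d)
  integral_exp_le : ∀ d ∈ good, ∫ t, Real.exp (-(r d * t)) ∂(μ d) ≤ κ
  integrable_max : ∀ d ∉ good, Integrable (fun t => max t (-L)) (μ d)
  integral_max_le : ∀ d ∉ good, ∫ t, max t (-L) ∂(μ d) ≤ -j
  D_lt : ∀ d ∉ good, D (d + 1) < D d

namespace DriftBounds

variable {μ : Fin K → Measure ℝ} {good : Finset (Fin K)} (b : DriftBounds μ good)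

/-- The cost of visiting a position that is not good. -/
def C : ℝ := b.L / b.j

/-- The cost of leaving a good position. -/
def β : ℝ := b.C * (∑ d, (b.D d : ℝ) + 1) / (1 - b.κ)

/-- A bound for the expected remaining time, up to the threshold `A`. -/
def potential (A : ℝ) (s : Fin K × ℝ) : ℝ :=
  if s.1 ∈ good then
    (A + b.M - max s.2 0) / b.c +
      (if s.2 ≤ 0 then b.β * b.κ else b.β * Real.exp (-(b.r s.1 * s.2)))
  else (A + b.M) / b.c + b.β * b.κ + b.C * b.D s.1 + (max s.2 0 + b.L) / b.j

theorem C_nonneg : 0 ≤ b.C := div_nonneg b.L_nonneg b.j_pos.le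

theorem sum_D_nonneg : 0 ≤ ∑ d, (b.D d : ℝ) := Finset.sum_nonneg fun _ _ => Nat.cast_nonneg _

theorem β_nonneg : 0 ≤ b.β :=
  div_nonneg (mul_nonneg b.C_nonneg (by linarith [b.sum_D_nonneg])) (by linarith [b.κ_lt_one])

/-- The self-consistency equation defining β: leaving a good position costs a tour through the
others and then a fresh good visit, charged βκ. -/
theorem β_eq : b.β * b.κ + b.C * (∑ d, (b.D d : ℝ) + 1) = b.β := by
  have : 1 - b.κ ≠ 0 := by linarith [b.κ_lt_one]
  have h : b.β * (1 - b.κ) = b.C * (∑ d, (b.D d : ℝ) + 1) := div_mul_cancel₀ _ this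
  linarith

theorem measurable_potential (A : ℝ) : Measurable (b.potential A) := by
  have hr : Measurable (fun s : Fin K × ℝ => b.r s.1) :=
    (measurable_of_countable b.r).comp measurable_fst
  have hD : Measurable (fun s : Fin K × ℝ => (b.D s.1 : ℝ)) :=
    (measurable_of_countable (fun d => (b.D d : ℝ))).comp measurable_fst
  have hs : MeasurableSet {s : Fin K × ℝ | s.1 ∈ good} :=
    measurable_fst (MeasurableSet.of_discrete (s := {d : Fin K | d ∈ good}))
  refine Measurable.ite hs ?_ (by fun_prop)
  refine Measurable.add (by fun_prop) (Measurable.ite ?_ (by fun_prop) (by fun_prop))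
  exact measurableSet_le measurable_snd measurable_const

/-- C times D prepays the bad positions ahead; the final C leaves room for one more visit. -/
theorem potential_fresh_le {A y : ℝ} (d : Fin K) (hy : y ≤ 0) :
    b.potential A (d, y) ≤ (A + b.M) / b.c + b.β * b.κ + b.C * b.D d + b.C := by
  have h1 := mul_nonneg b.C_nonneg (Nat.cast_nonneg (α := ℝ) (b.D d))
  have h2 := b.C_nonneg
  unfold potential
  by_cases hd : d ∈ good
  · simp only [hd, hy, if_true, max_eq_right hy, sub_zero]
    linarith
  · simp only [hd, if_false, max_eq_right hy, zero_add]
    exact le_of_eq rfl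

theorem potential_fresh_le_β {A y : ℝ} (d : Fin K) (hy : y ≤ 0) :
    b.potential A (d, y) ≤ (A + b.M) / b.c + b.β := by
  refine (b.potential_fresh_le d hy).trans ?_
  have h : (b.D d : ℝ) ≤ ∑ d, (b.D d : ℝ) :=
    Finset.single_le_sum (f := fun d => (b.D d : ℝ)) (fun _ _ => Nat.cast_nonneg _)
      (Finset.mem_univ d)
  have h' := mul_le_mul_of_nonneg_left h b.C_nonneg
  linarith [b.β_eq]

/-- Only a positive statistic on a position that is not good exceeds the target (A + M)/c + β; that
excess is averaged separately over the past. -/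
theorem potential_le {A : ℝ} (s : Fin K × ℝ) :
    b.potential A s ≤ ((A + b.M) / b.c + b.β) +
      (if s.1 ∈ good then 0 else max s.2 0) / b.j := by
  obtain ⟨d, y⟩ := s
  have hβ := b.β_nonneg
  by_cases hd : d ∈ good
  · simp only [potential, hd, if_true, zero_div, add_zero]
    refine add_le_add ?_ ?_
    · have := b.c_pos
      gcongr
      linarith [le_max_right y 0]
    · split_ifs with hy
      · exact mul_le_of_le_one_right hβ b.κ_lt_one.le
      · refine mul_le_of_le_one_right hβ (Real.exp_le_one_iff.2 ?_)
        have := mul_pos (b.r_pos d hd) (not_le.1 hy)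
        linarith
  · have h := b.potential_fresh_le_β (A := A) d le_rfl
    simp only [potential, hd, if_false, max_self, zero_add] at h ⊢
    rw [add_div (max y 0)]
    linarith

/-- A Foster-type drift condition: before the alarm the mean potential drops by at least one per
step. On good positions the term in y supplies the drop and the exponential term does not grow. On
the others the term y/j supplies it, and D decreases at a switch. -/
theorem lintegral_potential_add_one_le [∀ d, IsProbabilityMeasure (μ d)] {A : ℝ} (hA : 0 < A)
    {s : Fin K × ℝ} (hs : s.2 < A) :
    ∫⁻ t, ({s' : Fin K × ℝ | s'.2 < A}.indicator (fun s' => ENNReal.ofReal (b.potential A s')))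
      (rrNext s t) ∂(μ s.1) + 1 ≤ ENNReal.ofReal (b.potential A s) := by
  obtain ⟨d, y⟩ := s
  have hβ := b.β_nonneg
  have hc := b.c_pos
  have hj := b.j_pos
  have hyA : max y 0 < A := max_lt hs hA
  -- An integrable majorant of the next potential in terms of the increment t, valid whether or not
  -- the source is changed.
  set ψ : ℝ → ℝ := fun t => if d ∈ good then
      (A + b.M - (max y 0 + min t b.M)) / b.c + b.β * Real.exp (-(b.r d * (max y 0 + t)))
    else (A + b.M) / b.c + b.β * b.κ + b.C * b.D d + (max y 0 + max t (-b.L) + b.L) / b.j with hψ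
  have hψ0 : ∀ t, 0 ≤ ψ t := by
    intro t
    simp only [hψ]
    split_ifs with hd
    · have h1 : 0 ≤ A + b.M - (max y 0 + min t b.M) := by linarith [min_le_right t b.M]
      positivity
    · have h1 : 0 ≤ max y 0 + max t (-b.L) + b.L := by
        linarith [le_max_right t (-b.L), le_max_right y 0]
      have := b.M_nonneg
      have := b.κ_nonneg
      have := b.C_nonneg
      positivity
  have hle : ∀ t, max y 0 + t < A → b.potential A (rrNext (d, y) t) ≤ ψ t := by
    intro t ht
    by_cases hd : d ∈ good
    · simp only [hψ, hd, if_true]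
      by_cases hy' : max y 0 + t ≤ 0
      · have e : rrNext (d, y) t = (d + 1, max y 0 + t) := by simp [rrNext, hy']
        rw [e]
        refine (b.potential_fresh_le_β _ hy').trans ?_
        refine add_le_add ?_ ?_
        · gcongr
          linarith [min_le_left t b.M]
        · refine le_mul_of_one_le_right hβ (Real.one_le_exp ?_)
          have := mul_nonpos_of_nonneg_of_nonpos (b.r_pos d hd).le hy'
          linarith
      · have e : rrNext (d, y) t = (d, max y 0 + t) := by simp [rrNext, hy']
        rw [e]
        simp only [potential, hd, hy', if_true, if_false]
        rw [max_eq_left (not_le.1 hy').le]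
        gcongr
        linarith [min_le_left t b.M]
    · simp only [hψ, hd, if_false]
      by_cases hy' : max y 0 + t ≤ 0
      · have e : rrNext (d, y) t = (d + 1, max y 0 + t) := by simp [rrNext, hy']
        rw [e]
        refine (b.potential_fresh_le _ hy').trans ?_
        have hD : (b.D (d + 1) : ℝ) + 1 ≤ b.D d := by exact_mod_cast b.D_lt d hd
        have hCD := mul_le_mul_of_nonneg_left hD b.C_nonneg
        have h1 : 0 ≤ (max y 0 + max t (-b.L) + b.L) / b.j := by
          refine div_nonneg ?_ hj.le
          linarith [le_max_right t (-b.L), le_max_right y 0]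
        linarith
      · have e : rrNext (d, y) t = (d, max y 0 + t) := by simp [rrNext, hy']
        rw [e]
        simp only [potential, hd, if_false]
        rw [max_eq_left (not_le.1 hy').le]
        gcongr
        exact le_max_left _ _
  have hψi : Integrable ψ (μ d) := by
    by_cases hd : d ∈ good
    · simp only [hψ, hd, if_true]
      refine Integrable.add ?_ ?_
      · have := b.integrable_min d hd
        exact ((integrable_const _).sub ((integrable_const _).add this)).div_const _
      · have e : ∀ t, b.β * Real.exp (-(b.r d * (max y 0 + t))) =
            b.β * Real.exp (-(b.r d * max y 0)) * Real.exp (-(b.r d * t)) := fun t => by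
          rw [mul_assoc, ← Real.exp_add]; ring_nf
        simp_rw [e]
        exact (b.integrable_exp d hd).const_mul _
    · simp only [hψ, hd, if_false]
      have := b.integrable_max d hd
      exact (integrable_const _).add
        ((((integrable_const _).add this).add (integrable_const _)).div_const _)
  have hψint : ∫ t, ψ t ∂(μ d) + 1 ≤ b.potential A (d, y) := by
    by_cases hd : d ∈ good
    · have i1 := b.integrable_min d hd
      have i2 := b.integrable_exp d hd
      have e : ∀ t, ψ t = ((A + b.M - max y 0) / b.c - b.c⁻¹ * min t b.M) +
          b.β * Real.exp (-(b.r d * max y 0)) * Real.exp (-(b.r d * t)) := fun t => by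
        simp only [hψ, hd, if_true]
        rw [mul_assoc, ← Real.exp_add]
        ring_nf
      have i3 : Integrable (fun t => (A + b.M - max y 0) / b.c - b.c⁻¹ * min t b.M) (μ d) :=
        (integrable_const _).sub (i1.const_mul _)
      simp_rw [e]
      rw [integral_add i3 (i2.const_mul _), integral_sub (integrable_const _) (i1.const_mul _), integral_const_mul, integral_const_mul]
      simp only [integral_const, probReal_univ, smul_eq_mul, one_mul]
      have h1 : 1 ≤ b.c⁻¹ * ∫ t, min t b.M ∂(μ d) := by
        rw [← inv_mul_cancel₀ hc.ne']
        have := b.le_integral_min d hd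
        gcongr
      have h2 := b.integral_exp_le d hd
      simp only [potential, hd, if_true]
      -- From a nonpositive statistic, which acts as 0, one step averages to at most βκ; this
      -- explains the value of the potential there.
      have h3 : b.β * Real.exp (-(b.r d * max y 0)) * ∫ t, Real.exp (-(b.r d * t)) ∂(μ d) ≤
          if y ≤ 0 then b.β * b.κ else b.β * Real.exp (-(b.r d * y)) := by
        split_ifs with hy
        · rw [max_eq_right hy, mul_zero, neg_zero, Real.exp_zero, mul_one]
          gcongr
        · rw [max_eq_left (not_le.1 hy).le]
          refine mul_le_of_le_one_right (by positivity) (h2.trans b.κ_lt_one.le)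
      linarith
    · have i1 := b.integrable_max d hd
      have e : ∀ t, ψ t = ((A + b.M) / b.c + b.β * b.κ + b.C * b.D d + (max y 0 + b.L) / b.j) +
          b.j⁻¹ * max t (-b.L) := fun t => by
        simp only [hψ, hd, if_false]
        ring
      simp_rw [e]
      rw [integral_add (integrable_const _) (i1.const_mul _), integral_const_mul]
      simp only [integral_const, probReal_univ, smul_eq_mul, one_mul]
      have h1 : b.j⁻¹ * ∫ t, max t (-b.L) ∂(μ d) ≤ -1 := by
        have := mul_le_mul_of_nonneg_left (b.integral_max_le d hd) (inv_pos.2 hj).le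
        rwa [mul_neg, inv_mul_cancel₀ hj.ne'] at this
      simp only [potential, hd, if_false]
      linarith
  calc _ ≤ ∫⁻ t, ENNReal.ofReal (ψ t) ∂(μ d) + 1 := by
        gcongr with t
        by_cases ht : max y 0 + t < A
        · have hm : rrNext (d, y) t ∈ {s' : Fin K × ℝ | s'.2 < A} := ht
          rw [Set.indicator_of_mem hm]
          exact ENNReal.ofReal_le_ofReal (hle t ht)
        · have hm : rrNext (d, y) t ∉ {s' : Fin K × ℝ | s'.2 < A} := ht
          rw [Set.indicator_of_notMem hm]
          exact zero_le
    _ = ENNReal.ofReal (∫ t, ψ t ∂(μ d) + 1) := by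
        rw [ENNReal.ofReal_add (integral_nonneg hψ0) zero_le_one, ENNReal.ofReal_one,
          ofReal_integral_eq_lintegral_ofReal hψi (Eventually.of_forall hψ0)]
    _ ≤ _ := ENNReal.ofReal_le_ofReal hψint

end DriftBounds

end Potential

/-! ### From the drift condition to the expected delay -/

section ExpectedDelay

variable {K : ℕ} [NeZero K] {𝓧 : Fin K → Type u} [∀ k, MeasurableSpace (𝓧 k)]
  {ξ : ∀ k, 𝓧 k → ℝ} {σ : Equiv.Perm (Fin K)} {A : ℝ} {ℓ : ℕ → ProbabilityMeasure (∀ k, 𝓧 k)}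

/-- The law of the increment of the round robin CUSUM at every position. -/
def incLaw (G : ProbabilityMeasure (∀ k, 𝓧 k)) (ξ : ∀ k, 𝓧 k → ℝ) (σ : Equiv.Perm (Fin K))
    (d : Fin K) : Measure ℝ := (marginal G (σ d)).map (ξ (σ d))

theorem isProbabilityMeasure_incLaw (G : ProbabilityMeasure (∀ k, 𝓧 k))
    (hξ : ∀ k, Measurable (ξ k)) (d : Fin K) : IsProbabilityMeasure (incLaw G ξ σ d) :=
  Measure.isProbabilityMeasure_map (hξ _).aemeasurable

theorem setLIntegral_rrSt_succ_incLaw (hξ : ∀ k, Measurable (ξ k)) (N : ℕ)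
    {E : Set (Unit × (ℕ → ∀ k, 𝓧 k))}
    (hE : MeasurableSet[pastSigma Unit (∀ k, 𝓧 k) N] E) {g : Fin K × ℝ → ℝ≥0∞}
    (hg : Measurable g) :
    ∫⁻ ω in E, g (rrSt ξ σ (N + 1) ω) ∂(unitLaw 𝓧 ℓ) =
      ∫⁻ ω in E, ∫⁻ t, g (rrNext (rrSt ξ σ N ω) t) ∂(incLaw (ℓ N) ξ σ (rrSt ξ σ N ω).1)
        ∂(unitLaw 𝓧 ℓ) := by
  rw [setLIntegral_rrSt_succ hξ N hE hg]
  refine lintegral_congr fun ω => ?_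
  rw [incLaw, lintegral_map (f := fun t => g (rrNext (rrSt ξ σ N ω) t)) _ (hξ _)]
  exact hg.comp (measurable_rrNext.comp (measurable_const.prodMk measurable_id))

/-- The expected delay is bounded by the potential of the state at the change-point. -/
theorem tsum_rrAlive_le {G : ProbabilityMeasure (∀ k, 𝓧 k)} (hξ : ∀ k, Measurable (ξ k))
    {good : Finset (Fin K)} (b : DriftBounds (incLaw G ξ σ) good) (hA : 0 < A) {ν : ℕ}
    (hℓ : ∀ n, ν ≤ n → ℓ n = G) {E : Set (Unit × (ℕ → ∀ k, 𝓧 k))}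
    (hE : MeasurableSet[pastSigma Unit (∀ k, 𝓧 k) ν] E) :
    ∑' n : ℕ, unitLaw 𝓧 ℓ (E ∩ rrAlive ξ σ A (ν + n)) ≤
      ∫⁻ ω in E ∩ rrAlive ξ σ A ν, ENNReal.ofReal (b.potential A (rrSt ξ σ ν ω))
        ∂(unitLaw 𝓧 ℓ) := by
  have hprob := isProbabilityMeasure_incLaw (σ := σ) G hξ
  set P := unitLaw 𝓧 ℓ with hP
  set J : ℕ → ℝ≥0∞ := fun n => ∫⁻ ω in E ∩ rrAlive ξ σ A (ν + n),
    ENNReal.ofReal (b.potential A (rrSt ξ σ (ν + n) ω)) ∂P with hJ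
  have hEm : ∀ n, MeasurableSet[pastSigma Unit (∀ k, 𝓧 k) (ν + n)]
      (E ∩ rrAlive ξ σ A (ν + n)) := fun n =>
    @MeasurableSet.inter _ (pastSigma Unit (∀ k, 𝓧 k) (ν + n)) _ _
      (pastSigma_mono (Nat.le_add_right ν n) _ hE) (measurableSet_rrAlive hξ _)
  have hEm' : ∀ n, MeasurableSet (E ∩ rrAlive ξ σ A (ν + n)) := fun n => pastSigma_le _ _ (hEm n)
  have hs : MeasurableSet {s' : Fin K × ℝ | s'.2 < A} :=
    measurableSet_lt measurable_snd measurable_const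
  have hφ : Measurable (fun s => ENNReal.ofReal (b.potential A s)) :=
    (b.measurable_potential A).ennreal_ofReal
  have hstep : ∀ n, J (n + 1) + P (E ∩ rrAlive ξ σ A (ν + n)) ≤ J n := by
    intro n
    have h1 : J (n + 1) = ∫⁻ ω in E ∩ rrAlive ξ σ A (ν + n),
        ({s' : Fin K × ℝ | s'.2 < A}.indicator (fun s' => ENNReal.ofReal (b.potential A s')))
          (rrSt ξ σ (ν + n + 1) ω) ∂P := by
      simp only [hJ]
      rw [← lintegral_indicator (hEm' (n + 1)), ← lintegral_indicator (hEm' n)]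
      refine lintegral_congr fun ω => ?_
      by_cases h1 : ω ∈ E ∩ rrAlive ξ σ A (ν + n)
      · rw [Set.indicator_of_mem h1]
        by_cases h2 : (rrSt ξ σ (ν + n + 1) ω).2 < A
        · have h3 : ω ∈ E ∩ rrAlive ξ σ A (ν + (n + 1)) := ⟨h1.1, mem_rrAlive_succ.2 ⟨h1.2, h2⟩⟩
          have h4 : rrSt ξ σ (ν + n + 1) ω ∈ {s' : Fin K × ℝ | s'.2 < A} := h2
          rw [Set.indicator_of_mem h3, Set.indicator_of_mem h4]
          rfl
        · have h3 : ω ∉ E ∩ rrAlive ξ σ A (ν + (n + 1)) := fun h => h2 (mem_rrAlive_succ.1 h.2).2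
          have h4 : rrSt ξ σ (ν + n + 1) ω ∉ {s' : Fin K × ℝ | s'.2 < A} := h2
          rw [Set.indicator_of_notMem h3, Set.indicator_of_notMem h4]
      · have h3 : ω ∉ E ∩ rrAlive ξ σ A (ν + (n + 1)) :=
          fun h => h1 ⟨h.1, (mem_rrAlive_succ.1 h.2).1⟩
        rw [Set.indicator_of_notMem h1, Set.indicator_of_notMem h3]
    rw [h1, hP, setLIntegral_rrSt_succ_incLaw hξ (ν + n) (hEm n) (hφ.indicator hs),
      hℓ _ (Nat.le_add_right ν n), ← hP, ← setLIntegral_one, ← lintegral_add_right _ measurable_const]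
    refine setLIntegral_mono' (hEm' n) fun ω hω => b.lintegral_potential_add_one_le hA ?_
    -- Survival says nothing about time 0, where the statistic is 0 < A.
    rcases Nat.eq_zero_or_pos (ν + n) with h0 | h0
    · rw [h0]; exact hA
    · exact mem_rrAlive.1 hω.2 _ le_rfl h0
  have hsum : ∀ n, J n + ∑ i ∈ Finset.range n, P (E ∩ rrAlive ξ σ A (ν + i)) ≤ J 0 := by
    intro n
    induction n with
    | zero => simp
    | succ n ih =>
      rw [Finset.sum_range_succ]
      calc _ = (J (n + 1) + P (E ∩ rrAlive ξ σ A (ν + n))) +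
            ∑ i ∈ Finset.range n, P (E ∩ rrAlive ξ σ A (ν + i)) := by ring
        _ ≤ J n + ∑ i ∈ Finset.range n, P (E ∩ rrAlive ξ σ A (ν + i)) := by
            gcongr; exact hstep n
        _ ≤ _ := ih
  exact ENNReal.tsum_le_of_sum_range_le fun n => le_add_self.trans (hsum n)

end ExpectedDelay

end RoundRobinCusum

namespace RoundRobinCusum

universe u

/-! ### The statistic of an unaffected source at the change-point -/

section Runs

variable {K : ℕ} [NeZero K] {𝓧 : Fin K → Type u} [∀ k, MeasurableSpace (𝓧 k)]
  {ξ : ∀ k, 𝓧 k → ℝ} {σ : Equiv.Perm (Fin K)} {A : ℝ} {ℓ : ℕ → ProbabilityMeasure (∀ k, 𝓧 k)}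

/-- The source at position `d` starts to be sampled after time `s` and is still being sampled at
time `s + n`, without alarm so far. -/
def run (ξ : ∀ k, 𝓧 k → ℝ) (σ : Equiv.Perm (Fin K)) (A : ℝ) (d : Fin K) (s n : ℕ) :
    Set (Unit × (ℕ → ∀ k, 𝓧 k)) :=
  {ω | ω ∈ rrAlive ξ σ A (s + n) ∧ (rrSt ξ σ s ω).1 = d ∧ (rrSt ξ σ s ω).2 ≤ 0 ∧
    ∀ i < n, 0 < (rrSt ξ σ (s + (i + 1)) ω).2}

theorem mem_run_succ {d : Fin K} {s n : ℕ} {ω : Unit × (ℕ → ∀ k, 𝓧 k)} :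
    ω ∈ run ξ σ A d s (n + 1) ↔
      ω ∈ run ξ σ A d s n ∧ (rrSt ξ σ (s + n + 1) ω).2 ∈ Set.Ioo 0 A := by
  constructor
  · rintro ⟨h1, h2, h3, h4⟩
    have h1' := mem_rrAlive_succ.1 h1
    exact ⟨⟨h1'.1, h2, h3, fun i hi => h4 i (by omega)⟩, h4 n (by omega), h1'.2⟩
  · rintro ⟨⟨h1, h2, h3, h4⟩, h5, h6⟩
    refine ⟨mem_rrAlive_succ.2 ⟨h1, h6⟩, h2, h3, fun i hi => ?_⟩
    rcases Nat.lt_or_ge i n with h | h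
    · exact h4 i h
    · obtain rfl : i = n := by omega
      exact h5

theorem rrSt_fst_of_mem_run {d : Fin K} {s n : ℕ} {ω : Unit × (ℕ → ∀ k, 𝓧 k)}
    (h : ω ∈ run ξ σ A d s n) : ∀ i ≤ n, (rrSt ξ σ (s + i) ω).1 = d := by
  intro i
  induction i with
  | zero => exact fun _ => h.2.1
  | succ i ih =>
    intro hi
    have h1 := h.2.2.2 i (by omega)
    have h2 := ih (by omega)
    have e : rrSt ξ σ (s + (i + 1)) ω = rrNext (rrSt ξ σ (s + i) ω)
      (ξ (σ (rrSt ξ σ (s + i) ω).1) (ω.2 (s + i) (σ (rrSt ξ σ (s + i) ω).1))) := rfl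
    rw [e] at h1 ⊢
    simp only [rrNext] at h1 ⊢
    rw [if_neg (not_le.2 h1), h2]

theorem measurableSet_run (hξ : ∀ k, Measurable (ξ k)) (d : Fin K) (s n : ℕ) :
    MeasurableSet[pastSigma Unit (∀ k, 𝓧 k) (s + n)] (run ξ σ A d s n) := by
  induction n with
  | zero =>
    have : run ξ σ A d s 0 = rrAlive ξ σ A s ∩ rrSt ξ σ s ⁻¹' ({d} ×ˢ Set.Iic 0) := by
      ext ω
      simp [run]
    rw [this]
    exact @MeasurableSet.inter _ (pastSigma Unit (∀ k, 𝓧 k) s) _ _ (measurableSet_rrAlive hξ s)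
      (measurable_rrSt hξ s ((measurableSet_singleton d).prod measurableSet_Iic))
  | succ n ih =>
    have : run ξ σ A d s (n + 1) =
        run ξ σ A d s n ∩ rrSt ξ σ (s + n + 1) ⁻¹' (Set.univ ×ˢ Set.Ioo 0 A) := by
      ext ω
      rw [mem_run_succ]
      simp
    rw [this]
    exact @MeasurableSet.inter _ (pastSigma Unit (∀ k, 𝓧 k) (s + (n + 1))) _ _
      (pastSigma_mono (by omega) _ ih)
      (measurable_rrSt hξ (s + n + 1) (MeasurableSet.univ.prod measurableSet_Ioo))

/-- On a run, the statistic evolves like a random walk that is killed when it leaves `(0, A)`. -/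
theorem setLIntegral_run {F : ProbabilityMeasure (∀ k, 𝓧 k)} (hξ : ∀ k, Measurable (ξ k))
    {d : Fin K} {s : ℕ} {E : Set (Unit × (ℕ → ∀ k, 𝓧 k))}
    (hE : MeasurableSet[pastSigma Unit (∀ k, 𝓧 k) s] E) (n : ℕ)
    (hℓ : ∀ i < s + n, ℓ i = F) {f : ℝ → ℝ≥0∞} (hf : Measurable f) (hf' : ∀ y, f y = f (max y 0)) :
    ∫⁻ ω in E ∩ run ξ σ A d s n, f (rrSt ξ σ (s + n) ω).2 ∂(unitLaw 𝓧 ℓ) =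
      unitLaw 𝓧 ℓ (E ∩ run ξ σ A d s 0) * (killedStep (incLaw F ξ σ d) A)^[n] f 0 := by
  have hprob := isProbabilityMeasure_incLaw (σ := σ) F hξ
  set P := unitLaw 𝓧 ℓ with hP
  have hEm : ∀ n, MeasurableSet[pastSigma Unit (∀ k, 𝓧 k) (s + n)] (E ∩ run ξ σ A d s n) :=
    fun n => @MeasurableSet.inter _ (pastSigma Unit (∀ k, 𝓧 k) (s + n)) _ _
      (pastSigma_mono (Nat.le_add_right s n) _ hE) (measurableSet_run hξ d s n)
  have hEm' : ∀ n, MeasurableSet (E ∩ run ξ σ A d s n) := fun n => pastSigma_le _ _ (hEm n)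
  induction n generalizing f with
  | zero =>
    rw [Function.iterate_zero, id, mul_comm, ← setLIntegral_const]
    refine setLIntegral_congr_fun (hEm' 0) fun ω hω => ?_
    -- A run starts with a nonpositive statistic, which the next step replaces by 0; `hf'` makes f
    -- ignore the difference.
    have h : (rrSt ξ σ s ω).2 ≤ 0 := hω.2.2.2.1
    change f (rrSt ξ σ s ω).2 = f 0
    rw [hf', max_eq_right h]
  | succ n ih =>
    have hind : Measurable ((Set.Ioo 0 A).indicator f) := hf.indicator measurableSet_Ioo
    rw [Function.iterate_succ_apply, ← ih (fun i hi => hℓ i (by omega))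
      (measurable_killedStep hf) (fun y => by simp only [killedStep, max_assoc, max_self])]
    have h1 : ∫⁻ ω in E ∩ run ξ σ A d s (n + 1), f (rrSt ξ σ (s + (n + 1)) ω).2 ∂P =
        ∫⁻ ω in E ∩ run ξ σ A d s n,
          (fun q : Fin K × ℝ => (Set.Ioo 0 A).indicator f q.2) (rrSt ξ σ (s + n + 1) ω) ∂P := by
      rw [← lintegral_indicator (hEm' (n + 1)), ← lintegral_indicator (hEm' n)]
      refine lintegral_congr fun ω => ?_
      by_cases h1 : ω ∈ E ∩ run ξ σ A d s n
      · rw [Set.indicator_of_mem h1]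
        by_cases h2 : (rrSt ξ σ (s + n + 1) ω).2 ∈ Set.Ioo 0 A
        · have h3 : ω ∈ E ∩ run ξ σ A d s (n + 1) := ⟨h1.1, mem_run_succ.2 ⟨h1.2, h2⟩⟩
          rw [Set.indicator_of_mem h3]
          exact (Set.indicator_of_mem h2 f).symm
        · have h3 : ω ∉ E ∩ run ξ σ A d s (n + 1) := fun h => h2 (mem_run_succ.1 h.2).2
          rw [Set.indicator_of_notMem h3]
          exact (Set.indicator_of_notMem h2 f).symm
      · have h3 : ω ∉ E ∩ run ξ σ A d s (n + 1) := fun h => h1 ⟨h.1, (mem_run_succ.1 h.2).1⟩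
        rw [Set.indicator_of_notMem h1, Set.indicator_of_notMem h3]
    rw [h1, hP, setLIntegral_rrSt_succ_incLaw hξ (s + n) (hEm n)
      (g := fun q : Fin K × ℝ => (Set.Ioo 0 A).indicator f q.2) (hind.comp measurable_snd)]
    refine setLIntegral_congr_fun (hEm' n) fun ω hω => ?_
    simp only [rrSt_fst_of_mem_run hω.2 n le_rfl, hℓ (s + n) (by omega)]
    rfl

/-- On a run of an unaffected source, the observations from the affected sources are known before
the run starts. -/
theorem exists_past_inter_run_eq {F G : ProbabilityMeasure (∀ k, 𝓧 k)} (hξ : ∀ k, Measurable (ξ k))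
    {d : Fin K} (hd : σ d ∉ affected F G) (s n : ℕ) {E : Set (Unit × (ℕ → ∀ k, 𝓧 k))}
    (hE : MeasurableSet[(roundRobin ξ hξ σ A).affectedHistory F G (s + n)] E) :
    ∃ E', MeasurableSet[pastSigma Unit (∀ k, 𝓧 k) s] E' ∧
      E ∩ run ξ σ A d s n = E' ∩ run ξ σ A d s n := by
  induction E, hE using MeasurableSpace.generateFrom_induction with
  | hC E hE _ =>
    obtain ⟨t, ht, k, hk, B, hB, rfl⟩ := hE
    rcases Nat.lt_or_ge t s with hts | hts
    · refine ⟨_, ?_, rfl⟩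
      have h1 : Measurable[pastSigma Unit (∀ k, 𝓧 k) s] (rrS ξ σ t) :=
        ((roundRobin ξ hξ σ A).measurable_S t).mono
          ((obsSigma_le_pastSigma (roundRobin ξ hξ σ A) t).trans (pastSigma_mono hts.le)) le_rfl
      have h2 : Measurable[pastSigma Unit (∀ k, 𝓧 k) s]
          (fun ω : Unit × (ℕ → ∀ k, 𝓧 k) => ω.2 t k) :=
        (measurable_pi_apply k).comp (measurable_pastSigma_eval hts)
      exact @MeasurableSet.inter _ (pastSigma Unit (∀ k, 𝓧 k) s) _ _
        (h1 (measurableSet_singleton k)) (h2 hB)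
    -- From time s on, the run samples only the unaffected source, so a generator at such a time
    -- misses the run.
    · refine ⟨∅, @MeasurableSet.empty _ (pastSigma Unit (∀ k, 𝓧 k) s), ?_⟩
      rw [Set.empty_inter, Set.eq_empty_iff_forall_notMem]
      rintro ω ⟨⟨h1, -⟩, h2⟩
      have h3 := rrSt_fst_of_mem_run h2 (t - s) (by omega)
      rw [Nat.add_sub_cancel' hts] at h3
      have h4 : σ (rrSt ξ σ t ω).1 = k := h1
      rw [h3] at h4
      exact hd (h4 ▸ hk)
  | empty => exact ⟨∅, @MeasurableSet.empty _ (pastSigma Unit (∀ k, 𝓧 k) s), rfl⟩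
  | compl E _ ih =>
    obtain ⟨E', h1, h2⟩ := ih
    refine ⟨E'ᶜ, @MeasurableSet.compl _ _ (pastSigma Unit (∀ k, 𝓧 k) s) h1, ?_⟩
    ext ω
    have := congrArg (ω ∈ ·) h2
    simp only [Set.mem_inter_iff, Set.mem_compl_iff, eq_iff_iff] at this ⊢
    tauto
  | iUnion E _ ih =>
    choose E' h1 h2 using ih
    refine ⟨⋃ i, E' i, @MeasurableSet.iUnion _ _ (pastSigma Unit (∀ k, 𝓧 k) s) _ _ h1, ?_⟩
    rw [Set.iUnion_inter, Set.iUnion_inter]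
    exact Set.iUnion_congr h2

/-- Given the observations from the affected sources, the mean of the statistic of an unaffected
source at the change-point is small compared to the threshold. -/
theorem setLIntegral_unaffected_le {F G : ProbabilityMeasure (∀ k, 𝓧 k)}
    (hξ : ∀ k, Measurable (ξ k)) {ν : ℕ} (hℓ : ∀ i < ν, ℓ i = F) {ε : ℝ}
    (hres : ∀ d, σ d ∉ affected F G → ∀ n, (killedStep (incLaw F ξ σ d) A)^[n] ENNReal.ofReal 0 ≤
      ENNReal.ofReal (ε * A) * (killedStep (incLaw F ξ σ d) A)^[n] (fun _ => 1) 0)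
    {E : Set (Unit × (ℕ → ∀ k, 𝓧 k))}
    (hE : MeasurableSet[(roundRobin ξ hξ σ A).affectedHistory F G ν] E) :
    ∫⁻ ω in E ∩ rrAlive ξ σ A ν, (if σ (rrSt ξ σ ν ω).1 ∈ affected F G then 0
      else ENNReal.ofReal (rrSt ξ σ ν ω).2) ∂(unitLaw 𝓧 ℓ) ≤
      ENNReal.ofReal (ε * A) * unitLaw 𝓧 ℓ (E ∩ rrAlive ξ σ A ν) := by
  classical
  set P := unitLaw 𝓧 ℓ with hP
  have hEm : MeasurableSet E := (roundRobin ξ hξ σ A).affectedHistory_le F G ν _ hE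
  -- The surviving event with an unaffected source under sampling is partitioned by the start s and
  -- the position d of the current run.
  set I : Finset (ℕ × Fin K) :=
    Finset.range (ν + 1) ×ˢ Finset.univ.filter (fun d => σ d ∉ affected F G) with hI
  set R : ℕ × Fin K → Set (Unit × (ℕ → ∀ k, 𝓧 k)) :=
    fun q => E ∩ run ξ σ A q.2 q.1 (ν - q.1) with hR
  have hRm : ∀ q, MeasurableSet (R q) := fun q =>
    hEm.inter (pastSigma_le _ _ (measurableSet_run hξ q.2 q.1 (ν - q.1)))
  have hIle : ∀ q ∈ I, q.1 ≤ ν := fun q hq => by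
    have := Finset.mem_range.1 (Finset.mem_product.1 hq).1
    omega
  have hIun : ∀ q ∈ I, σ q.2 ∉ affected F G := fun q hq =>
    (Finset.mem_filter.1 (Finset.mem_product.1 hq).2).2
  have hRle : ∀ q ∈ I, ∫⁻ ω in R q, ENNReal.ofReal (rrSt ξ σ ν ω).2 ∂P ≤
      ENNReal.ofReal (ε * A) * P (R q) := by
    rintro ⟨s, d⟩ hq
    have hs : s ≤ ν := hIle _ hq
    obtain ⟨n, rfl⟩ := Nat.exists_eq_add_of_le hs
    have hd := hIun _ hq
    simp only [hR, Nat.add_sub_cancel_left]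
    obtain ⟨E', h1, h2⟩ := exists_past_inter_run_eq hξ hd s n hE
    rw [h2]
    have h3 := setLIntegral_run (σ := σ) (A := A) (d := d) hξ h1 n hℓ (f := ENNReal.ofReal)
      ENNReal.measurable_ofReal (fun y => by simp only [ENNReal.ofReal, Real.toNNReal, max_assoc, max_self])
    have h4 := setLIntegral_run (σ := σ) (A := A) (d := d) hξ h1 n hℓ (f := fun _ => 1)
      measurable_const (fun y => rfl)
    rw [setLIntegral_one] at h4
    rw [h3, h4, mul_left_comm]
    gcongr
    exact hres d hd n
  have hdisj : Set.PairwiseDisjoint (I : Set (ℕ × Fin K)) R := by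
    -- The statistic is nonpositive at the start of the later run but positive during the earlier
    -- one.
    have key : ∀ q ∈ I, ∀ q' ∈ I, q.1 < q'.1 → Disjoint (R q) (R q') := by
      intro q hq q' hq' hlt
      rw [Set.disjoint_left]
      rintro ω ⟨-, h1⟩ ⟨-, h2⟩
      have h3 := h1.2.2.2 (q'.1 - q.1 - 1) (by have := hIle q' hq'; omega)
      rw [show q.1 + (q'.1 - q.1 - 1 + 1) = q'.1 by omega] at h3
      exact absurd h2.2.2.1 (not_le.2 h3)
    intro q hq q' hq' hne
    rcases lt_trichotomy q.1 q'.1 with h | h | h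
    · exact key q hq q' hq' h
    · change Disjoint (R q) (R q')
      rw [Set.disjoint_left]
      rintro ω ⟨-, h1⟩ ⟨-, h2⟩
      refine hne (Prod.ext h ?_)
      rw [← h1.2.1, ← h2.2.1, h]
    · exact (key q' hq' q hq h).symm
  have hcover : ∀ ω ∈ E ∩ rrAlive ξ σ A ν, σ (rrSt ξ σ ν ω).1 ∉ affected F G →
      ω ∈ ⋃ q ∈ I, R q := by
    rintro ω ⟨hωE, hω⟩ hun
    -- The current run starts at the last time with a nonpositive statistic, which exists since the
    -- statistic is 0 at time 0.
    have hex : ∃ s ≤ ν, (rrSt ξ σ s ω).2 ≤ 0 ∧ ∀ i, s < i → i ≤ ν → 0 < (rrSt ξ σ i ω).2 := by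
      have h0 : ∃ m, m ≤ ν ∧ (rrSt ξ σ (ν - m) ω).2 ≤ 0 := ⟨ν, le_rfl, by simp [rrState]⟩
      refine ⟨ν - Nat.find h0, by omega, (Nat.find_spec h0).2, fun i hi hi' => ?_⟩
      have := Nat.find_min h0 (m := ν - i) (by omega)
      rw [not_and, show ν - (ν - i) = i by omega] at this
      exact not_le.1 (this (by omega))
    obtain ⟨s, hs, h1, h2⟩ := hex
    have hrun : ω ∈ run ξ σ A (rrSt ξ σ s ω).1 s (ν - s) := by
      refine ⟨by rwa [Nat.add_sub_cancel' hs], rfl, h1, fun i hi => h2 _ (by omega) (by omega)⟩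
    have h3 := rrSt_fst_of_mem_run hrun (ν - s) le_rfl
    rw [Nat.add_sub_cancel' hs] at h3
    refine Set.mem_biUnion (x := (s, (rrSt ξ σ s ω).1)) ?_ ⟨hωE, hrun⟩
    refine Finset.mem_coe.2 (Finset.mem_product.2 ⟨Finset.mem_range.2 (by omega),
      Finset.mem_filter.2 ⟨Finset.mem_univ _, ?_⟩⟩)
    rw [← h3]; exact hun
  have hsub : (⋃ q ∈ I, R q) ⊆ E ∩ rrAlive ξ σ A ν := by
    refine Set.iUnion₂_subset fun q hq ω hω => ⟨hω.1, ?_⟩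
    have := hω.2.1
    rwa [Nat.add_sub_cancel' (hIle q hq)] at this
  have hUm : MeasurableSet (⋃ q ∈ I, R q) := Finset.measurableSet_biUnion _ fun q _ => hRm q
  have hEA : MeasurableSet (E ∩ rrAlive ξ σ A ν) :=
    hEm.inter (pastSigma_le _ _ (measurableSet_rrAlive hξ ν))
  calc _ ≤ ∫⁻ ω in ⋃ q ∈ I, R q, ENNReal.ofReal (rrSt ξ σ ν ω).2 ∂P := by
        rw [← lintegral_indicator hEA, ← lintegral_indicator hUm]
        refine lintegral_mono fun ω => ?_
        by_cases h1 : ω ∈ E ∩ rrAlive ξ σ A ν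
        · rw [Set.indicator_of_mem h1]
          split_ifs with h2
          · exact zero_le
          · rw [Set.indicator_of_mem (hcover ω h1 h2)]
        · rw [Set.indicator_of_notMem h1]; exact zero_le
    _ = ∑ q ∈ I, ∫⁻ ω in R q, ENNReal.ofReal (rrSt ξ σ ν ω).2 ∂P :=
        lintegral_biUnion_finset hdisj (fun q _ => hRm q) _
    _ ≤ ∑ q ∈ I, ENNReal.ofReal (ε * A) * P (R q) := Finset.sum_le_sum hRle
    _ = ENNReal.ofReal (ε * A) * P (⋃ q ∈ I, R q) := by
        rw [← Finset.mul_sum, measure_biUnion_finset hdisj fun q _ => hRm q]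
    _ ≤ _ := by gcongr

end Runs

end RoundRobinCusum

namespace RoundRobinCusum

universe u

/-! ### Upper bound for the delay of the round robin CUSUM -/

/-! ### Truncated means and the choice of the drift constants -/

section Truncation

variable {X : Type*} [MeasurableSpace X] {μ : Measure X}

theorem tendsto_integral_min {f : X → ℝ} (hf : Integrable f μ) :
    Tendsto (fun n : ℕ => ∫ x, min (f x) n ∂μ) atTop (𝓝 (∫ x, f x ∂μ)) := by
  refine tendsto_integral_of_dominated_convergence (fun x => |f x|)
    (fun n => hf.aestronglyMeasurable.inf aestronglyMeasurable_const) hf.abs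
    (fun n => Eventually.of_forall fun x => ?_) (Eventually.of_forall fun x => ?_)
  · have hn : (0 : ℝ) ≤ n := Nat.cast_nonneg n
    rw [Real.norm_eq_abs]
    refine abs_le.2 ⟨le_min (neg_abs_le _) (by linarith [abs_nonneg (f x)]), ?_⟩
    exact (min_le_left _ _).trans (le_abs_self _)
  · refine tendsto_const_nhds.congr' ?_
    filter_upwards [eventually_ge_atTop ⌈f x⌉₊] with n hn
    exact (min_eq_left ((Nat.le_ceil _).trans (by exact_mod_cast hn))).symm

theorem tendsto_integral_max {f : X → ℝ} (hf : Integrable f μ) :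
    Tendsto (fun n : ℕ => ∫ x, max (f x) (-n) ∂μ) atTop (𝓝 (∫ x, f x ∂μ)) := by
  have h := (tendsto_integral_min hf.neg).neg
  simp only [Pi.neg_apply, integral_neg, neg_neg] at h
  refine h.congr fun n => ?_
  rw [← integral_neg]
  refine integral_congr_ae (Eventually.of_forall fun x => ?_)
  simp only [← max_neg_neg, neg_neg]

end Truncation

section Existence

variable {K : ℕ} [NeZero K]

theorem exists_iterate_add_one_eq (d g : Fin K) : ∃ n : ℕ, (fun i : Fin K => i + 1)^[n] d = g := by
  have h : ∀ n : ℕ, ((fun i : Fin K => i + 1)^[n] d).val = (d.val + n) % K := by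
    intro n
    induction n with
    | zero => simp [Nat.mod_eq_of_lt d.2]
    | succ n ih =>
      rw [Function.iterate_succ_apply', Fin.val_add, ih, Fin.val_one', ← Nat.add_mod, add_assoc]
  refine ⟨g.val + K - d.val, Fin.ext ?_⟩
  rw [h, show d.val + (g.val + K - d.val) = g.val + K by omega, Nat.add_mod_right,
    Nat.mod_eq_of_lt g.2]

/-- There are finitely many positions and each inequality is strict, so common truncation levels and
a common κ < 1 exist. The distance D is the number of cyclic moves to the first good position. -/
theorem exists_driftBounds (μ : Fin K → Measure ℝ) [∀ d, IsProbabilityMeasure (μ d)]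
    {good : Finset (Fin K)} (hgood : good.Nonempty) (hint : ∀ d, Integrable (fun t => t) (μ d))
    (hexp : ∀ d ∈ good, ∃ r : ℝ, 0 < r ∧ Integrable (fun t => Real.exp (-(r * t))) (μ d) ∧
      ∫ t, Real.exp (-(r * t)) ∂(μ d) < 1)
    {c : ℝ} (hc : 0 < c) (hup : ∀ d ∈ good, c < ∫ t, t ∂(μ d))
    (hdown : ∀ d ∉ good, ∫ t, t ∂(μ d) < 0) :
    ∃ b : DriftBounds μ good, b.c = c := by
  classical
  obtain ⟨M, hM⟩ : ∃ n : ℕ, ∀ d, d ∈ good → c ≤ ∫ t, min t n ∂(μ d) := by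
    refine (eventually_all.2 fun d => ?_ : ∀ᶠ n : ℕ in atTop,
      ∀ d, d ∈ good → c ≤ ∫ t, min t n ∂(μ d)).exists
    by_cases hd : d ∈ good
    · filter_upwards [(tendsto_integral_min (hint d)).eventually_const_lt (hup d hd)] with n hn _
      exact hn.le
    · exact Eventually.of_forall fun n h => absurd h hd
  obtain ⟨j, hj, hj0⟩ : ∃ j : ℝ, (∀ d, d ∉ good → ∫ t, t ∂(μ d) < -j) ∧ 0 < j := by
    refine ((eventually_all.2 fun d => ?_ : ∀ᶠ j : ℝ in 𝓝[>] 0,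
      ∀ d, d ∉ good → ∫ t, t ∂(μ d) < -j).and self_mem_nhdsWithin).exists
    by_cases hd : d ∈ good
    · exact Eventually.of_forall fun n h => absurd hd h
    · have h := hdown d hd
      filter_upwards [nhdsWithin_le_nhds (Iio_mem_nhds (neg_pos.2 h))] with j hj _
      have : j < -∫ t, t ∂(μ d) := hj
      linarith
  obtain ⟨L, hL⟩ : ∃ n : ℕ, ∀ d, d ∉ good → ∫ t, max t (-n) ∂(μ d) ≤ -j := by
    refine (eventually_all.2 fun d => ?_ : ∀ᶠ n : ℕ in atTop,
      ∀ d, d ∉ good → ∫ t, max t (-n) ∂(μ d) ≤ -j).exists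
    by_cases hd : d ∈ good
    · exact Eventually.of_forall fun n h => absurd hd h
    · filter_upwards [(tendsto_integral_max (hint d)).eventually_lt_const (hj d hd)] with n hn _
      exact hn.le
  choose! r hr0 hri hr1 using hexp
  obtain ⟨κ, ⟨hκ, hκ1⟩, hκ0⟩ : ∃ κ : ℝ, ((∀ d, d ∈ good →
      ∫ t, Real.exp (-(r d * t)) ∂(μ d) < κ) ∧ κ < 1) ∧ 0 < κ := by
    refine (((eventually_all.2 fun d => ?_ : ∀ᶠ κ : ℝ in 𝓝[<] 1,
      ∀ d, d ∈ good → ∫ t, Real.exp (-(r d * t)) ∂(μ d) < κ).and self_mem_nhdsWithin).and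
      (nhdsWithin_le_nhds (Ioi_mem_nhds one_pos))).exists
    by_cases hd : d ∈ good
    · filter_upwards [nhdsWithin_le_nhds (Ioi_mem_nhds (hr1 d hd))] with κ hκ _
      exact hκ
    · exact Eventually.of_forall fun n h => absurd h hd
  have hex : ∀ d, ∃ n : ℕ, (fun i : Fin K => i + 1)^[n] d ∈ good := fun d => by
    obtain ⟨g, hg⟩ := hgood
    obtain ⟨n, hn⟩ := exists_iterate_add_one_eq d g
    exact ⟨n, hn ▸ hg⟩
  refine ⟨{
    c := c, M := M, j := j, L := L, κ := κ, r := r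
    D := fun d => Nat.find (hex d)
    c_pos := hc
    M_nonneg := Nat.cast_nonneg _
    j_pos := hj0
    L_nonneg := Nat.cast_nonneg _
    κ_nonneg := hκ0.le
    κ_lt_one := hκ1
    r_pos := hr0
    integrable_min := fun d _ => (hint d).inf (integrable_const _)
    le_integral_min := hM
    integrable_exp := hri
    integral_exp_le := fun d hd => (hκ d hd).le
    integrable_max := fun d _ => (hint d).sup (integrable_const _)
    integral_max_le := hL
    D_lt := fun d hd => ?_ }, rfl⟩
  have h := Nat.find_spec (hex d)
  have h0 : Nat.find (hex d) ≠ 0 := fun h0 => by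
    rw [h0] at h
    exact hd h
  obtain ⟨m, hm⟩ := Nat.exists_eq_succ_of_ne_zero h0
  rw [hm, Function.iterate_succ_apply] at h
  rw [hm]
  exact Nat.lt_succ_of_le (Nat.find_min' (hex (d + 1)) h)

end Existence

section Delay

variable {K : ℕ} [NeZero K] {𝓧 : Fin K → Type u} [∀ k, MeasurableSpace (𝓧 k)]
  {F G : ProbabilityMeasure (∀ k, 𝓧 k)}

theorem affectedHistory_le_pastSigma (p : Policy K 𝓧) (ν : ℕ) :
    p.affectedHistory F G ν ≤ pastSigma p.R (∀ k, 𝓧 k) ν := by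
  refine MeasurableSpace.generateFrom_le ?_
  rintro _ ⟨t, ht, k, -, B, hB, rfl⟩
  have h1 : Measurable[pastSigma p.R (∀ k, 𝓧 k) ν] (p.S t) :=
    (p.measurable_S t).mono ((obsSigma_le_pastSigma p t).trans (pastSigma_mono ht.le)) le_rfl
  have h2 : Measurable[pastSigma p.R (∀ k, 𝓧 k) ν]
      (fun ω : p.R × (ℕ → ∀ k, 𝓧 k) => ω.2 t k) :=
    (measurable_pi_apply k).comp (measurable_pastSigma_eval ht)
  exact @MeasurableSet.inter _ (pastSigma p.R (∀ k, 𝓧 k) ν) _ _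
    (h1 (measurableSet_singleton k)) (h2 hB)

variable {ξ : ∀ k, 𝓧 k → ℝ} {σ : Equiv.Perm (Fin K)} {A : ℝ}

/-- A non-asymptotic upper bound for the worst-case delay of the round robin CUSUM. -/
theorem roundRobin_delay_le (hξ : ∀ k, Measurable (ξ k)) {good : Finset (Fin K)}
    (hgood : ∀ d, d ∈ good ↔ σ d ∈ affected F G) (b : DriftBounds (incLaw G ξ σ) good)
    (hA : 0 < A) {ε : ℝ} (hε : 0 ≤ ε)
    (hres : ∀ d, σ d ∉ affected F G → ∀ n, (killedStep (incLaw F ξ σ d) A)^[n] ENNReal.ofReal 0 ≤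
      ENNReal.ofReal (ε * A) * (killedStep (incLaw F ξ σ d) A)^[n] (fun _ => 1) 0) :
    (roundRobin ξ hξ σ A).delay F G ≤
      ENNReal.ofReal ((A + b.M) / b.c + b.β + ε * A / b.j) := by
  refine delay_le _ fun ν E hE => ?_
  set ℓ : ℕ → ProbabilityMeasure (∀ k, 𝓧 k) := fun n => if n < ν then F else G with hℓ
  set B := (A + b.M) / b.c + b.β with hB
  have hc := b.c_pos
  have hj := b.j_pos
  have hβ := b.β_nonneg
  have hM := b.M_nonneg
  have hB0 : 0 ≤ B := by positivity
  have hEp : MeasurableSet[pastSigma Unit (∀ k, 𝓧 k) ν] E :=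
    affectedHistory_le_pastSigma (roundRobin ξ hξ σ A) ν _ hE
  have key : ∑' n : ℕ, unitLaw 𝓧 ℓ (E ∩ rrAlive ξ σ A (ν + n)) ≤
      ENNReal.ofReal (B + ε * A / b.j) * unitLaw 𝓧 ℓ (E ∩ rrAlive ξ σ A ν) := by
    calc _ ≤ ∫⁻ ω in E ∩ rrAlive ξ σ A ν, ENNReal.ofReal (b.potential A (rrSt ξ σ ν ω))
          ∂(unitLaw 𝓧 ℓ) :=
          tsum_rrAlive_le hξ b hA (fun n hn => if_neg (by omega)) hEp
      _ ≤ ∫⁻ ω in E ∩ rrAlive ξ σ A ν, (ENNReal.ofReal B + ENNReal.ofReal b.j⁻¹ *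
          (if σ (rrSt ξ σ ν ω).1 ∈ affected F G then 0 else ENNReal.ofReal (rrSt ξ σ ν ω).2))
          ∂(unitLaw 𝓧 ℓ) := by
          refine lintegral_mono fun ω => ?_
          refine (ENNReal.ofReal_le_ofReal (b.potential_le _)).trans ?_
          refine (ENNReal.ofReal_add_le).trans ?_
          gcongr
          rw [div_eq_inv_mul, ENNReal.ofReal_mul (by positivity)]
          gcongr
          simp only [hgood]
          split_ifs
          · simp
          · simp [ENNReal.ofReal, Real.toNNReal]
      _ = ENNReal.ofReal B * unitLaw 𝓧 ℓ (E ∩ rrAlive ξ σ A ν) + ENNReal.ofReal b.j⁻¹ *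
          ∫⁻ ω in E ∩ rrAlive ξ σ A ν, (if σ (rrSt ξ σ ν ω).1 ∈ affected F G then 0
            else ENNReal.ofReal (rrSt ξ σ ν ω).2) ∂(unitLaw 𝓧 ℓ) := by
          rw [lintegral_add_left measurable_const, setLIntegral_const,
            lintegral_const_mul' _ _ ENNReal.ofReal_ne_top]
      _ ≤ ENNReal.ofReal B * unitLaw 𝓧 ℓ (E ∩ rrAlive ξ σ A ν) + ENNReal.ofReal b.j⁻¹ *
          (ENNReal.ofReal (ε * A) * unitLaw 𝓧 ℓ (E ∩ rrAlive ξ σ A ν)) := by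
          gcongr
          exact setLIntegral_unaffected_le hξ (fun i hi => if_pos hi) hres hE
      _ = _ := by
          rw [← mul_assoc, ← add_mul, ← ENNReal.ofReal_mul (by positivity),
            ← ENNReal.ofReal_add hB0 (by positivity)]
          congr 3
          ring
  exact key

end Delay

end RoundRobinCusum

namespace RoundRobinCusum

universe u

/-! ### Asymptotics -/

section Asymptotics

variable {K : ℕ} [NeZero K] {𝓧 : Fin K → Type u} [∀ k, MeasurableSpace (𝓧 k)]
  {F G : ProbabilityMeasure (∀ k, 𝓧 k)}

theorem marginal_eq_of_notMem_affected {k : Fin K} (hk : k ∉ affected F G) :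
    marginal G k = marginal F k :=
  not_not.1 fun h => hk (mem_affected.2 h)

theorem infoI_eq_zero {k : Fin K} (hk : k ∉ affected F G) : infoI F G k = 0 := by
  rw [infoI, marginal_eq_of_notMem_affected hk]
  refine (integral_congr_ae (llr_self _)).trans ?_
  simp

/-- An asymptotic upper bound for the worst-case delay of the round robin CUSUM. -/
theorem eventually_roundRobin_delay_le {ξ : ∀ k, 𝓧 k → ℝ} (hξ : ∀ k, Measurable (ξ k))
    (σ : Equiv.Perm (Fin K)) (hne : (affected F G).Nonempty)
    (hint : ∀ k, Integrable (ξ k) (marginal G k))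
    (hexp : ∀ k ∈ affected F G, ∃ r : ℝ, 0 < r ∧
      Integrable (fun x => Real.exp (-(r * ξ k x))) (marginal G k) ∧
      ∫ x, Real.exp (-(r * ξ k x)) ∂(marginal G k) < 1)
    {J : ℝ} (hJ : 0 < J) (hup : ∀ k ∈ affected F G, J ≤ ∫ x, ξ k x ∂(marginal G k))
    (hdown : ∀ k ∉ affected F G, ∫ x, ξ k x ∂(marginal F k) < 0)
    (hone : ∀ k ∉ affected F G, ∫ x, Real.exp (ξ k x) ∂(marginal F k) = 1)
    (hzero : ∀ k ∉ affected F G, ¬ ∀ᵐ x ∂(marginal F k), ξ k x = 0) {δ : ℝ} (hδ : 0 < δ) :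
    ∀ᶠ A in atTop, (roundRobin ξ hξ σ A).delay F G ≤ ENNReal.ofReal ((1 + δ) * A / J) := by
  classical
  have hprob := isProbabilityMeasure_incLaw (σ := σ) G hξ
  have hprob' := isProbabilityMeasure_incLaw (σ := σ) F hξ
  set good : Finset (Fin K) := Finset.univ.filter fun d => σ d ∈ affected F G with hgood
  have hmem : ∀ d, d ∈ good ↔ σ d ∈ affected F G := fun d => by simp [hgood]
  have hmap : ∀ d, ∫ t, t ∂(incLaw G ξ σ d) = ∫ x, ξ (σ d) x ∂(marginal G (σ d)) := fun d =>
    integral_map (hξ _).aemeasurable aestronglyMeasurable_id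
  obtain ⟨b, hb⟩ := exists_driftBounds (incLaw G ξ σ) (good := good)
    (by
      obtain ⟨k, hk⟩ := hne
      exact ⟨σ.symm k, (hmem _).2 (by simpa using hk)⟩)
    (fun d => (integrable_map_measure aestronglyMeasurable_id (hξ _).aemeasurable).2 (hint _))
    (fun d hd => by
      obtain ⟨r, h0, h1, h2⟩ := hexp _ ((hmem d).1 hd)
      have hm : AEStronglyMeasurable (fun t : ℝ => Real.exp (-(r * t))) (incLaw G ξ σ d) := by
        fun_prop
      exact ⟨r, h0, (integrable_map_measure hm (hξ _).aemeasurable).2 h1,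
        (integral_map (hξ _).aemeasurable hm).trans_lt h2⟩)
    -- A drift strictly below J survives truncation and costs only the factor 1 + δ/3.
    (c := J / (1 + δ / 3)) (by positivity)
    (fun d hd => by
      rw [hmap]
      refine lt_of_lt_of_le ?_ (hup _ ((hmem d).1 hd))
      rw [div_lt_iff₀ (by positivity)]
      nlinarith)
    (fun d hd => by
      have hd' : σ d ∉ affected F G := fun h => hd ((hmem d).2 h)
      rw [hmap, marginal_eq_of_notMem_affected hd']
      exact hdown _ hd')
  have hj := b.j_pos
  -- With this ε the excess on unaffected sources is δA/(3J), one of the three thirds of δ.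
  have hε : 0 < b.j * δ / (3 * J) := by positivity
  have hres : ∀ᶠ A : ℝ in atTop, ∀ d, σ d ∉ affected F G → ∀ n,
      (killedStep (incLaw F ξ σ d) A)^[n] ENNReal.ofReal 0 ≤ ENNReal.ofReal
        (b.j * δ / (3 * J) * A) * (killedStep (incLaw F ξ σ d) A)^[n] (fun _ => 1) 0 := by
    refine eventually_all.2 fun d => ?_
    by_cases hd : σ d ∈ affected F G
    · exact Eventually.of_forall fun A h => absurd hd h
    · have h1 : ∫ t, Real.exp t ∂(incLaw F ξ σ d) = 1 :=
        (integral_map (hξ _).aemeasurable (by fun_prop)).trans (hone _ hd)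
      have h2 : ¬ ∀ᵐ t ∂(incLaw F ξ σ d), t = 0 := fun h => hzero _ hd
        ((ae_map_iff (hξ _).aemeasurable (measurableSet_singleton 0)).1 h)
      filter_upwards [eventually_killedStep_iterate_ofReal_le h1 h2 hε] with A hA _
      exact hA
  filter_upwards [hres, eventually_gt_atTop 0,
    eventually_ge_atTop ((b.M / b.c + b.β) * (3 * J / δ))] with A h1 hA h2
  refine (roundRobin_delay_le hξ hmem b hA hε.le h1).trans (ENNReal.ofReal_le_ofReal ?_)
  have h3 : b.M / b.c + b.β ≤ δ * A / (3 * J) := by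
    rw [le_div_iff₀ (by positivity)]
    have := mul_le_mul_of_nonneg_left h2 hδ.le
    field_simp at this ⊢
    linarith
  have h4 : A / b.c = (1 + δ / 3) * A / J := by
    rw [hb]; field_simp
  have h5 : b.j * δ / (3 * J) * A / b.j = δ * A / (3 * J) := by field_simp
  have h6 : (1 + δ) * A / J = (1 + δ / 3) * A / J + δ * A / (3 * J) + δ * A / (3 * J) := by
    field_simp; ring
  rw [add_div, h4, h5, h6]
  linarith

/-- An asymptotic lower bound for the optimal worst-case delay. -/
theorem eventually_le_optimalDelay (h : ∀ k ∈ affected F G, marginal G k ≪ marginal F k ∧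
    marginal F k ≪ marginal G k)
    (h_moment : ∀ k ∈ affected F G,
      Integrable (fun x => llr (marginal G k) (marginal F k) x ^ 2) (marginal G k))
    {I : ℝ} (hI0 : 0 < I) (hI : ∀ k ∈ affected F G, infoI F G k ≤ I) {δ : ℝ} (hδ : 0 < δ)
    (hδ1 : δ < 1) :
    ∀ᶠ γ in atTop, ENNReal.ofReal ((1 - δ) * Real.log γ / I) ≤ optimalDelay F G γ := by
  obtain ⟨v, hv, hvar⟩ := exists_integral_llr_sq_le h_moment
  have hI' : ∀ k, infoI F G k ≤ I := fun k => by
    by_cases hk : k ∈ affected F G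
    · exact hI k hk
    · rw [infoI_eq_zero hk]; exact hI0.le
  set η := δ / 3 with hη
  have hη0 : 0 < η := by positivity
  have hη1 : η < 1 / 3 := by rw [hη]; linarith
  -- The two error terms of `le_optimalDelay` for γ = exp(A), m ≤ A/I and b = ηA/2: the exponent -A
  -- + mI + b is at most -ηA/2, and the variance term is O(1/A).
  have hlim : Tendsto (fun A : ℝ => 2 / I * (A * Real.exp (-(η / 2) * A)) +
      v / I / (η / 2) ^ 2 * A⁻¹) atTop (𝓝 0) := by
    have h1 : Tendsto (fun A : ℝ => A * Real.exp (-(η / 2) * A)) atTop (𝓝 0) := by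
      have := tendsto_rpow_mul_exp_neg_mul_atTop_nhds_zero 1 (η / 2) (by positivity)
      simpa using this
    have := (h1.const_mul (2 / I)).add
      ((tendsto_inv_atTop_zero (𝕜 := ℝ)).const_mul (v / I / (η / 2) ^ 2))
    simpa using this
  have hA : ∀ᶠ A : ℝ in atTop, ∀ γ : ℝ, 0 < γ → Real.log γ = A →
      ENNReal.ofReal ((1 - δ) * A / I) ≤ optimalDelay F G γ := by
    filter_upwards [hlim.eventually_le_const hη0, eventually_gt_atTop 0,
      eventually_ge_atTop (I / η)] with A h1 hA0 hAI γ hγ hγA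
    set m := ⌊(1 - η) * A / I⌋₊ with hm
    have hx : 1 ≤ η * A / I := by
      rw [le_div_iff₀ hI0, one_mul]
      rw [div_le_iff₀ hη0] at hAI
      linarith
    have hsplit : (1 - η) * A / I = η * A / I + (1 - 2 * η) * A / I := by ring
    have h2η : 0 ≤ (1 - 2 * η) * A / I :=
      div_nonneg (mul_nonneg (by linarith) hA0.le) hI0.le
    have hm1 : 1 ≤ m := Nat.le_floor (by push_cast; linarith)
    have hmle : (m : ℝ) ≤ (1 - η) * A / I := Nat.floor_le (by linarith)
    have hmge : (1 - 2 * η) * A / I ≤ m := by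
      have := Nat.lt_floor_add_one ((1 - η) * A / I)
      linarith
    have hmA : (m : ℝ) ≤ A / I := by
      refine hmle.trans ?_
      gcongr
      nlinarith
    have hmI : (m : ℝ) * I ≤ (1 - η) * A := by
      rwa [le_div_iff₀ hI0] at hmle
    refine le_trans ?_ (le_optimalDelay h hv hvar hI' hγ (b := η * A / 2) (by positivity) hm1)
    refine ENNReal.ofReal_le_ofReal ?_
    have hγe : γ = Real.exp A := by rw [← hγA, Real.exp_log hγ]
    have e1 : 2 * m / γ * Real.exp (m * I + η * A / 2) ≤
        2 / I * (A * Real.exp (-(η / 2) * A)) := by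
      rw [hγe, div_eq_mul_inv, ← Real.exp_neg, mul_assoc, ← Real.exp_add]
      calc 2 * (m : ℝ) * Real.exp (-A + (m * I + η * A / 2))
          ≤ 2 * (A / I) * Real.exp (-(η / 2) * A) := by
            gcongr
            linarith
        _ = _ := by ring
    have e2 : m * v / (η * A / 2) ^ 2 ≤ v / I / (η / 2) ^ 2 * A⁻¹ := by
      calc m * v / (η * A / 2) ^ 2 ≤ A / I * v / (η * A / 2) ^ 2 := by gcongr
        _ = _ := by field_simp
    have e3 : 1 - η ≤ 1 - (2 * m / γ * Real.exp (m * I + η * A / 2) +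
        m * v / (η * A / 2) ^ 2) := by linarith
    -- With δ = 3η this is 1 - 3η ≤ (1 - 2η)(1 - η): rounding m down costs one η and the error terms
    -- another.
    calc (1 - δ) * A / I ≤ (1 - 2 * η) * A / I * (1 - η) := by
          rw [div_mul_eq_mul_div, div_le_div_iff_of_pos_right hI0]
          have : δ = 3 * η := by rw [hη]; ring
          rw [this]
          nlinarith [mul_pos hA0 (mul_pos hη0 hη0)]
      _ ≤ m * (1 - η) := by
          gcongr
          linarith
      _ ≤ _ := by gcongr
  filter_upwards [Real.tendsto_log_atTop.eventually hA, eventually_gt_atTop 0] with γ h1 h2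
  exact h1 γ h2 rfl

/-- The round robin CUSUM policy meets the false alarm constraint. -/
theorem rrPolicy_mem_Delta {𝒢 : Set (ProbabilityMeasure (∀ k, 𝓧 k))} (σ : Equiv.Perm (Fin K))
    (hint : ∀ k, Integrable (fun x => Real.exp (xi F 𝒢 k x)) (marginal F k))
    (hone : ∀ k, ∫ x, Real.exp (xi F 𝒢 k x) ∂(marginal F k) = 1) {γ : ℝ} (hγ : 0 < γ) :
    rrPolicy F 𝒢 σ γ ∈ Delta F γ := by
  have h := exp_le_lintegral_rrT (F := F) (σ := σ) (A := Real.log γ) (measurable_xi F 𝒢)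
    (fun k => by
      rw [← ofReal_integral_eq_lintegral_ofReal (hint k)
        (Eventually.of_forall fun x => (Real.exp_pos _).le), hone, ENNReal.ofReal_one])
  rw [Real.exp_log hγ] at h
  exact h

end Asymptotics

/-! ### Positivity of the drift of the mixture statistic -/

section MixtureDrift

variable {K : ℕ} {𝓧 : Fin K → Type u} [∀ k, MeasurableSpace (𝓧 k)]
  {F G : ProbabilityMeasure (∀ k, 𝓧 k)} {𝒢 : Set (ProbabilityMeasure (∀ k, 𝓧 k))}

theorem mixture_ac_marginal
    (h_ac : ∀ G ∈ 𝒢, ∀ k ∈ affected F G,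
      marginal G k ≪ marginal F k ∧ marginal F k ≪ marginal G k)
    (h_family : ∀ k, (postFamily F 𝒢 k).Nonempty ∧ (postFamily F 𝒢 k).Finite) (k : Fin K) :
    mixture F 𝒢 k ≪ marginal F k ∧ marginal F k ≪ mixture F 𝒢 k := by
  refine ⟨mixture_ac ?_, ?_⟩
  · rintro _ ⟨G, hG, rfl, hne⟩
    exact (h_ac G hG k (mem_affected.2 hne)).1
  · obtain ⟨P, hP⟩ := (h_family k).1
    refine Measure.AbsolutelyContinuous.trans ?_ (ac_mixture (h_family k).2 hP)
    obtain ⟨G, hG, rfl, hne⟩ := hP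
    exact (h_ac G hG k (mem_affected.2 hne)).2

/-- The drift of every affected source is the same as under the mixture, hence positive. -/
theorem driftJ_pos (hH : mixture F 𝒢 k ≪ marginal F k ∧ marginal F k ≪ mixture F 𝒢 k)
    (h_family : (postFamily F 𝒢 k).Nonempty ∧ (postFamily F 𝒢 k).Finite)
    (h_ne : mixture F 𝒢 k ≠ marginal F k) (hG : G ∈ 𝒢) (hk : k ∈ affected F G)
    (h_drift : ∃ c : ℝ, ∀ P ∈ postFamily F 𝒢 k,
      Integrable (xi F 𝒢 k) P ∧ ∫ x, xi F 𝒢 k x ∂P = c) : 0 < driftJ F 𝒢 G k := by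
  have := isProbabilityMeasure_mixture h_family.1 h_family.2
  obtain ⟨c, hc⟩ := h_drift
  obtain ⟨h1, h2⟩ := integral_mixture h_family.1 h_family.2 hc
  have h3 := (hc _ (marginal_mem_postFamily hG hk)).2
  rw [driftJ, h3, ← h2]
  exact integral_llr_pos hH.1 hH.2 h_ne h1

/-- The mean of exp(-ξ) is finite under the mixture, hence under each member, which is at most a
multiple of it; together with the positive drift this gives the exponent. -/
theorem exists_integral_exp_neg_xi_lt_one (hH : mixture F 𝒢 k ≪ marginal F k)
    (h_family : (postFamily F 𝒢 k).Nonempty ∧ (postFamily F 𝒢 k).Finite)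
    (hG : G ∈ 𝒢) (hk : k ∈ affected F G) (hint : Integrable (xi F 𝒢 k) (marginal G k))
    (hpos : 0 < driftJ F 𝒢 G k) :
    ∃ r : ℝ, 0 < r ∧ Integrable (fun x => Real.exp (-(r * xi F 𝒢 k x))) (marginal G k) ∧
      ∫ x, Real.exp (-(r * xi F 𝒢 k x)) ∂(marginal G k) < 1 := by
  have := isProbabilityMeasure_mixture h_family.1 h_family.2
  have h1 : Integrable (fun x => Real.exp (-xi F 𝒢 k x)) (marginal G k) :=
    ((integrable_exp_neg_llr hH).smul_measure (ENNReal.natCast_ne_top _)).mono_measure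
      (le_smul_mixture h_family.2 (marginal_mem_postFamily hG hk))
  exact exists_integral_exp_neg_lt_one hint h1 hpos

end MixtureDrift

end RoundRobinCusum

end

/-! ### The asymptotic relative efficiency and asymptotic optimality -/

theorem proposition2 {K : ℕ} [NeZero K] {𝓧 : Fin K → Type*} [∀ k, MeasurableSpace (𝓧 k)]
    (F : ProbabilityMeasure (∀ k, 𝓧 k)) (𝒢 : Set (ProbabilityMeasure (∀ k, 𝓧 k)))
    (σ : Equiv.Perm (Fin K))
    -- standing assumptions of the model
    (h_affected : ∀ G ∈ 𝒢, (RoundRobinCusum.affected F G).Nonempty)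
    (h_ac : ∀ G ∈ 𝒢, ∀ k ∈ RoundRobinCusum.affected F G,
      RoundRobinCusum.marginal G k ≪ RoundRobinCusum.marginal F k ∧
        RoundRobinCusum.marginal F k ≪ RoundRobinCusum.marginal G k)
    (h_family : ∀ k, (RoundRobinCusum.postFamily F 𝒢 k).Nonempty ∧
      (RoundRobinCusum.postFamily F 𝒢 k).Finite)
    -- the true post-change distribution, with the second-moment condition
    (G : ProbabilityMeasure (∀ k, 𝓧 k)) (hG : G ∈ 𝒢)
    (h_moment : ∀ k ∈ RoundRobinCusum.affected F G,
      Integrable (fun x => llr (RoundRobinCusum.marginal G k) (RoundRobinCusum.marginal F k) x ^ 2)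
        (RoundRobinCusum.marginal G k))
    -- the conditions on the mixtures
    (h_ne : ∀ k, RoundRobinCusum.mixture F 𝒢 k ≠ RoundRobinCusum.marginal F k)
    (h_drift_inf : ∀ k,
      Integrable (llr (RoundRobinCusum.marginal F k) (RoundRobinCusum.mixture F 𝒢 k))
        (RoundRobinCusum.marginal F k))
    (h_drift_zero : ∀ k ∈ RoundRobinCusum.affected F G, ∃ c : ℝ,
      ∀ P ∈ RoundRobinCusum.postFamily F 𝒢 k,
        Integrable (RoundRobinCusum.xi F 𝒢 k) P ∧ ∫ x, RoundRobinCusum.xi F 𝒢 k x ∂P = c) :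
    ((∀ᶠ γ in atTop, (RoundRobinCusum.rrPolicy F 𝒢 σ γ).delay F G < ⊤) ∧
      RoundRobinCusum.ARE F 𝒢 σ G ≤ ENNReal.ofReal
        ((RoundRobinCusum.affected F G).sup' (h_affected G hG) (RoundRobinCusum.infoI F G) /
          (RoundRobinCusum.affected F G).inf' (h_affected G hG)
            (RoundRobinCusum.driftJ F 𝒢 G))) ∧
    ((∀ k ∈ RoundRobinCusum.affected F G, ∃ P, RoundRobinCusum.postFamily F 𝒢 k = {P}) →
      (∀ k ∈ RoundRobinCusum.affected F G, ∀ l ∈ RoundRobinCusum.affected F G,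
        RoundRobinCusum.infoI F G k = RoundRobinCusum.infoI F G l) →
      RoundRobinCusum.AsymptoticallyOptimal F 𝒢 σ G) := by
  open RoundRobinCusum in
  have hH := mixture_ac_marginal h_ac h_family
  have hHprob : ∀ k, IsProbabilityMeasure (mixture F 𝒢 k) := fun k =>
    isProbabilityMeasure_mixture (h_family k).1 (h_family k).2
  have hJpos : ∀ k ∈ affected F G, 0 < driftJ F 𝒢 G k := fun k hk =>
    driftJ_pos (hH k) (h_family k) (h_ne k) hG hk (h_drift_zero k hk)
  have hintG : ∀ k ∈ affected F G, Integrable (xi F 𝒢 k) (marginal G k) := fun k hk => by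
    obtain ⟨c, hc⟩ := h_drift_zero k hk
    exact (hc _ (marginal_mem_postFamily hG hk)).1
  have hintF : ∀ k, Integrable (xi F 𝒢 k) (marginal F k) := fun k =>
    (integrable_congr (neg_llr (hH k).2)).1 (h_drift_inf k).neg
  have hint : ∀ k, Integrable (xi F 𝒢 k) (marginal G k) := fun k => by
    by_cases hk : k ∈ affected F G
    · exact hintG k hk
    · rw [marginal_eq_of_notMem_affected hk]; exact hintF k
  have hIpos : ∀ k ∈ affected F G, 0 < infoI F G k := fun k hk => by
    obtain ⟨v, -, hv⟩ := exists_integral_llr_sq_le h_moment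
    exact integral_llr_pos (h_ac G hG k hk).1 (h_ac G hG k hk).2 (mem_affected.1 hk) (hv k).1
  set I := (affected F G).sup' (h_affected G hG) (infoI F G) with hI
  set J := (affected F G).inf' (h_affected G hG) (driftJ F 𝒢 G) with hJ
  have hJ0 : 0 < J := (Finset.lt_inf'_iff _).2 hJpos
  have hI0 : 0 < I := by
    obtain ⟨k, hk⟩ := h_affected G hG
    exact (hIpos k hk).trans_le (Finset.le_sup' (infoI F G) hk)
  have hupper : ∀ δ : ℝ, 0 < δ → ∀ᶠ γ in atTop, (rrPolicy F 𝒢 σ γ).delay F G ≤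
      ENNReal.ofReal ((1 + δ) * Real.log γ / J) := fun δ hδ =>
    Real.tendsto_log_atTop.eventually (eventually_roundRobin_delay_le (measurable_xi F 𝒢) σ
      (h_affected G hG) hint
      (fun k hk => exists_integral_exp_neg_xi_lt_one (hH k).1 (h_family k) hG hk (hint k)
        (hJpos k hk))
      hJ0 (fun k hk => Finset.inf'_le (driftJ F 𝒢 G) hk)
      (fun k _ => integral_llr_neg (hH k).1 (hH k).2 (h_ne k) (hintF k))
      (fun k _ => integral_exp_llr (hH k).1 (hH k).2)
      (fun k _ => not_ae_llr_eq_zero (hH k).1 (hH k).2 (h_ne k)) hδ)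
  have hlower : ∀ δ : ℝ, 0 < δ → δ < 1 → ∀ᶠ γ in atTop,
      ENNReal.ofReal ((1 - δ) * Real.log γ / I) ≤ optimalDelay F G γ := fun δ hδ hδ1 =>
    eventually_le_optimalDelay (h_ac G hG) h_moment hI0
      (fun k hk => Finset.le_sup' (infoI F G) hk) hδ hδ1
  have hratio : ∀ δ : ℝ, 0 < δ → δ < 1 → ∀ᶠ γ in atTop, delayRatio F 𝒢 σ G γ ≤
      ENNReal.ofReal ((1 + δ) / (1 - δ) * (I / J)) := by
    intro δ hδ hδ1
    filter_upwards [hupper δ hδ, hlower δ hδ hδ1, eventually_gt_atTop 1] with γ h1 h2 h3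
    have hlog := Real.log_pos h3
    have h1δ : 0 < 1 - δ := by linarith
    calc delayRatio F 𝒢 σ G γ ≤ ENNReal.ofReal ((1 + δ) * Real.log γ / J) /
          ENNReal.ofReal ((1 - δ) * Real.log γ / I) := ENNReal.div_le_div h1 h2
      _ = _ := by
          rw [← ENNReal.ofReal_div_of_pos (by positivity)]
          congr 1
          field_simp
  have hARE : ARE F 𝒢 σ G ≤ ENNReal.ofReal (I / J) := by
    have hlim : Tendsto (fun δ : ℝ => ENNReal.ofReal ((1 + δ) / (1 - δ) * (I / J))) (𝓝[>] 0)
        (𝓝 (ENNReal.ofReal (I / J))) := by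
      refine ENNReal.tendsto_ofReal (Tendsto.mono_left ?_ nhdsWithin_le_nhds)
      have : ContinuousAt (fun δ : ℝ => (1 + δ) / (1 - δ) * (I / J)) 0 := by
        refine ContinuousAt.mul (ContinuousAt.div (by fun_prop) (by fun_prop) (by simp))
          continuousAt_const
      have h := this.tendsto
      simpa using h
    refine ge_of_tendsto hlim ?_
    filter_upwards [self_mem_nhdsWithin, nhdsWithin_le_nhds (Iio_mem_nhds one_pos)] with δ h1 h2
    exact limsup_le_of_le (h := hratio δ h1 h2)
  refine ⟨⟨?_, hARE⟩, fun hsingle hconst => ?_⟩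
  · filter_upwards [hupper 1 one_pos] with γ h
    exact h.trans_lt ENNReal.ofReal_lt_top
  -- With a single candidate the mixture is the true marginal, so drift and information number
  -- agree.
  · have hJI : ∀ k ∈ affected F G, driftJ F 𝒢 G k = infoI F G k := by
      intro k hk
      obtain ⟨P, hP⟩ := hsingle k hk
      have h1 : marginal G k = P := by
        have := marginal_mem_postFamily hG hk
        rw [hP] at this
        exact this
      have h2 : mixture F 𝒢 k = marginal G k := (mixture_eq_of_singleton hP).trans h1.symm
      rw [driftJ, infoI, xi, h2]
    have hIJ : I = J := by
      obtain ⟨k, hk⟩ := h_affected G hG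
      have h1 : I = infoI F G k := le_antisymm
        (Finset.sup'_le _ _ fun l hl => (hconst l hl k hk).le) (Finset.le_sup' (infoI F G) hk)
      have h2 : J = infoI F G k := le_antisymm
        ((Finset.inf'_le (driftJ F 𝒢 G) hk).trans (hJI k hk).le)
        (Finset.le_inf' _ _ fun l hl => by rw [hJI l hl, hconst l hl k hk])
      rw [h1, h2]
    rw [hIJ, div_self hJ0.ne', ENNReal.ofReal_one] at hARE
    -- The policy itself competes in the infimum. The division is legitimate because the optimal
    -- delay is eventually positive and finite.
    have hge : ∀ᶠ γ in atTop, 1 ≤ delayRatio F 𝒢 σ G γ := by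
      filter_upwards [hupper 1 one_pos, hlower (1 / 2) (by norm_num) (by norm_num),
        eventually_gt_atTop 1] with γ h1 h2 h3
      have hlog := Real.log_pos h3
      have h4 : optimalDelay F G γ ≤ (rrPolicy F 𝒢 σ γ).delay F G :=
        iInf₂_le _ (rrPolicy_mem_Delta σ (fun k => integrable_exp_llr (hH k).2)
          (fun k => integral_exp_llr (hH k).1 (hH k).2) (by linarith))
      have h5 : optimalDelay F G γ ≠ ⊤ := ne_top_of_le_ne_top ENNReal.ofReal_ne_top (h4.trans h1)
      have h6 : optimalDelay F G γ ≠ 0 := by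
        refine (lt_of_lt_of_le (ENNReal.ofReal_pos.2 ?_) h2).ne'
        have : (0 : ℝ) < 1 - 1 / 2 := by norm_num
        positivity
      rw [delayRatio, ENNReal.le_div_iff_mul_le (Or.inl h6) (Or.inl h5), one_mul]
      exact h4
    refine tendsto_of_le_liminf_of_limsup_le ?_ hARE
    exact le_liminf_of_le (h := hge)
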